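/- Let $M$ be a complex surface with complex structure $J$. A torsion-free affine connection $\nabla$ on $TM$ is complex-linear if $\nabla J=0$; its generalised geodesics are the smoothly immersed curves $\gamma$ with $\nabla_{\dot\gamma}\dot\gamma\in\mathrm{span}_{\mathbb R}(\dot\gamma,J\dot\gamma)$. A complex projective structure $[\nabla]$ is the class of complex-linear torsion-free connections with the same generalised geodesics as a given one $\nabla$. A (pseudo-)Kähler metric on an open set $V\subset M$ is compatible with $[\nabla]$ if its Levi-Civita connection is complex-linear and has the same generalised geodesics in $V$ as $\nabla$. In holomorphic coordinates $z=(z^1,z^2)$ let $\nabla_{\partial_{z^j}}\partial_{z^k}=\Gamma^i_{jk}\partial_{z^i}$ and $$\Pi^i_{jk}=\Gamma^i_{jk}-\tfrac13(\Gamma^l_{lj}\delta^i_k+\Gamma^l_{lk}\delta^i_j),\qquad \Pi_{ij}=\Pi^k_{il}\Pi^l_{jk}-\frac{\partial\Pi^k_{ij}}{\partial z^k}.$$ Let $P\subset\mathrm{PSL}(3,\mathbb C)$ be the stabiliser of $[1,0,0]^t\in\mathbb{CP}^2$. The Cartan geometry of $(M,J,[\nabla])$ is the (up to isomorphism unique)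 real Cartan geometry $(\pi:B\to M,\theta)$ of type $(\mathrm{PSL}(3,\mathbb C),P)$, $\theta=(\theta^i_j)_{i,j=0,1,2}$, such that every holomorphic coordinate system $z$ on $M$ admits a section $\sigma_z$ of $B$ over its domain with, for $i,j\in\{1,2\}$, $$\sigma_z^*\theta^0_0=0,\quad \sigma_z^*\theta^i_0=dz^i,\quad \sigma_z^*\theta^i_j=\Pi^i_{jk}\,dz^k,\quad \sigma_z^*\theta^0_i=\Pi_{ik}\,dz^k .$$ Its curvature $\Theta=d\theta+\theta\wedge\theta$ has components $\Theta^0_i=L_i\,\theta^1_0\wedge\theta^2_0+K_{il\bar\jmath}\,\theta^l_0\wedge\overline{\theta^j_0}$ and $\Theta^i_k=W^i_{kl\bar\jmath}\,\theta^l_0\wedge\overline{\theta^j_0}$ for $i,k\in\{1,2\}$, which defines the functions $K_{il\bar\jmath}$ and $W^i_{kl\bar\jmath}$ on $B$. Let $\varepsilon_{ij}$ be the antisymmetric matrix with $\varepsilon_{12}=1$ and $\varepsilon^{ij}$ its inverse matrix. Lower case indices in sums run over $1,2$. **Theorem.** Let $U\subset B$ be a connected open set on which there are smooth complex-valued functions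 $h_{i\bar\jmath}=\overline{h_{j\bar\imath}}$ and $h_i$ and a smooth real-valued function $h$ that satisfy the rank $9$ linear system $$\begin{aligned} dh_{i\bar\jmath}&=2h_{i\bar\jmath}\,\mathrm{Re}(\theta^0_0)+h_{i\bar s}\overline{\theta^s_j}+h_{s\bar\jmath}\theta^s_i+h_i\overline{\varepsilon_{sj}\theta^s_0}+\overline{h_j}\,\varepsilon_{si}\theta^s_0,\\ dh_k&=2\mathrm i\,h_k\,\mathrm{Im}(\theta^0_0)+h_l\theta^l_k+h_{k\bar\imath}\overline{\varepsilon^{ij}\theta^0_j}+\Big(\varepsilon_{kl}h-\tfrac12\overline{\varepsilon^{ij}}h_{s\bar\imath}W^s_{kl\bar\jmath}\Big)\theta^l_0,\\ dh&=-2h\,\mathrm{Re}(\theta^0_0)-2\varepsilon^{lk}\,\mathrm{Re}(h_l\theta^0_k)+\overline{\varepsilon^{ij}}\varepsilon^{kl}\,\mathrm{Re}(h_{k\bar\imath}K_{ls\bar\jmath}\theta^s_0), \end{aligned}$$ and $h_{1\bar1}h_{2\bar2}-|h_{1\bar2}|^2\neq0$ everywhere on $U$. Consider on $U$ the quadratic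 form $$g=\frac{h_{i\bar\jmath}\,\theta^i_0\circ\overline{\theta^j_0}}{(h_{1\bar1}h_{2\bar2}-|h_{1\bar2}|^2)^2}.$$ (a) Every point of $U$ has an open neighbourhood $U'\subset U$ such that $g|_{U'}$ is the $\pi$-pullback to $U'$ of a (pseudo-)Kähler metric on the open set $\pi(U')\subset M$ that is compatible with $[\nabla]$. (b) If the fibres $U\cap\pi^{-1}(x)$, $x\in M$, are connected (or empty), for instance if $U=\pi^{-1}(\pi(U))$, then $g$ is the $\pi$-pullback to $U$ of a (pseudo-)Kähler metric on the open set $\pi(U)\subset M$ that is compatible with $[\nabla]$. -/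

import Mathlib

open Set Filter Topology
open scoped Manifold ContDiff ComplexConjugate

noncomputable section

namespace CProj

/-- The model space `ℂ²` of complex surfaces. -/
abbrev CSq : Type := Fin 2 → ℂ

/-- A complex surface is in particular a smooth real manifold modelled on `ℂ² = ℝ⁴`. -/
instance realManifold {M : Type*} [TopologicalSpace M] [ChartedSpace CSq M]
    [IsManifold 𝓘(ℂ, CSq) ω M] : IsManifold 𝓘(ℝ, CSq) ∞ M := by
  refine isManifold_of_contDiffOn _ _ _ fun e e' he he' => ?_
  have h := (HasGroupoid.compatible (G := contDiffGroupoid ω 𝓘(ℂ, CSq)) he he')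
  rw [contDiffGroupoid, mem_groupoid_of_pregroupoid] at h
  have h1 : ContDiffOn ℂ ω (𝓘(ℂ, CSq) ∘ (e.symm.trans e') ∘ 𝓘(ℂ, CSq).symm)
    (𝓘(ℂ, CSq).symm ⁻¹' (e.symm.trans e').source ∩ range 𝓘(ℂ, CSq)) := h.1
  exact (h1.restrict_scalars ℝ).of_le le_top

section Surface

variable {M : Type*} [TopologicalSpace M] [ChartedSpace CSq M]

/-- Vector fields on (the real manifold underlying) a complex surface; no regularity is implied. -/
abbrev VField (M : Type*) [TopologicalSpace M] [ChartedSpace CSq M] : Type _ :=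
  (x : M) → TangentSpace 𝓘(ℝ, CSq) x

/-- The data of an affine connection: `cov Y x v` is `(∇_v Y)(x)`. -/
abbrev Conn (M : Type*) [TopologicalSpace M] [ChartedSpace CSq M] : Type _ :=
  VField M → (x : M) → TangentSpace 𝓘(ℝ, CSq) x →L[ℝ] TangentSpace 𝓘(ℝ, CSq) x

/-- Fields of symmetric bilinear forms on the tangent spaces (the symmetry is imposed later). -/
abbrev BilinField (M : Type*) [TopologicalSpace M] [ChartedSpace CSq M] : Type _ :=
  (x : M) → TangentSpace 𝓘(ℝ, CSq) x →L[ℝ] TangentSpace 𝓘(ℝ, CSq) x →L[ℝ] ℝ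

/-- The almost complex structure: multiplication by `i` in the holomorphic chart through which
the tangent space at `x` is identified with `ℂ²` (any other holomorphic chart gives the same). -/
def J (x : M) : TangentSpace 𝓘(ℝ, CSq) x →L[ℝ] TangentSpace 𝓘(ℝ, CSq) x :=
  (Complex.I • ContinuousLinearMap.id ℝ CSq : CSq →L[ℝ] CSq)

variable [IsManifold 𝓘(ℂ, CSq) ω M]

/-- Differentiability at a point of a vector field. -/
def DiffFieldAt (Y : VField M) (x : M) : Prop :=
  MDifferentiableAt 𝓘(ℝ, CSq) 𝓘(ℝ, CSq).tangent
    (fun y => (⟨y, Y y⟩ : TangentBundle 𝓘(ℝ, CSq) M)) x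

/-- Smoothness near a point of a vector field. -/
def SmoothFieldAt (Y : VField M) (x : M) : Prop :=
  ContMDiffAt 𝓘(ℝ, CSq) 𝓘(ℝ, CSq).tangent ∞
    (fun y => (⟨y, Y y⟩ : TangentBundle 𝓘(ℝ, CSq) M)) x

/-- `cov` is, over the open set `V`, a smooth torsion-free affine connection on `TM`
that is complex-linear, i.e. `∇J = 0`. -/
structure IsComplexLinearOn (cov : Conn M) (V : Set M) : Prop where
  isCov : IsCovariantDerivativeOn CSq cov V
  smooth : ContMDiffCovariantDerivativeOn CSq ∞ cov V
  torsion_free : ∀ x ∈ V, ∀ X Y : VField M, DiffFieldAt X x → DiffFieldAt Y x →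
    cov Y x (X x) - cov X x (Y x) = VectorField.mlieBracket 𝓘(ℝ, CSq) X Y x
  complex_linear : ∀ x ∈ V, ∀ Y : VField M, DiffFieldAt Y x →
    ∀ v, cov (fun y => J y (Y y)) x v = J x (cov Y x v)

/-- The velocity of a curve. -/
def velocity (γ : ℝ → M) (t : ℝ) : TangentSpace 𝓘(ℝ, CSq) (γ t) :=
  mfderiv 𝓘(ℝ, ℝ) 𝓘(ℝ, CSq) γ t (1 : ℝ)

/-- `γ : (a, b) → V` is a generalised geodesic: a smoothly immersed curve such that
`∇_γ' γ'` lies in the span of `γ'` and `Jγ'`. The value of `∇_γ' γ'` at `t` is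
`∇_X X` at `γ t`, for any local vector field `X` that extends `γ'` near `t`
(such extensions exist as `γ` is an immersion, and the value does not depend on the choice). -/
structure IsGeneralisedGeodesicOn (cov : Conn M) (V : Set M) (γ : ℝ → M) (a b : ℝ) : Prop where
  smooth : ContMDiffOn 𝓘(ℝ, ℝ) 𝓘(ℝ, CSq) ∞ γ (Ioo a b)
  mapsTo : MapsTo γ (Ioo a b) V
  immersed : ∀ t ∈ Ioo a b, velocity γ t ≠ 0
  planar : ∀ t ∈ Ioo a b, ∀ X : VField M, SmoothFieldAt X (γ t) →
    (∀ᶠ s in 𝓝 t, X (γ s) = velocity γ s) →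
    cov X (γ t) (velocity γ t) ∈
      Submodule.span ℝ {velocity γ t, J (γ t) (velocity γ t)}

/-- Complex projective equivalence over `V`: the same generalised geodesics. -/
def CProjEquivOn (cov cov' : Conn M) (V : Set M) : Prop :=
  ∀ (γ : ℝ → M) (a b : ℝ),
    IsGeneralisedGeodesicOn cov V γ a b ↔ IsGeneralisedGeodesicOn cov' V γ a b

/-- `g` is a (pseudo-)Riemannian metric over the open set `V`. Smoothness of the symmetric form
is smoothness of the function `v ↦ g(v, v)` on the tangent bundle. -/
structure IsMetricOn (g : BilinField M) (V : Set M) : Prop where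
  smooth : ContMDiffOn 𝓘(ℝ, CSq).tangent 𝓘(ℝ, ℝ) ∞
    (fun v : TangentBundle 𝓘(ℝ, CSq) M => g v.proj v.snd v.snd) {v | v.proj ∈ V}
  symm : ∀ x ∈ V, ∀ v w, g x v w = g x w v
  nondegenerate : ∀ x ∈ V, ∀ v, (∀ w, g x v w = 0) → v = 0

/-- `cov` is the Levi-Civita connection of `g` over `V`: torsion-free and `∇g = 0`. -/
structure IsLeviCivitaOn (cov : Conn M) (g : BilinField M) (V : Set M) : Prop where
  isCov : IsCovariantDerivativeOn CSq cov V
  smooth : ContMDiffCovariantDerivativeOn CSq ∞ cov V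
  torsion_free : ∀ x ∈ V, ∀ X Y : VField M, DiffFieldAt X x → DiffFieldAt Y x →
    cov Y x (X x) - cov X x (Y x) = VectorField.mlieBracket 𝓘(ℝ, CSq) X Y x
  metric : ∀ x ∈ V, ∀ Y Z : VField M, DiffFieldAt Y x → DiffFieldAt Z x → ∀ v,
    mvfderiv 𝓘(ℝ, CSq) (fun y => g y (Y y) (Z y)) x v =
      g x (cov Y x v) (Z x) + g x (Y x) (cov Z x v)

/-- `g` is a (pseudo-)Kähler metric on the open set `V`: a `J`-hermitian (pseudo-)Riemannian
metric for whose Levi-Civita connection `J` is parallel. -/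
structure IsPseudoKahlerOn (g : BilinField M) (V : Set M) : Prop where
  isMetric : IsMetricOn g V
  hermitian : ∀ x ∈ V, ∀ v w, g x (J x v) (J x w) = g x v w
  kahler : ∃ cov : Conn M, IsLeviCivitaOn cov g V ∧ IsComplexLinearOn cov V

/-- `g` is compatible over `V` with the complex projective structure `[∇]` represented
by `cov`: its Levi-Civita connection is a complex-linear connection belonging to `[∇]`. -/
def IsCompatibleOn (g : BilinField M) (cov : Conn M) (V : Set M) : Prop :=
  ∃ cov' : Conn M, IsLeviCivitaOn cov' g V ∧ IsComplexLinearOn cov' V ∧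
    CProjEquivOn cov cov' V

/-- The holomorphic coordinate systems of a complex surface. -/
def IsHolomorphicChart (z : OpenPartialHomeomorph M CSq) : Prop :=
  z ∈ IsManifold.maximalAtlas 𝓘(ℂ, CSq) ω M

/-- `dz^i` at `x`. -/
def dz (z : OpenPartialHomeomorph M CSq) (x : M) (v : TangentSpace 𝓘(ℝ, CSq) x) (i : Fin 2) : ℂ :=
  (mfderiv 𝓘(ℝ, CSq) 𝓘(ℝ, CSq) z x v : CSq) i

/-- The real coordinate field `∂/∂(Re z^k)`, i.e. the field `X` with `dz^i(X) = δ^i_k`. -/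
def coordField (z : OpenPartialHomeomorph M CSq) (k : Fin 2) : VField M := fun x =>
  (mfderiv 𝓘(ℝ, CSq) 𝓘(ℝ, CSq) z x).inverse (Pi.single k 1 : CSq)

/-- The derivative `∂f/∂z^k = ½ (∂f/∂(Re z^k) - i ∂f/∂(Im z^k))`. -/
def dWirtinger (z : OpenPartialHomeomorph M CSq) (k : Fin 2) (f : M → ℂ) (x : M) : ℂ :=
  (1 / 2 : ℂ) * (mvfderiv 𝓘(ℝ, CSq) f x (coordField z k x)
    - Complex.I * mvfderiv 𝓘(ℝ, CSq) f x (J x (coordField z k x)))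

/-- The complex Christoffel symbols `Γ^i_{jk}` of a complex-linear torsion-free connection.
As `∇_{∂/∂z^j} ∂/∂z^k = Γ^i_{jk} ∂/∂z^i` and `∇_{∂/∂\bar z^j} ∂/∂z^k = 0` for such a connection,
`∇` of the real coordinate fields is `Γ^i_{jk} ∂/∂z^i` plus its complex conjugate. -/
def christoffel (cov : Conn M) (z : OpenPartialHomeomorph M CSq) (i j k : Fin 2) (x : M) : ℂ :=
  dz z x (cov (coordField z k) x (coordField z j x)) i

/-- The complex projective invariants
`Π^i_{jk} = Γ^i_{jk} - ⅓ (Γ^l_{lj} δ^i_k + Γ^l_{lk} δ^i_j)`. -/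
def projInv (cov : Conn M) (z : OpenPartialHomeomorph M CSq) (i j k : Fin 2) (x : M) : ℂ :=
  christoffel cov z i j k x - (1 / 3 : ℂ) *
    ((∑ l, christoffel cov z l l j x) * (if i = k then 1 else 0)
      + (∑ l, christoffel cov z l l k x) * (if i = j then 1 else 0))

/-- `Π_{ij} = Π^k_{il} Π^l_{jk} - ∂Π^k_{ij}/∂z^k`. -/
def projInvLow (cov : Conn M) (z : OpenPartialHomeomorph M CSq) (i j : Fin 2) (x : M) : ℂ :=
  (∑ k, ∑ l, projInv cov z k i l x * projInv cov z l j k x)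
    - ∑ k, dWirtinger z k (projInv cov z k i j) x

end Surface

section Group

/-- `PSL(3, ℂ)`. -/
abbrev PSL3 : Type := Matrix.ProjectiveSpecialLinearGroup (Fin 3) ℂ

/-- `SL(3, ℂ)`. -/
abbrev SL3 : Type := Matrix.SpecialLinearGroup (Fin 3) ℂ

/-- The quotient map `SL(3, ℂ) → PSL(3, ℂ)`. -/
def toPSL : SL3 →* PSL3 := QuotientGroup.mk' (Subgroup.center SL3)

/-- The point `[1, 0, 0]` of the complex projective plane. -/
def basePoint : Projectivization ℂ (Fin 3 → ℂ) :=
  Projectivization.mk ℂ ![1, 0, 0] fun h => by simpa using congrFun h 0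

/-- The stabiliser `P ⊂ PSL(3, ℂ)` of the point `[1, 0, 0]`. -/
def P : Subgroup PSL3 := MulAction.stabilizer PSL3 basePoint

/-- The matrix with rows `(det a⁻¹, v)` and `(0, a)`. -/
def coverMatrix (a : Fin 2 → Fin 2 → ℂ) (v : Fin 2 → ℂ) : Matrix (Fin 3) (Fin 3) ℂ :=
  !![(a 0 0 * a 1 1 - a 0 1 * a 1 0)⁻¹, v 0, v 1; 0, a 0 0, a 0 1; 0, a 1 0, a 1 1]

theorem coverMatrix_det {a : Fin 2 → Fin 2 → ℂ} (ha : a 0 0 * a 1 1 - a 0 1 * a 1 0 ≠ 0)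
    (v : Fin 2 → ℂ) : (coverMatrix a v).det = 1 := by
  rw [Matrix.det_fin_three]
  simp [coverMatrix]
  field_simp

theorem toPSL_mem_P {A : SL3} (h1 : A.1 1 0 = 0) (h2 : A.1 2 0 = 0) : toPSL A ∈ P := by
  rw [P, MulAction.mem_stabilizer_iff]
  change A • basePoint = basePoint
  rw [basePoint, Projectivization.smul_mk, Projectivization.mk_eq_mk_iff']
  refine ⟨A.1 0 0, ?_⟩
  change _ = A.1.mulVec ![1, 0, 0]
  ext i
  fin_cases i <;> simp [Matrix.mulVec, dotProduct, Fin.sum_univ_three] <;> simp_all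

/-- The smooth covering `GL(2, ℂ) × ℂ² → P`, continued by `1` where `a` is singular. -/
def cover (a : Fin 2 → Fin 2 → ℂ) (v : Fin 2 → ℂ) : P := by
  classical
  exact if ha : a 0 0 * a 1 1 - a 0 1 * a 1 0 ≠ 0 then
    ⟨toPSL ⟨coverMatrix a v, coverMatrix_det ha v⟩, toPSL_mem_P rfl rfl⟩ else 1

end Group

section Cartan

variable {M : Type*} [TopologicalSpace M] [ChartedSpace CSq M] [IsManifold 𝓘(ℂ, CSq) ω M]
variable {F : Type*} [NormedAddCommGroup F] [NormedSpace ℝ F]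
variable {B : Type*} [TopologicalSpace B] [ChartedSpace F B] [IsManifold 𝓘(ℝ, F) ∞ B]

/-- A (real) Cartan geometry `(π : B → M, θ)` of type `(PSL(3, ℂ), P)`: a smooth principal right
`P`-bundle over `M` with a Cartan connection `θ`, a `𝔰𝔩(3, ℂ)`-valued one-form on `B`. -/
structure CartanGeometry (M : Type*) [TopologicalSpace M] [ChartedSpace CSq M]
    [IsManifold 𝓘(ℂ, CSq) ω M]
    {F : Type*} [NormedAddCommGroup F] [NormedSpace ℝ F]
    (B : Type*) [TopologicalSpace B] [ChartedSpace F B] [IsManifold 𝓘(ℝ, F) ∞ B] where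
  /-- the bundle projection -/
  proj : B → M
  /-- the right action of `P` -/
  act : B → P → B
  /-- the Cartan connection -/
  form : (b : B) → TangentSpace 𝓘(ℝ, F) b →L[ℝ] Matrix (Fin 3) (Fin 3) ℂ
  proj_smooth : ContMDiff 𝓘(ℝ, F) 𝓘(ℝ, CSq) ∞ proj
  act_one : ∀ b, act b 1 = b
  act_mul : ∀ b p q, act b (p * q) = act (act b p) q
  /-- the action is smooth; `P` carries the smooth structure of its covering `GL(2, ℂ) × ℂ²` -/
  act_smooth : ContMDiffOn (𝓘(ℝ, F).prod 𝓘(ℝ, (Fin 2 → Fin 2 → ℂ) × (Fin 2 → ℂ))) 𝓘(ℝ, F) ∞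
    (fun q : B × ((Fin 2 → Fin 2 → ℂ) × (Fin 2 → ℂ)) => act q.1 (cover q.2.1 q.2.2))
    {q | q.2.1 0 0 * q.2.1 1 1 - q.2.1 0 1 * q.2.1 1 0 ≠ 0}
  /-- the action is free -/
  act_free : ∀ b p, act b p = b → p = 1
  /-- the orbits of the action are the fibres -/
  proj_eq_iff : ∀ b b', proj b = proj b' ↔ ∃ p, act b p = b'
  /-- local triviality: there are smooth local sections -/
  local_section : ∀ x : M, ∃ (V : Set M) (s : M → B), IsOpen V ∧ x ∈ V ∧
    ContMDiffOn 𝓘(ℝ, CSq) 𝓘(ℝ, F) ∞ s V ∧ ∀ y ∈ V, proj (s y) = y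
  form_smooth : ∀ i j, ContMDiff 𝓘(ℝ, F).tangent 𝓘(ℝ, ℂ) ∞
    (fun v : TangentBundle 𝓘(ℝ, F) B => form v.proj v.snd i j)
  /-- `θ_b : T_b B → 𝔰𝔩(3, ℂ)` is an isomorphism -/
  form_trace : ∀ b v, (form b v).trace = 0
  form_injective : ∀ b, Function.Injective (form b)
  form_surjective : ∀ b, ∀ A : Matrix (Fin 3) (Fin 3) ℂ, A.trace = 0 → ∃ v, form b v = A
  /-- `R_p^* θ = Ad(p⁻¹) θ` -/
  form_equivariant : ∀ (A : SL3) (hA : toPSL A ∈ P) (b : B) (v : TangentSpace 𝓘(ℝ, F) b),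
    form (act b ⟨toPSL A, hA⟩) (mfderiv 𝓘(ℝ, F) 𝓘(ℝ, F) (fun b' => act b' ⟨toPSL A, hA⟩) b v) =
      ((A⁻¹ : SL3) : Matrix (Fin 3) (Fin 3) ℂ) * form b v * (A : Matrix (Fin 3) (Fin 3) ℂ)
  /-- `θ` maps the fundamental vector field of an element of the Lie algebra of `P`
  to this element; the latter is the velocity at `1` of a curve in the group. -/
  form_vertical : ∀ (c : ℝ → SL3) (hc : ∀ t, toPSL (c t) ∈ P), c 0 = 1 →
    (∀ i j, ContDiff ℝ ∞ fun t => (c t : Matrix (Fin 3) (Fin 3) ℂ) i j) → ∀ b : B,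
    form (act b ⟨toPSL (c 0), hc 0⟩)
        (mfderiv 𝓘(ℝ, ℝ) 𝓘(ℝ, F) (fun t : ℝ => act b ⟨toPSL (c t), hc t⟩) 0 (1 : ℝ)) =
      Matrix.of fun i j => deriv (fun t => (c t : Matrix (Fin 3) (Fin 3) ℂ) i j) 0

/-- `(B, θ)` is the Cartan geometry of the complex projective structure represented by `cov`:
every holomorphic coordinate system `z` has a section `σ_z` (necessarily unique) that pulls `θ`
back to the matrix with entries `θ^0_0 = 0`, `θ^i_0 = dz^i`, `θ^i_j = Π^i_{jk} dz^k`,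
`θ^0_i = Π_{ik} dz^k`. -/
def CartanGeometry.IsGeometryOf (C : CartanGeometry M (F := F) B) (cov : Conn M) : Prop :=
  ∀ z : OpenPartialHomeomorph M CSq, IsHolomorphicChart z → ∃ s : M → B,
    ContMDiffOn 𝓘(ℝ, CSq) 𝓘(ℝ, F) ∞ s z.source ∧ (∀ x ∈ z.source, C.proj (s x) = x) ∧
    ∀ x ∈ z.source, ∀ v : TangentSpace 𝓘(ℝ, CSq) x,
      let φ : Matrix (Fin 3) (Fin 3) ℂ := C.form (s x) (mfderiv 𝓘(ℝ, CSq) 𝓘(ℝ, F) s x v)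
      φ 0 0 = 0 ∧ (∀ i : Fin 2, φ i.succ 0 = dz z x v i) ∧
      (∀ i j : Fin 2, φ i.succ j.succ = ∑ k, projInv cov z i j k x * dz z x v k) ∧
      (∀ i : Fin 2, φ 0 i.succ = ∑ k, projInvLow cov z i k x * dz z x v k)

/-- The exterior derivative at `b` of a complex-valued one-form on `B`, computed in the chart
at `b`: `dα(u, v) = D_u α̃(v) - D_v α̃(u)`, where `α̃` is `α` read in the chart. -/
def extD (α : (b : B) → TangentSpace 𝓘(ℝ, F) b →L[ℝ] ℂ) (b : B)
    (u v : TangentSpace 𝓘(ℝ, F) b) : ℂ :=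
  let e := extChartAt 𝓘(ℝ, F) b
  let αc : F → (F →L[ℝ] ℂ) := fun y =>
    (α (e.symm y)).comp (mfderiv 𝓘(ℝ, F) 𝓘(ℝ, F) e.symm y)
  let u' : F := mfderiv 𝓘(ℝ, F) 𝓘(ℝ, F) e b u
  let v' : F := mfderiv 𝓘(ℝ, F) 𝓘(ℝ, F) e b v
  fderiv ℝ αc (e b) u' v' - fderiv ℝ αc (e b) v' u'

namespace CartanGeometry

variable (C : CartanGeometry M (F := F) B)

/-- The component `θ^i_j` of the Cartan connection. -/
def comp (i j : Fin 3) (b : B) : TangentSpace 𝓘(ℝ, F) b →L[ℝ] ℂ :=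
  ((ContinuousLinearMap.proj j).comp
    (ContinuousLinearMap.proj (R := ℝ) (φ := fun _ : Fin 3 => Fin 3 → ℂ) i)).comp (C.form b)

/-- The component `Θ^i_j` of the curvature `Θ = dθ + θ ∧ θ`. -/
def curvature (i j : Fin 3) (b : B) (u v : TangentSpace 𝓘(ℝ, F) b) : ℂ :=
  extD (C.comp i j) b u v +
    ∑ k, (C.comp i k b u * C.comp k j b v - C.comp i k b v * C.comp k j b u)

/-- The tangent vector `u` at `b` for which `θ_b(u)` has entry `c` in place `(l, 0)` and
entry `0` elsewhere. -/
def frameVec (b : B) (l : Fin 2) (c : ℂ) : TangentSpace 𝓘(ℝ, F) b :=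
  Function.invFun (C.form b) (Matrix.single l.succ 0 c)

/-- The coefficient of `θ^l_0 ∧ \bar θ^j_0` in the curvature component `Θ^i_k`, i.e. the value of
the complex-bilinear extension of `Θ^i_k` on the complexified tangent vectors `½(X_l - i X'_l)`
and `½(X_j + i X'_j)`, where `X_l`, `X'_l` are dual to the real and imaginary parts of `θ^l_0`. -/
def coeff (i k : Fin 3) (l j : Fin 2) (b : B) : ℂ :=
  (1 / 4 : ℂ) *
    (C.curvature i k b (C.frameVec b l 1) (C.frameVec b j 1)
      + Complex.I * C.curvature i k b (C.frameVec b l 1) (C.frameVec b j Complex.I)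
      - Complex.I * C.curvature i k b (C.frameVec b l Complex.I) (C.frameVec b j 1)
      + C.curvature i k b (C.frameVec b l Complex.I) (C.frameVec b j Complex.I))

/-- `W^i_{kl\bar j}`, from `Θ^i_k = W^i_{kl\bar j} θ^l_0 ∧ \bar θ^j_0`. -/
def W (i k l j : Fin 2) (b : B) : ℂ := C.coeff i.succ k.succ l j b

/-- `K_{il\bar j}`, from `Θ^0_i = L_i θ^1_0 ∧ θ^2_0 + K_{il\bar j} θ^l_0 ∧ \bar θ^j_0`. -/
def K (i l j : Fin 2) (b : B) : ℂ := C.coeff 0 i.succ l j b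

/-- `θ^0_0`. -/
def θ00 (b : B) (v : TangentSpace 𝓘(ℝ, F) b) : ℂ := C.form b v 0 0

/-- `θ^i_0`, for `i = 1, 2`. -/
def θc (i : Fin 2) (b : B) (v : TangentSpace 𝓘(ℝ, F) b) : ℂ := C.form b v i.succ 0

/-- `θ^0_i`, for `i = 1, 2`. -/
def θr (i : Fin 2) (b : B) (v : TangentSpace 𝓘(ℝ, F) b) : ℂ := C.form b v 0 i.succ

/-- `θ^i_j`, for `i, j = 1, 2`. -/
def θm (i j : Fin 2) (b : B) (v : TangentSpace 𝓘(ℝ, F) b) : ℂ := C.form b v i.succ j.succ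

/-- The antisymmetric symbol `ε_{ij}` with `ε_{12} = 1`. -/
def eps (i j : Fin 2) : ℝ := (!![0, 1; -1, 0] : Matrix (Fin 2) (Fin 2) ℝ) i j

/-- The inverse matrix `ε^{ij}` of `ε_{ij}`, so `ε^{12} = -1`. -/
def epsInv (i j : Fin 2) : ℝ := (!![0, -1; 1, 0] : Matrix (Fin 2) (Fin 2) ℝ) i j

/-- `(h_{i\bar j}, h_i, h)` is on `U` a smooth solution of the rank 9 linear system. -/
structure IsSolutionOn (hh : Fin 2 → Fin 2 → B → ℂ) (hv : Fin 2 → B → ℂ) (h : B → ℝ)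
    (U : Set B) : Prop where
  smooth_hh : ∀ i j, ContMDiffOn 𝓘(ℝ, F) 𝓘(ℝ, ℂ) ∞ (hh i j) U
  smooth_hv : ∀ i, ContMDiffOn 𝓘(ℝ, F) 𝓘(ℝ, ℂ) ∞ (hv i) U
  smooth_h : ContMDiffOn 𝓘(ℝ, F) 𝓘(ℝ, ℝ) ∞ h U
  hermitian : ∀ b ∈ U, ∀ i j, hh i j b = conj (hh j i b)
  eq_hh : ∀ b ∈ U, ∀ v : TangentSpace 𝓘(ℝ, F) b, ∀ i j,
    mvfderiv 𝓘(ℝ, F) (hh i j) b v =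
      2 * hh i j b * ((C.θ00 b v).re : ℂ)
      + (∑ s, hh i s b * conj (C.θm s j b v))
      + (∑ s, hh s j b * C.θm s i b v)
      + hv i b * (∑ s, conj (eps s j * C.θc s b v))
      + conj (hv j b) * ∑ s, eps s i * C.θc s b v
  eq_hv : ∀ b ∈ U, ∀ v : TangentSpace 𝓘(ℝ, F) b, ∀ k,
    mvfderiv 𝓘(ℝ, F) (hv k) b v =
      2 * Complex.I * hv k b * ((C.θ00 b v).im : ℂ)
      + (∑ l, hv l b * C.θm l k b v)
      + (∑ i, ∑ j, hh k i b * conj (epsInv i j * C.θr j b v))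
      + ∑ l, (eps k l * h b
          - (1 / 2 : ℂ) * ∑ i, ∑ j, ∑ s, epsInv i j * hh s i b * C.W s k l j b) * C.θc l b v
  eq_h : ∀ b ∈ U, ∀ v : TangentSpace 𝓘(ℝ, F) b,
    mvfderiv 𝓘(ℝ, F) h b v =
      -2 * h b * (C.θ00 b v).re
      - 2 * (∑ l, ∑ k, epsInv l k * (hv l b * C.θr k b v).re)
      + ∑ i, ∑ j, ∑ k, ∑ l, ∑ s,
          epsInv i j * epsInv k l * (hh k i b * C.K l s j b * C.θc s b v).re

/-- `h_{1\bar 1} h_{2\bar 2} - |h_{1\bar 2}|²` (a real number where `h_{i\bar j}` is hermitian). -/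
def hdet (hh : Fin 2 → Fin 2 → B → ℂ) (b : B) : ℝ :=
  (hh 0 0 b * hh 1 1 b).re - ‖hh 0 1 b‖ ^ 2

/-- The quadratic form `h_{i\bar j} θ^i_0 ∘ \bar θ^j_0 / (h_{1\bar 1} h_{2\bar 2} - |h_{1\bar 2}|²)²`,
evaluated on `v`; the sum is real where `h_{i\bar j}` is hermitian. -/
def quadForm (hh : Fin 2 → Fin 2 → B → ℂ) (b : B) (v : TangentSpace 𝓘(ℝ, F) b) : ℝ :=
  (∑ i, ∑ j, hh i j b * C.θc i b v * conj (C.θc j b v)).re / hdet hh b ^ 2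

/-- On the open set `U` of `B`, the quadratic form above is the `π`-pullback of a
(pseudo-)Kähler metric on `π(U)` that is compatible with `[∇]`. -/
def DescendsOn (cov : Conn M) (hh : Fin 2 → Fin 2 → B → ℂ) (U : Set B) : Prop :=
  IsOpen (C.proj '' U) ∧ ∃ g : BilinField M,
    IsPseudoKahlerOn g (C.proj '' U) ∧ IsCompatibleOn g cov (C.proj '' U) ∧
    ∀ b ∈ U, ∀ v : TangentSpace 𝓘(ℝ, F) b,
      C.quadForm hh b v =
        g (C.proj b) (mfderiv 𝓘(ℝ, F) 𝓘(ℝ, CSq) C.proj b v)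
          (mfderiv 𝓘(ℝ, F) 𝓘(ℝ, CSq) C.proj b v)

end CartanGeometry

end Cartan

end CProj

end

/-! The equation for `dh_{i\bar j}` is read once along the fibres of `π`, where it makes `g`
invariant, and once along sections, where it says that `g` is parallel for a connection in the given
class.

Fibres. The forms `θ^i_0` vanish on vertical vectors, and what is left of the equation is an
infinitesimal congruence. Integrated along a segment of parameters from the identity to `q = (a,
v)`, it gives `h(b) = adj(a)ᵗ h(bq) conj(adj a)` (`congruence_orbit`). By equivariance the soldering
form satisfies `θ(b) = det a · a · θ(bq)` on the base (`sum_mul_solder_orbit`). Between `bq` and `b`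
the hermitian form thus gains the factor `|det a|⁴` and its determinant the factor `|det a|²`, so
dividing by the square of the determinant gives an invariant (`bform_orbit`). The argument is local
in the fibre. It yields (a) on small product neighbourhoods, and (b) because a locally constant
function on a connected fibre is constant.

Base. Every `b` lies on a translate `τ = s·A`, by a constant `A`, of the section `s` belonging to a
chart. As `h_{i\bar j}` is invertible, one can solve `\bar h_j = h_{t\bar j} ψ_t`; then the `ε`
terms, applied to a vector `y`, take the form `μ(y)e - μ(e)y` with `μ = (-ψ_2, ψ_1)`, an identity
special to dimension two. With the weight `det⁻²` the equation becomes the statement that `g` is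
parallel for `∇_v Y + λ(v)Y + λ(Y)v`, where `λ` is a complex-linear covector built from `μ`, `A` and
the trace of the Christoffel symbols (`IsAdaptedSection.isMetricCovector`).

A change of this shape keeps the connection torsion-free and complex-linear and keeps its
generalised geodesics. The covector is determined by `g` (`IsMetricCovector.unique`), so the local
formulas fit together to a smooth covector field (`isPseudoKahlerOn_and_isCompatibleOn`). The two
halves meet in `IsGeometryOf.descendsOn`: invariance on fibres suffices for the descent. -/

noncomputable section

namespace CProj

/-! ### Fields and differentials in a holomorphic chart -/

section ChartCalculus

variable {M : Type*} [TopologicalSpace M] [ChartedSpace CSq M]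

/-- The differential of the preferred holomorphic chart at `x₀`. -/
def chartD (x₀ y : M) : TangentSpace 𝓘(ℝ, CSq) y →L[ℝ] CSq :=
  mfderiv 𝓘(ℝ, CSq) 𝓘(ℝ, CSq) (chartAt CSq x₀) y

theorem dz_chartAt (x₀ y : M) (v : TangentSpace 𝓘(ℝ, CSq) y) (i : Fin 2) :
    dz (chartAt CSq x₀) y v i = chartD x₀ y v i := rfl

/-- The field with constant components `w` in the preferred chart at `x₀`. -/
def constField (x₀ : M) (w : CSq) : VField M := fun y => (chartD x₀ y).inverse w

theorem coordField_chartAt (x₀ : M) (k : Fin 2) :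
    coordField (chartAt CSq x₀) k = constField x₀ (Pi.single k 1) := rfl

variable [IsManifold 𝓘(ℂ, CSq) ω M]

instance realManifoldOne : IsManifold 𝓘(ℝ, CSq) 1 M :=
  IsManifold.of_le (n := ∞) (by exact_mod_cast le_top)

theorem isHolomorphicChart_chartAt (x₀ : M) : IsHolomorphicChart (chartAt CSq x₀) :=
  IsManifold.chart_mem_maximalAtlas x₀

/-- The bridge between bundle regularity and coordinates: the tangent trivialisation centred at `x₀`
is the differential of the chart, so regularity of a field is regularity of its components. -/
theorem trivializationAt_snd {x₀ y : M} (hy : y ∈ (chartAt CSq x₀).source)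
    (v : TangentSpace 𝓘(ℝ, CSq) y) :
    (trivializationAt CSq (TangentSpace 𝓘(ℝ, CSq)) x₀ (⟨y, v⟩ : TangentBundle 𝓘(ℝ, CSq) M)).2
      = chartD x₀ y v := by
  have h := TangentBundle.continuousLinearMapAt_trivializationAt (I := 𝓘(ℝ, CSq)) hy
  have h2 := congrArg (fun L => L v) h
  rw [Bundle.Trivialization.continuousLinearMapAt_apply,
    Bundle.Trivialization.linearMapAt_apply, if_pos (by simpa using hy)] at h2
  exact h2

theorem chartD_isInvertible {x₀ y : M} (hy : y ∈ (chartAt CSq x₀).source) :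
    (chartD x₀ y).IsInvertible :=
  isInvertible_mfderiv_extChartAt (I := 𝓘(ℝ, CSq)) (x := x₀) (by simpa using hy)

/-- The chart is holomorphic, so its real differential is the restriction of scalars of a
complex-linear map. This is where `J` becomes independent of the chart. -/
theorem chartD_J {x₀ y : M} (hy : y ∈ (chartAt CSq x₀).source)
    (v : TangentSpace 𝓘(ℝ, CSq) y) :
    chartD x₀ y (J y v) = Complex.I • chartD x₀ y v := by
  have hm : MDifferentiableAt 𝓘(ℝ, CSq) 𝓘(ℝ, CSq) (chartAt CSq x₀) y :=
    mdifferentiableAt_atlas (chart_mem_atlas _ _) hy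
  have hc : MDifferentiableAt 𝓘(ℂ, CSq) 𝓘(ℂ, CSq) (chartAt CSq x₀) y :=
    have : IsManifold 𝓘(ℂ, CSq) 1 M := IsManifold.of_le (n := ω) le_top
    mdifferentiableAt_atlas (chart_mem_atlas _ _) hy
  have hr := hm.hasMFDerivAt.2
  have hx := hc.hasMFDerivAt.2
  simp only [mfld_simps] at hr hx
  have huniq := HasFDerivAt.unique ((hasFDerivWithinAt_univ (𝕜 := ℝ) (E := CSq) (F := CSq)).1 hr)
    (((hasFDerivWithinAt_univ (𝕜 := ℂ) (E := CSq) (F := CSq)).1 hx).restrictScalars ℝ)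
  refine (congrArg (fun L => L (J y v)) huniq).trans
    (Eq.trans ?_ (congrArg (fun L : CSq →L[ℝ] CSq => Complex.I • L v) huniq.symm))
  exact (show CSq →L[ℂ] CSq from mfderiv 𝓘(ℂ, CSq) 𝓘(ℂ, CSq) (chartAt CSq x₀) y).map_smul
    Complex.I (show CSq from v)

theorem diffFieldAt_iff {x₀ y : M} (hy : y ∈ (chartAt CSq x₀).source) (Y : VField M) :
    DiffFieldAt Y y ↔
      MDifferentiableAt 𝓘(ℝ, CSq) 𝓘(ℝ, CSq) (fun p => chartD x₀ p (Y p)) y := by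
  have h := (trivializationAt CSq (TangentSpace 𝓘(ℝ, CSq)) x₀).mdifferentiableAt_section_iff
    𝓘(ℝ, CSq) Y (b₀ := y) (by simpa using hy)
  refine Iff.trans h ?_
  apply Filter.EventuallyEq.mdifferentiableAt_iff
  filter_upwards [(chartAt CSq x₀).open_source.mem_nhds hy] with p hp
  exact trivializationAt_snd hp _

theorem contMDiffOn_field_iff {n : ℕ∞} {x₀ : M} {V : Set M} (hV : IsOpen V)
    (hVs : V ⊆ (chartAt CSq x₀).source) (Y : VField M) :
    ContMDiffOn 𝓘(ℝ, CSq) 𝓘(ℝ, CSq).tangent n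
      (fun y => (⟨y, Y y⟩ : TangentBundle 𝓘(ℝ, CSq) M)) V ↔
      ContMDiffOn 𝓘(ℝ, CSq) 𝓘(ℝ, CSq) n (fun p => chartD x₀ p (Y p)) V := by
  have : IsManifold 𝓘(ℝ, CSq) (n + 1) M :=
    IsManifold.of_le (n := ∞) (by exact_mod_cast le_top)
  have h := (trivializationAt CSq (TangentSpace 𝓘(ℝ, CSq)) x₀).contMDiffOn_section_iff
    (IB := 𝓘(ℝ, CSq)) (n := n) (s := Y) hV (fun y hy => by simpa using hVs hy)
  refine Iff.trans h ?_
  apply contMDiffOn_congr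
  intro p hp
  exact trivializationAt_snd (hVs hp) _

theorem chartD_constField {x₀ y : M} (hy : y ∈ (chartAt CSq x₀).source) (w : CSq) :
    chartD x₀ y (constField x₀ w y) = w :=
  (chartD_isInvertible hy).self_apply_inverse w

theorem chartD_injective {x₀ y : M} (hy : y ∈ (chartAt CSq x₀).source)
    {v w : TangentSpace 𝓘(ℝ, CSq) y} (h : chartD x₀ y v = chartD x₀ y w) : v = w :=
  (chartD_isInvertible hy).injective h

theorem J_constField {x₀ y : M} (hy : y ∈ (chartAt CSq x₀).source) (w : CSq) :
    J y (constField x₀ w y) = constField x₀ (Complex.I • w) y := by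
  apply chartD_injective hy
  rw [chartD_J hy, chartD_constField hy, chartD_constField hy]

theorem diffFieldAt_constField {x₀ y : M} (hy : y ∈ (chartAt CSq x₀).source) (w : CSq) :
    DiffFieldAt (constField x₀ w) y := by
  rw [diffFieldAt_iff hy]
  apply (mdifferentiableAt_const (c := w)).congr_of_eventuallyEq
  filter_upwards [(chartAt CSq x₀).open_source.mem_nhds hy] with p hp
  exact chartD_constField hp w

theorem contMDiffOn_constField {n : ℕ∞} (x₀ : M) (w : CSq) :
    ContMDiffOn 𝓘(ℝ, CSq) 𝓘(ℝ, CSq).tangent n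
      (fun y => (⟨y, constField x₀ w y⟩ : TangentBundle 𝓘(ℝ, CSq) M)) (chartAt CSq x₀).source := by
  rw [contMDiffOn_field_iff (chartAt CSq x₀).open_source subset_rfl]
  exact (contMDiffOn_const (c := w)).congr fun p hp => chartD_constField hp w

/-- These fields are chart pullbacks of constant fields on `ℂ²`, and brackets commute with pullback.
-/
theorem mlieBracket_constField {x₀ y : M} (hy : y ∈ (chartAt CSq x₀).source) (w w' : CSq) :
    VectorField.mlieBracket 𝓘(ℝ, CSq) (constField x₀ w) (constField x₀ w') y = 0 := by
  have hc : ContMDiffAt 𝓘(ℝ, CSq) 𝓘(ℝ, CSq) ∞ (chartAt CSq x₀) y :=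
    contMDiffAt_of_mem_maximalAtlas (IsManifold.chart_mem_maximalAtlas x₀) hy
  have hd : ∀ u : CSq, MDifferentiableAt 𝓘(ℝ, CSq) 𝓘(ℝ, CSq).tangent
      (fun p => (⟨p, u⟩ : TangentBundle 𝓘(ℝ, CSq) CSq)) (chartAt CSq x₀ y) := fun u =>
    ((contMDiff_vectorSpace_iff_contDiff (V := fun _ => u)).2 contDiff_const
      |>.mdifferentiable (n := 1) one_ne_zero) _
  have h2 : (2 : WithTop ℕ∞) ≤ ∞ := WithTop.coe_le_coe.2 (le_top : (2 : ℕ∞) ≤ ⊤)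
  have hmin : IsManifold 𝓘(ℝ, CSq) (minSmoothness ℝ 2) M := by
    rw [minSmoothness_of_isRCLikeNormedField]; exact IsManifold.of_le (n := ∞) h2
  have h := VectorField.mpullback_mlieBracket (I := 𝓘(ℝ, CSq)) (I' := 𝓘(ℝ, CSq)) (n := ∞)
    (V := fun _ => w) (W := fun _ => w') (hd w) (hd w') hc
    (by rw [minSmoothness_of_isRCLikeNormedField]; exact h2)
  refine Eq.trans h.symm ?_
  have h0 : VectorField.mlieBracket 𝓘(ℝ, CSq) (fun _ : CSq => w) (fun _ => w') = 0 := by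
    refine (VectorField.mlieBracketWithin_univ (I := 𝓘(ℝ, CSq)) (V := fun _ : CSq => w)
      (W := fun _ => w')).symm.trans ?_
    refine VectorField.mlieBracketWithin_eq_lieBracketWithin.trans ?_
    ext1 p
    simp [VectorField.lieBracketWithin]
    rfl
  refine (congrArg (fun X => VectorField.mpullback 𝓘(ℝ, CSq) 𝓘(ℝ, CSq) (chartAt CSq x₀) X y)
    h0).trans ?_
  rw [VectorField.mpullback_zero]; rfl

end ChartCalculus

/-! ### Derivatives along coordinate lines -/

section Curves

variable {E : Type*} [NormedAddCommGroup E] [NormedSpace ℝ E]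
variable {N : Type*} [TopologicalSpace N] [ChartedSpace E N]
variable {G : Type*} [NormedAddCommGroup G] [NormedSpace ℝ G]

/-- The coordinate line through `y` with velocity `v` at time `0`. -/
def chartLine (y : N) (v : E) (t : ℝ) : N :=
  (chartAt E y).symm (chartAt E y y + t • v)

@[simp] theorem chartLine_zero (y : N) (v : E) : chartLine y v 0 = y := by
  simp only [chartLine, zero_smul, add_zero]
  exact (chartAt E y).left_inv (mem_chart_source E y)

theorem continuousAt_chartLine (y : N) (v : E) :
    ContinuousAt (chartLine y v) 0 := by
  have h1 : ContinuousAt (chartAt E y).symm (chartAt E y y + (0 : ℝ) • v) := by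
    rw [zero_smul, add_zero]
    exact (chartAt E y).continuousAt_symm (mem_chart_target E y)
  have h2 : ContinuousAt (fun t : ℝ => chartAt E y y + t • v) 0 := by fun_prop
  exact ContinuousAt.comp (f := fun t : ℝ => chartAt E y y + t • v) h1 h2

theorem eventually_chartLine {p : N → Prop} {y : N} (h : ∀ᶠ q in 𝓝 y, p q)
    (v : E) : ∀ᶠ t in 𝓝 (0 : ℝ), p (chartLine y v t) := by
  have := continuousAt_chartLine y v
  rw [ContinuousAt, chartLine_zero] at this
  exact this.eventually h

theorem hasDerivAt_chartLine {f : N → G} {y : N}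
    (hf : MDifferentiableAt 𝓘(ℝ, E) 𝓘(ℝ, G) f y) (v : TangentSpace 𝓘(ℝ, E) y) :
    HasDerivAt (fun t => f (chartLine (E := E) y v t)) (mvfderiv 𝓘(ℝ, E) f y v) 0 := by
  change E at v
  have hr := hf.hasMFDerivAt.2
  simp only [mfld_simps] at hr
  have h1 := (hasFDerivWithinAt_univ (𝕜 := ℝ) (E := E) (F := G)).1 hr
  have h2 : HasDerivAt (fun t : ℝ => chartAt E y y + t • v) v 0 := by
    simpa only [id, one_smul] using
      ((hasDerivAt_id (0 : ℝ)).smul_const v).const_add (chartAt E y y)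
  have h3 : chartAt E y y + (0 : ℝ) • v = chartAt E y y := by simp
  exact HasFDerivAt.comp_hasDerivAt (f := fun t : ℝ => chartAt E y y + t • v)
    (0 : ℝ) (by rw [h3]; exact h1) h2

/-- Reduces directional derivatives on a manifold to calculus in one real variable. -/
theorem mvfderiv_eq_of_hasDerivAt {f : N → G} {y : N}
    (hf : MDifferentiableAt 𝓘(ℝ, E) 𝓘(ℝ, G) f y) {v : TangentSpace 𝓘(ℝ, E) y} {c : G}
    (h : HasDerivAt (fun t => f (chartLine (E := E) y v t)) c 0) : mvfderiv 𝓘(ℝ, E) f y v = c :=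
  (hasDerivAt_chartLine hf v).unique h

theorem mvfderiv_clm_comp {G' : Type*} [NormedAddCommGroup G'] [NormedSpace ℝ G']
    (L : G →L[ℝ] G') {f : N → G} {y : N}
    (hf : MDifferentiableAt 𝓘(ℝ, E) 𝓘(ℝ, G) f y) (v : TangentSpace 𝓘(ℝ, E) y) :
    mvfderiv 𝓘(ℝ, E) (fun p => L (f p)) y v = L (mvfderiv 𝓘(ℝ, E) f y v) :=
  mvfderiv_eq_of_hasDerivAt (L.differentiable.comp_mdifferentiableAt hf)
    (L.hasFDerivAt.comp_hasDerivAt (0 : ℝ) (hasDerivAt_chartLine hf v))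

end Curves

/-! ### Locality, symmetry and complex linearity of the connection -/

section Connection

variable {M : Type*} [TopologicalSpace M] [ChartedSpace CSq M] [IsManifold 𝓘(ℂ, CSq) ω M]

/-- A field that is smooth only on `V` is multiplied by a bump function supported in `V` and equal
to one near the point. The product is globally smooth, and a connection sees only the germ of a
field. -/
theorem _root_.ContMDiffCovariantDerivativeOn.of_univ [T2Space M] {cov : Conn M}
    (hc : IsCovariantDerivativeOn CSq cov univ)
    (hs : ContMDiffCovariantDerivativeOn CSq ∞ cov univ) {V : Set M} (hV : IsOpen V) :
    ContMDiffCovariantDerivativeOn CSq ∞ cov V where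
  contMDiff {σ} hσ x hx := by
    obtain ⟨f, -, hf⟩ := (SmoothBumpFunction.nhds_basis_tsupport (I := 𝓘(ℝ, CSq)) x).mem_iff.1
      (hV.mem_nhds hx)
    have hsm : ContMDiff 𝓘(ℝ, CSq) 𝓘(ℝ, CSq).tangent (∞ + 1)
        (fun y => (⟨y, (⇑f • σ) y⟩ : TangentBundle 𝓘(ℝ, CSq) M)) :=
      ContMDiffOn.smul_section_of_tsupport (n := ∞ + 1) f.contMDiff.contMDiffOn hV hf hσ
    have h1 := (hs.contMDiff hsm.contMDiffOn).contMDiffAt (x := x) univ_mem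
    refine (h1.congr_of_eventuallyEq ?_).contMDiffWithinAt
    have he := f.eventuallyEq_one.eventuallyEq_nhds
    filter_upwards [he, hV.mem_nhds hx] with y hy hyV
    have hσy := ((hσ y hyV).contMDiffAt (hV.mem_nhds hyV)).mdifferentiableAt (by simp)
    congr 1
    refine hc.congr_of_eventuallyEq hσy (hsm.mdifferentiable (by simp) y) univ_mem ?_
    filter_upwards [hy] with p hp
    simp [hp]

variable {cov : Conn M}

theorem cov_constField_symm (hcov : IsComplexLinearOn cov univ) {x₀ y : M}
    (hy : y ∈ (chartAt CSq x₀).source) (w w' : CSq) :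
    cov (constField x₀ w') y (constField x₀ w y) = cov (constField x₀ w) y (constField x₀ w' y) := by
  have h := hcov.torsion_free y trivial _ _ (diffFieldAt_constField hy w)
    (diffFieldAt_constField hy w')
  rw [mlieBracket_constField hy] at h
  exact sub_eq_zero.1 h

theorem cov_constField_I_smul (hcov : IsComplexLinearOn cov univ) {x₀ y : M}
    (hy : y ∈ (chartAt CSq x₀).source) (w : CSq) (v : TangentSpace 𝓘(ℝ, CSq) y) :
    cov (constField x₀ (Complex.I • w)) y v = J y (cov (constField x₀ w) y v) := by
  rw [← hcov.complex_linear y trivial _ (diffFieldAt_constField hy w)]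
  have hev : ∀ᶠ p in 𝓝 y, constField x₀ (Complex.I • w) p = J p (constField x₀ w p) := by
    filter_upwards [(chartAt CSq x₀).open_source.mem_nhds hy] with p hp
    exact (J_constField hp w).symm
  have hd : DiffFieldAt (fun p => J p (constField x₀ w p)) y :=
    (diffFieldAt_constField hy (Complex.I • w)).congr_of_eventuallyEq
      (hev.mono fun p hp => by simp [hp])
  rw [hcov.isCov.congr_of_eventuallyEq (diffFieldAt_constField hy (Complex.I • w)) hd univ_mem hev]

end Connection

/-! ### The coordinate formula for the connection -/

section Christoffel

variable {M : Type*} [TopologicalSpace M] [ChartedSpace CSq M] [IsManifold 𝓘(ℂ, CSq) ω M]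
variable {cov : Conn M}

theorem constField_add {x₀ y : M} (hy : y ∈ (chartAt CSq x₀).source) (w w' : CSq) :
    constField x₀ (w + w') y = constField x₀ w y + constField x₀ w' y := by
  apply chartD_injective hy
  rw [map_add, chartD_constField hy, chartD_constField hy, chartD_constField hy]

theorem constField_smul {x₀ y : M} (hy : y ∈ (chartAt CSq x₀).source) (r : ℝ) (w : CSq) :
    constField x₀ (r • w) y = r • constField x₀ w y := by
  apply chartD_injective hy
  rw [map_smul, chartD_constField hy, chartD_constField hy]

theorem constField_chartD {x₀ y : M} (hy : y ∈ (chartAt CSq x₀).source)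
    (v : TangentSpace 𝓘(ℝ, CSq) y) : constField x₀ (chartD x₀ y v) y = v := by
  apply chartD_injective hy
  rw [chartD_constField hy]

theorem csq_eq_sum (w : CSq) :
    w = (w 0).re • (Pi.single 0 1 : CSq) + (w 0).im • (Complex.I • (Pi.single 0 1 : CSq))
      + ((w 1).re • (Pi.single 1 1 : CSq) + (w 1).im • (Complex.I • (Pi.single 1 1 : CSq))) := by
  ext i
  fin_cases i <;> apply Complex.ext <;> simp

/-- The coordinate `w ↦ w k` of `ℂ²` as a real-linear map. -/
def coordL (k : Fin 2) : CSq →L[ℝ] ℂ := ContinuousLinearMap.proj (R := ℝ) (φ := fun _ => ℂ) k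

theorem mdifferentiableAt_component {x₀ y : M} (hy : y ∈ (chartAt CSq x₀).source) {Y : VField M}
    (hY : DiffFieldAt Y y) (k : Fin 2) :
    MDifferentiableAt 𝓘(ℝ, CSq) 𝓘(ℝ, ℂ) (fun p => chartD x₀ p (Y p) k) y :=
  (coordL k).differentiable.comp_mdifferentiableAt ((diffFieldAt_iff hy Y).1 hY)

/-- Torsion-freeness exchanges direction and field for constant fields, so `∇J = 0` also gives
linearity over `ℂ` in the direction. This is the vanishing of the mixed Christoffel symbols. -/
theorem chartD_cov_constField_I_smul (hcov : IsComplexLinearOn cov univ) {x₀ y : M}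
    (hy : y ∈ (chartAt CSq x₀).source) (w w' : CSq) :
    chartD x₀ y (cov (constField x₀ w') y (constField x₀ (Complex.I • w) y)) =
      Complex.I • chartD x₀ y (cov (constField x₀ w') y (constField x₀ w y)) := by
  rw [cov_constField_symm hcov hy, cov_constField_I_smul hcov hy, chartD_J hy,
    cov_constField_symm hcov hy]

theorem christoffel_symm (hcov : IsComplexLinearOn cov univ) {x₀ y : M}
    (hy : y ∈ (chartAt CSq x₀).source) (i j k : Fin 2) :
    christoffel cov (chartAt CSq x₀) i j k y = christoffel cov (chartAt CSq x₀) i k j y := by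
  unfold christoffel
  rw [coordField_chartAt, coordField_chartAt, cov_constField_symm hcov hy]

theorem chartD_cov_coordField (hcov : IsComplexLinearOn cov univ) {x₀ y : M}
    (hy : y ∈ (chartAt CSq x₀).source) (v : TangentSpace 𝓘(ℝ, CSq) y) (i k : Fin 2) :
    chartD x₀ y (cov (constField x₀ (Pi.single k 1)) y v) i =
      ∑ j, christoffel cov (chartAt CSq x₀) i j k y * chartD x₀ y v j := by
  obtain ⟨w, rfl⟩ : ∃ w, constField x₀ w y = v := ⟨_, constField_chartD hy v⟩
  rw [chartD_constField hy]
  conv_lhs => rw [csq_eq_sum w]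
  simp only [constField_add hy, constField_smul hy, map_add, map_smul,
    chartD_cov_constField_I_smul hcov hy, Fin.sum_univ_two, christoffel, coordField_chartAt,
    dz_chartAt, Pi.add_apply, Pi.smul_apply, smul_eq_mul, Complex.real_smul]
  conv_rhs => rw [← Complex.re_add_im (w 0), ← Complex.re_add_im (w 1)]
  ring

/-- The local formula for a complex-linear connection: its components are the derivatives of the
components of the field plus a Christoffel term. -/
theorem chartD_cov (hcov : IsComplexLinearOn cov univ) {x₀ y : M}
    (hy : y ∈ (chartAt CSq x₀).source) {Y : VField M} (hY : DiffFieldAt Y y)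
    (v : TangentSpace 𝓘(ℝ, CSq) y) (i : Fin 2) :
    chartD x₀ y (cov Y y v) i =
      mvfderiv 𝓘(ℝ, CSq) (fun p => chartD x₀ p (Y p) i) y v +
        ∑ j, ∑ k, christoffel cov (chartAt CSq x₀) i j k y * chartD x₀ y v j
          * chartD x₀ y (Y y) k := by
  have hm := mdifferentiableAt_component hy hY
  -- The Leibniz rule admits real coefficient functions only, so the field is expanded in four
  -- constant fields, with the real and imaginary parts of its components as coefficients.
  let re (k : Fin 2) : M → ℝ := fun p => (chartD x₀ p (Y p) k).re
  let im (k : Fin 2) : M → ℝ := fun p => (chartD x₀ p (Y p) k).im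
  have hre (k) : MDifferentiableAt 𝓘(ℝ, CSq) 𝓘(ℝ, ℝ) (re k) y :=
    Complex.reCLM.differentiable.comp_mdifferentiableAt (hm k)
  have him (k) : MDifferentiableAt 𝓘(ℝ, CSq) 𝓘(ℝ, ℝ) (im k) y :=
    Complex.imCLM.differentiable.comp_mdifferentiableAt (hm k)
  let X (k : Fin 2) : VField M := constField x₀ (Pi.single k 1)
  let X' (k : Fin 2) : VField M := constField x₀ (Complex.I • Pi.single k 1)
  have hX (k) : DiffFieldAt (X k) y := diffFieldAt_constField hy _
  have hX' (k) : DiffFieldAt (X' k) y := diffFieldAt_constField hy _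
  have h1 (k) : DiffFieldAt (re k • X k) y := (hre k).smul_section (hX k)
  have h2 (k) : DiffFieldAt (im k • X' k) y := (him k).smul_section (hX' k)
  have h3 (k) : DiffFieldAt (re k • X k + im k • X' k) y := mdifferentiableAt_add_section (h1 k) (h2 k)
  have h4 : DiffFieldAt ((re 0 • X 0 + im 0 • X' 0) + (re 1 • X 1 + im 1 • X' 1)) y :=
    mdifferentiableAt_add_section (h3 0) (h3 1)
  have hev : ∀ᶠ p in 𝓝 y, Y p = ((re 0 • X 0 + im 0 • X' 0) + (re 1 • X 1 + im 1 • X' 1)) p := by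
    filter_upwards [(chartAt CSq x₀).open_source.mem_nhds hy] with p hp
    simp only [Pi.add_apply, Pi.smul_apply', X, X', ← constField_smul hp, ← constField_add hp, re, im]
    rw [← csq_eq_sum, constField_chartD hp]
  have hdre (k) : mvfderiv 𝓘(ℝ, CSq) (re k) y v =
      (mvfderiv 𝓘(ℝ, CSq) (fun p => chartD x₀ p (Y p) k) y v).re :=
    mvfderiv_clm_comp Complex.reCLM (hm k) v
  have hdim (k) : mvfderiv 𝓘(ℝ, CSq) (im k) y v =
      (mvfderiv 𝓘(ℝ, CSq) (fun p => chartD x₀ p (Y p) k) y v).im :=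
    mvfderiv_clm_comp Complex.imCLM (hm k) v
  rw [hcov.isCov.congr_of_eventuallyEq hY h4 univ_mem hev, hcov.isCov.add (h3 0) (h3 1),
    hcov.isCov.add (h1 0) (h2 0), hcov.isCov.add (h1 1) (h2 1),
    hcov.isCov.leibniz (hX 0) (hre 0), hcov.isCov.leibniz (hX 1) (hre 1),
    hcov.isCov.leibniz (hX' 0) (him 0), hcov.isCov.leibniz (hX' 1) (him 1)]
  simp only [add_apply, smul_apply,
    ContinuousLinearMap.smulRight_apply, map_add, map_smul, hdre, hdim]
  simp only [X, X', cov_constField_I_smul hcov hy, chartD_J hy, chartD_constField hy]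
  simp only [Pi.add_apply, Pi.smul_apply, smul_eq_mul, Complex.real_smul,
    chartD_cov_coordField hcov hy, Fin.sum_univ_two, re, im]
  have e (k) := Complex.re_add_im (chartD x₀ y (Y y) k)
  have d (k) := Complex.re_add_im (mvfderiv 𝓘(ℝ, CSq) (fun p => chartD x₀ p (Y p) k) y v)
  have hS (k : Fin 2) : ∃ S : ℂ, S = christoffel cov (chartAt CSq x₀) i 0 k y * chartD x₀ y v 0 +
    christoffel cov (chartAt CSq x₀) i 1 k y * chartD x₀ y v 1 := ⟨_, rfl⟩
  obtain ⟨S0, hS0⟩ := hS 0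
  obtain ⟨S1, hS1⟩ := hS 1
  rw [← hS0, ← hS1]
  trans mvfderiv 𝓘(ℝ, CSq) (fun p => chartD x₀ p (Y p) i) y v
    + S0 * chartD x₀ y (Y y) 0 + S1 * chartD x₀ y (Y y) 1
  · fin_cases i
    · simp
      linear_combination S0 * e 0 + S1 * e 1 + d 0
    · simp
      linear_combination S0 * e 0 + S1 * e 1 + d 1
  · rw [hS0, hS1]; ring
end Christoffel

/-! ### Changing a connection by a complex covector field -/

section ProjectiveChange

variable {M : Type*} [TopologicalSpace M] [ChartedSpace CSq M]

/-- Complex scalar multiplication on `ℂ²`, as a real-bilinear map. -/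
def smulL : ℂ →L[ℝ] CSq →L[ℝ] CSq := ContinuousLinearMap.lsmul ℝ ℂ

/-- Multiplication of tangent vectors by a complex number. -/
def csmul (x : M) (a : ℂ) : TangentSpace 𝓘(ℝ, CSq) x →L[ℝ] TangentSpace 𝓘(ℝ, CSq) x := smulL a

theorem csq_smul_eq (a : ℂ) (v : CSq) : a • v = a.re • v + a.im • (Complex.I • v) := by
  ext i
  have h := Complex.re_add_im a
  simp only [Pi.add_apply, Pi.smul_apply, smul_eq_mul, Complex.real_smul]
  linear_combination -(v i) * h

theorem csmul_eq (x : M) (a : ℂ) (v : TangentSpace 𝓘(ℝ, CSq) x) :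
    csmul x a v = a.re • v + a.im • J x v :=
  csq_smul_eq a v

theorem csmul_self_eq_zero {x : M} {a : ℂ} {u : TangentSpace 𝓘(ℝ, CSq) x}
    (h : csmul x a u + csmul x a u = 0) : a = 0 ∨ u = 0 := by
  have h2 : a • (show CSq from u) + a • (show CSq from u) = 0 := h
  rw [← two_smul ℂ] at h2
  rcases smul_eq_zero.1 h2 with h3 | h3
  · norm_num at h3
  · exact (smul_eq_zero (M := CSq)).1 h3

/-- The bilinear map `(w, v) ↦ a(w) v + a(v) w` on `ℂ²`. -/
def symTensor (a : CSq →L[ℝ] ℂ) : CSq →L[ℝ] CSq →L[ℝ] CSq :=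
  smulL.comp a + (smulL.comp a).flip

theorem symTensor_eq (a : CSq →L[ℝ] ℂ) (w : CSq) :
    symTensor a w = smulL (a w) + (smulL.flip w).comp a := rfl

theorem symTensor_apply (a : CSq →L[ℝ] ℂ) (w v : CSq) :
    symTensor a w v = a w • v + a v • w := rfl

/-- The bilinear map `(Y, v) ↦ A(Y) v + A(v) Y` on a tangent space. -/
def projTensor (x : M) (A : TangentSpace 𝓘(ℝ, CSq) x →L[ℝ] ℂ) :
    TangentSpace 𝓘(ℝ, CSq) x →L[ℝ] TangentSpace 𝓘(ℝ, CSq) x →L[ℝ] TangentSpace 𝓘(ℝ, CSq) x :=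
  symTensor A

theorem projTensor_apply (x : M) (A : TangentSpace 𝓘(ℝ, CSq) x →L[ℝ] ℂ)
    (w v : TangentSpace 𝓘(ℝ, CSq) x) :
    projTensor x A w v = csmul x (A w) v + csmul x (A v) w := rfl

/-- The change of a connection by a field of complex covectors. -/
def projChange (cov : Conn M) (A : (x : M) → TangentSpace 𝓘(ℝ, CSq) x →L[ℝ] ℂ) : Conn M :=
  fun Y x => cov Y x + projTensor x (A x) (Y x)

theorem projChange_apply (cov : Conn M) (A : (x : M) → TangentSpace 𝓘(ℝ, CSq) x →L[ℝ] ℂ)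
    (Y : VField M) (x : M) (v : TangentSpace 𝓘(ℝ, CSq) x) :
    projChange cov A Y x v = cov Y x v + (csmul x (A x (Y x)) v + csmul x (A x v) (Y x)) := rfl

variable [IsManifold 𝓘(ℂ, CSq) ω M]

theorem chartD_csmul {x₀ y : M} (hy : y ∈ (chartAt CSq x₀).source) (a : ℂ)
    (v : TangentSpace 𝓘(ℝ, CSq) y) : chartD x₀ y (csmul y a v) = a • chartD x₀ y v := by
  rw [csmul_eq, map_add, map_smul, map_smul, chartD_J hy, ← csq_smul_eq]

/-- In the trivialisation of the bundle of endomorphisms centred at `x₀`, an endomorphism is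
conjugated by the differential of the chart, so `φ'` is its coordinate expression. -/
theorem contMDiffAt_hom_of_chartD {n : ℕ∞} {x₀ : M}
    {φ : (y : M) → TangentSpace 𝓘(ℝ, CSq) y →L[ℝ] TangentSpace 𝓘(ℝ, CSq) y}
    {φ' : M → CSq →L[ℝ] CSq} (hφ' : ContMDiffAt 𝓘(ℝ, CSq) 𝓘(ℝ, CSq →L[ℝ] CSq) n φ' x₀)
    (h : ∀ᶠ y in 𝓝 x₀, ∀ v, chartD x₀ y (φ y v) = φ' y (chartD x₀ y v)) :
    ContMDiffAt 𝓘(ℝ, CSq) (𝓘(ℝ, CSq).prod 𝓘(ℝ, CSq →L[ℝ] CSq)) n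
      (fun y => (⟨y, φ y⟩ : Bundle.TotalSpace (CSq →L[ℝ] CSq)
        fun y : M => TangentSpace 𝓘(ℝ, CSq) y →L[ℝ] TangentSpace 𝓘(ℝ, CSq) y)) x₀ := by
  rw [contMDiffAt_hom_bundle]
  refine ⟨contMDiffAt_id, hφ'.congr_of_eventuallyEq ?_⟩
  filter_upwards [h, (chartAt CSq x₀).open_source.mem_nhds (mem_chart_source CSq x₀)] with y hy hys
  have hc := TangentBundle.continuousLinearMapAt_trivializationAt (I := 𝓘(ℝ, CSq)) hys
  have hb : y ∈ (trivializationAt CSq (TangentSpace 𝓘(ℝ, CSq)) x₀).baseSet := by simpa using hys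
  ext1 w
  have h1 := (trivializationAt CSq (TangentSpace 𝓘(ℝ, CSq)) x₀).continuousLinearMapAt_symmL
    (R := ℝ) hb w
  have h2 : ∀ u : TangentSpace 𝓘(ℝ, CSq) y,
      (trivializationAt CSq (TangentSpace 𝓘(ℝ, CSq)) x₀).continuousLinearMapAt ℝ y u
        = chartD x₀ y u := fun u => congrArg (fun L => L u) hc
  rw [h2] at h1
  exact (h2 _).trans ((hy _).trans (congrArg (φ' y) h1))

variable {cov : Conn M} {A : (x : M) → TangentSpace 𝓘(ℝ, CSq) x →L[ℝ] ℂ} {V : Set M}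

/-- A field of covectors is smooth on `V` if its components in the charts are smooth. -/
def SmoothCovectorOn (A : (x : M) → TangentSpace 𝓘(ℝ, CSq) x →L[ℝ] ℂ) (V : Set M) : Prop :=
  ∀ x ∈ V, ∃ a : M → CSq →L[ℝ] ℂ, ContMDiffAt 𝓘(ℝ, CSq) 𝓘(ℝ, CSq →L[ℝ] ℂ) ∞ a x ∧
    ∀ᶠ y in 𝓝 x, ∀ v, A y v = a y (chartD x y v)

theorem projChange_isCovariantDerivativeOn (h : IsCovariantDerivativeOn CSq cov V) :
    IsCovariantDerivativeOn CSq (projChange cov A) V :=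
  h.add_one_form fun x => projTensor x (A x)

theorem projChange_smooth [T2Space M] (hcov : IsComplexLinearOn cov univ) (hV : IsOpen V)
    (hA : SmoothCovectorOn A V) :
    ContMDiffCovariantDerivativeOn CSq ∞ (projChange cov A) V where
  contMDiff {σ} hσ := by
    have h1 := (ContMDiffCovariantDerivativeOn.of_univ hcov.isCov hcov.smooth hV).contMDiff hσ
    refine h1.add_section ?_
    intro x hx
    obtain ⟨a, ha, hA⟩ := hA x hx
    have hs := (chartAt CSq x).open_source.mem_nhds (mem_chart_source CSq x)
    obtain ⟨N, hNsub, hNo, hxN⟩ := mem_nhds_iff.1 (inter_mem hs (hV.mem_nhds hx))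
    have hσ' := (contMDiffOn_field_iff (n := ⊤) hNo (fun y hy => (hNsub hy).1) σ).1
      (hσ.mono fun y hy => (hNsub hy).2)
    have hσx := hσ'.contMDiffAt (hNo.mem_nhds hxN)
    refine (contMDiffAt_hom_of_chartD (n := ⊤)
      (φ' := fun y => symTensor (a y) (chartD x y (σ y))) ?_ ?_).contMDiffWithinAt
    · simp only [symTensor_eq]
      exact (smulL.contMDiff.contMDiffAt.comp x (ha.clm_apply hσx)).add
        ((smulL.flip.contMDiff.contMDiffAt.comp x hσx).clm_comp ha)
    · filter_upwards [hA, hs] with y hy hys v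
      rw [projTensor_apply, map_add, chartD_csmul hys, chartD_csmul hys, hy, hy, symTensor_apply]

/-- The added term `A(Y)v + A(v)Y` is symmetric, so the torsion does not change. It is
complex-linear in `Y` when `A` is, so `J` stays parallel. -/
theorem projChange_isComplexLinearOn [T2Space M] (hcov : IsComplexLinearOn cov univ)
    (hV : IsOpen V) (hA : SmoothCovectorOn A V)
    (hJ : ∀ x ∈ V, ∀ v, A x (J x v) = Complex.I * A x v) :
    IsComplexLinearOn (projChange cov A) V where
  isCov := projChange_isCovariantDerivativeOn (hcov.isCov.mono (subset_univ _))
  smooth := projChange_smooth hcov hV hA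
  torsion_free x _ X Y hX hY := by
    rw [← hcov.torsion_free x trivial X Y hX hY, projChange_apply, projChange_apply]
    abel
  complex_linear x hx Y hY v := by
    rw [projChange_apply, projChange_apply, hcov.complex_linear x trivial Y hY, hJ x hx, map_add,
      map_add]
    congr 2
    · exact mul_smul (β := CSq) Complex.I (A x (Y x)) v
    · exact smul_comm (α := CSq) (A x v) Complex.I (Y x)

/-- Along a curve the added term is `2A(γ')γ'`, a complex multiple of the velocity, which the
planarity condition ignores. -/
theorem projChange_cprojEquivOn : CProjEquivOn cov (projChange cov A) V := by
  have key : ∀ (γ : ℝ → M) (t : ℝ) (X : VField M), X (γ t) = velocity γ t →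
      projChange cov A X (γ t) (velocity γ t) - cov X (γ t) (velocity γ t) ∈
        Submodule.span ℝ {velocity γ t, J (γ t) (velocity γ t)} := by
    intro γ t X hX
    rw [projChange_apply, add_sub_cancel_left, hX, csmul_eq]
    have h1 := Submodule.subset_span (R := ℝ) (mem_insert (velocity γ t) {J (γ t) (velocity γ t)})
    have h2 := Submodule.subset_span (R := ℝ)
      (mem_insert_of_mem (velocity γ t) (mem_singleton (J (γ t) (velocity γ t))))
    have h3 := add_mem (Submodule.smul_mem _ (A (γ t) (velocity γ t)).re h1)
      (Submodule.smul_mem _ (A (γ t) (velocity γ t)).im h2)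
    exact add_mem h3 h3
  intro γ a b
  constructor
  · rintro ⟨h1, h2, h3, h4⟩
    refine ⟨h1, h2, h3, fun t ht X hX he => ?_⟩
    have := add_mem (key γ t X he.self_of_nhds) (h4 t ht X hX he)
    rwa [sub_add_cancel] at this
  · rintro ⟨h1, h2, h3, h4⟩
    refine ⟨h1, h2, h3, fun t ht X hX he => ?_⟩
    have := sub_mem (h4 t ht X hX he) (key γ t X he.self_of_nhds)
    rwa [sub_sub_cancel] at this

theorem contMDiffOn_christoffel [T2Space M] (hcov : IsComplexLinearOn cov univ) (x₀ : M)
    (i j k : Fin 2) :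
    ContMDiffOn 𝓘(ℝ, CSq) 𝓘(ℝ, ℂ) ∞ (christoffel cov (chartAt CSq x₀) i j k)
      (chartAt CSq x₀).source := by
  have ho := (chartAt CSq x₀).open_source
  have h1 := (ContMDiffCovariantDerivativeOn.of_univ hcov.isCov hcov.smooth ho).contMDiff
    (contMDiffOn_constField (n := ⊤) x₀ (Pi.single k 1))
  have h2 := h1.clm_bundle_apply (contMDiffOn_constField (n := ⊤) x₀ (Pi.single j 1))
  have h3 := (contMDiffOn_field_iff (n := ⊤) ho subset_rfl
    (fun y => cov (constField x₀ (Pi.single k 1)) y (constField x₀ (Pi.single j 1) y))).1 h2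
  exact (coordL i).contMDiff.comp_contMDiffOn h3

end ProjectiveChange

/-! ### The covector that makes a metric parallel -/

section MetricCovector

variable {M : Type*} [TopologicalSpace M] [ChartedSpace CSq M] [IsManifold 𝓘(ℂ, CSq) ω M]
variable {cov : Conn M} {g : BilinField M} {V : Set M}

/-- The change of `cov` by the complex covector `A` makes `g` parallel at `x`. -/
structure IsMetricCovector (g : BilinField M) (cov : Conn M) (x : M)
    (A : TangentSpace 𝓘(ℝ, CSq) x →L[ℝ] ℂ) : Prop where
  complex_linear : ∀ v, A (J x v) = Complex.I * A v
  metric : ∀ Y Z : VField M, DiffFieldAt Y x → DiffFieldAt Z x → ∀ v,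
    mvfderiv 𝓘(ℝ, CSq) (fun y => g y (Y y) (Z y)) x v =
      g x (cov Y x v + projTensor x A (Y x) v) (Z x) +
        g x (Y x) (cov Z x v + projTensor x A (Z x) v)

theorem exists_diffFieldAt (x : M) (u : TangentSpace 𝓘(ℝ, CSq) x) :
    ∃ Y : VField M, DiffFieldAt Y x ∧ Y x = u :=
  ⟨constField x (chartD x x u), diffFieldAt_constField (mem_chart_source CSq x) _,
    constField_chartD (mem_chart_source CSq x) u⟩

/-- Koszul's argument: the difference `T` of the two changes is symmetric in its arguments, and
`g(T(u,v),w)` is skew in `u` and `w`, hence `T = 0`. Then `0 = T(u,u) = 2(A - A')(u)u` forces `A =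
A'`. -/
theorem IsMetricCovector.unique {x : M} {A A' : TangentSpace 𝓘(ℝ, CSq) x →L[ℝ] ℂ}
    (hA : IsMetricCovector g cov x A) (hA' : IsMetricCovector g cov x A')
    (hs : ∀ v w, g x v w = g x w v) (hn : ∀ v, (∀ w, g x v w = 0) → v = 0) : A = A' := by
  let T := fun u v : TangentSpace 𝓘(ℝ, CSq) x => projTensor x A u v - projTensor x A' u v
  have hT (u v) : T u v = T v u := by
    simp only [T, projTensor_apply]
    abel
  have hskew (u w v) : g x (T u v) w + g x (T w v) u = 0 := by
    obtain ⟨Y, hY, rfl⟩ := exists_diffFieldAt x u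
    obtain ⟨Z, hZ, rfl⟩ := exists_diffFieldAt x w
    have h := (hA.metric Y Z hY hZ v).symm.trans (hA'.metric Y Z hY hZ v)
    rw [hs (Y x), hs (Y x)] at h
    simp only [map_add, add_apply, map_sub, sub_apply, T] at h ⊢
    linarith
  have hzero (u v) : T u v = 0 := by
    apply hn
    intro w
    have h1 := hskew u w v
    have h2 := hskew v u w
    have h3 := hskew w v u
    rw [hT w v] at h1
    rw [hT u w] at h2
    rw [hT v u] at h3
    linarith
  ext u
  have h := hzero u u
  have h' : csmul x (A u - A' u) u + csmul x (A u - A' u) u = 0 := by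
    rw [← h]
    simp only [T, projTensor_apply, csmul_eq, Complex.sub_re, Complex.sub_im, sub_smul]
    abel
  rcases csmul_self_eq_zero h' with h1 | rfl
  · exact sub_eq_zero.1 h1
  · rw [map_zero, map_zero]

open Classical in
/-- The covector field that changes `cov` to the Levi-Civita connection of `g`, where it exists. -/
def metricCovector (g : BilinField M) (cov : Conn M) (x : M) : TangentSpace 𝓘(ℝ, CSq) x →L[ℝ] ℂ :=
  if h : ∃ A, IsMetricCovector g cov x A then h.choose else 0

theorem metricCovector_eq {x : M} {A : TangentSpace 𝓘(ℝ, CSq) x →L[ℝ] ℂ}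
    (hA : IsMetricCovector g cov x A)
    (hs : ∀ v w, g x v w = g x w v) (hn : ∀ v, (∀ w, g x v w = 0) → v = 0) :
    metricCovector g cov x = A := by
  have h : ∃ A, IsMetricCovector g cov x A := ⟨A, hA⟩
  rw [metricCovector, dif_pos h]
  exact h.choose_spec.unique hA hs hn

/-- Uniqueness turns local solutions into a global one: the chosen covector field agrees near each
point with the local smooth family, so it is smooth, and the changed connection is the Levi-Civita
connection. -/
theorem isPseudoKahlerOn_and_isCompatibleOn [T2Space M] (hcov : IsComplexLinearOn cov univ)
    (hV : IsOpen V) (hg : IsMetricOn g V)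
    (hherm : ∀ x ∈ V, ∀ v w, g x (J x v) (J x w) = g x v w)
    (hloc : ∀ x ∈ V, ∃ a : M → CSq →L[ℝ] ℂ,
      ContMDiffAt 𝓘(ℝ, CSq) 𝓘(ℝ, CSq →L[ℝ] ℂ) ∞ a x ∧
      ∀ᶠ y in 𝓝 x, IsMetricCovector g cov y ((a y).comp (chartD x y))) :
    IsPseudoKahlerOn g V ∧ IsCompatibleOn g cov V := by
  have hmet : ∀ x ∈ V, IsMetricCovector g cov x (metricCovector g cov x) := by
    intro x hx
    obtain ⟨a, -, ha⟩ := hloc x hx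
    have h := ha.self_of_nhds
    rw [metricCovector_eq h (hg.symm x hx) (hg.nondegenerate x hx)]
    exact h
  have hsm : SmoothCovectorOn (metricCovector g cov) V := by
    intro x hx
    obtain ⟨a, ha, hev⟩ := hloc x hx
    refine ⟨a, ha, ?_⟩
    filter_upwards [hev, hV.mem_nhds hx] with y hy hyV v
    rw [metricCovector_eq hy (hg.symm y hyV) (hg.nondegenerate y hyV)]
    rfl
  have hcl := projChange_isComplexLinearOn hcov hV hsm fun x hx => (hmet x hx).complex_linear
  have hLC : IsLeviCivitaOn (projChange cov (metricCovector g cov)) g V :=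
    ⟨hcl.isCov, hcl.smooth, hcl.torsion_free, fun x hx => (hmet x hx).metric⟩
  exact ⟨⟨hg, hherm, _, hLC, hcl⟩, _, hLC, hcl, projChange_cprojEquivOn⟩

end MetricCovector

/-! ### Parameters on the structure group -/

section GroupParameters

/-- The parameters `(a, v)` of the covering `GL(2, ℂ) × ℂ² → P`. -/
abbrev Par : Type := (Fin 2 → Fin 2 → ℂ) × (Fin 2 → ℂ)

/-- The determinant of the first parameter. -/
def pdet (q : Par) : ℂ := q.1 0 0 * q.1 1 1 - q.1 0 1 * q.1 1 0

/-- The parameter of the identity. -/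
def parOne : Par := (fun i j => if i = j then 1 else 0, 0)

@[simp] theorem pdet_parOne : pdet parOne = 1 := by simp [pdet, parOne]

/-- The element of `SL(3, ℂ)` with the given parameters. -/
def coverSL (q : Par) (h : pdet q ≠ 0) : SL3 := ⟨coverMatrix q.1 q.2, coverMatrix_det h q.2⟩

theorem toPSL_coverSL_mem (q : Par) (h : pdet q ≠ 0) : toPSL (coverSL q h) ∈ P :=
  toPSL_mem_P rfl rfl

theorem cover_eq (q : Par) (h : pdet q ≠ 0) :
    cover q.1 q.2 = ⟨toPSL (coverSL q h), toPSL_coverSL_mem q h⟩ := dif_pos h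

theorem entries_of_toPSL_mem {A : SL3} (h : toPSL A ∈ P) : A.1 1 0 = 0 ∧ A.1 2 0 = 0 := by
  rw [P, MulAction.mem_stabilizer_iff] at h
  change A • basePoint = basePoint at h
  rw [basePoint, Projectivization.smul_mk, Projectivization.mk_eq_mk_iff'] at h
  obtain ⟨c, hc⟩ := h
  change _ = A.1.mulVec ![1, 0, 0] at hc
  have h1 := congrFun hc 1
  have h2 := congrFun hc 2
  simp [Matrix.mulVec, dotProduct, Fin.sum_univ_three] at h1 h2
  exact ⟨h1.symm, h2.symm⟩

/-- The parameters of a matrix. -/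
def parOf (A : SL3) : Par := (fun i j => A.1 i.succ j.succ, fun j => A.1 0 j.succ)

/-- A representative of an element of `P` is block triangular, so determinant one fixes its corner
entry. Hence the parameters `(a, v)` reach all of `P`. -/
theorem mul_pdet_parOf {A : SL3} (h : toPSL A ∈ P) : A.1 0 0 * pdet (parOf A) = 1 := by
  obtain ⟨h1, h2⟩ := entries_of_toPSL_mem h
  have := A.2
  rw [Matrix.det_fin_three, h1, h2] at this
  simp only [pdet, parOf, Fin.succ_zero_eq_one, Fin.succ_one_eq_two]
  linear_combination this

theorem pdet_parOf_ne_zero {A : SL3} (h : toPSL A ∈ P) : pdet (parOf A) ≠ 0 :=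
  right_ne_zero_of_mul (mul_pdet_parOf h ▸ one_ne_zero)

theorem coverSL_parOf {A : SL3} (h : toPSL A ∈ P) :
    coverSL (parOf A) (pdet_parOf_ne_zero h) = A := by
  obtain ⟨h1, h2⟩ := entries_of_toPSL_mem h
  have h3 : A.1 0 0 = (pdet (parOf A))⁻¹ := eq_inv_of_mul_eq_one_left (mul_pdet_parOf h)
  apply Subtype.ext
  ext i j
  fin_cases i <;> fin_cases j <;> simp [coverSL, coverMatrix, h1, h2]
  · exact h3.symm
  all_goals simp [parOf]

theorem cover_parOf {A : SL3} (h : toPSL A ∈ P) :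
    cover (parOf A).1 (parOf A).2 = ⟨toPSL A, h⟩ := by
  rw [cover_eq _ (pdet_parOf_ne_zero h)]
  simp only [coverSL_parOf h]

theorem coverSL_parOne : coverSL parOne (by simp) = 1 := by
  apply Subtype.ext
  ext i j
  fin_cases i <;> fin_cases j <;> simp [coverSL, coverMatrix, parOne]

theorem cover_parOne : cover parOne.1 parOne.2 = 1 := by
  rw [cover_eq _ (by simp)]
  apply Subtype.ext
  simp [coverSL_parOne]

theorem continuous_pdet : Continuous pdet := by
  unfold pdet
  fun_prop

/-- The derivative of `coverMatrix` at `q` in the direction `δ`. -/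
def coverDeriv (q δ : Par) : Matrix (Fin 3) (Fin 3) ℂ :=
  !![-(q.1 0 0 * δ.1 1 1 + δ.1 0 0 * q.1 1 1 - (q.1 0 1 * δ.1 1 0 + δ.1 0 1 * q.1 1 0))
      / pdet q ^ 2, δ.2 0, δ.2 1; 0, δ.1 0 0, δ.1 0 1; 0, δ.1 1 0, δ.1 1 1]

theorem hasDerivAt_coverMatrix {q δ : Par} (hq : pdet q ≠ 0) {χ : ℝ → ℝ} (h0 : χ 0 = 0)
    (hχ : HasDerivAt χ 1 0) (i j : Fin 3) :
    HasDerivAt (fun t => coverMatrix (q + χ t • δ).1 (q + χ t • δ).2 i j) (coverDeriv q δ i j) 0 := by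
  have hlin (c d : ℂ) : HasDerivAt (fun t => c + (χ t : ℂ) * d) d 0 := by
    simpa using (hχ.ofReal_comp.mul_const d).const_add c
  have hd := (((hlin (q.1 0 0) (δ.1 0 0)).mul (hlin (q.1 1 1) (δ.1 1 1))).sub
    ((hlin (q.1 0 1) (δ.1 0 1)).mul (hlin (q.1 1 0) (δ.1 1 0)))).inv
      (by simpa [h0, pdet] using hq)
  fin_cases i <;> fin_cases j
  · refine (hd.congr_deriv ?_).congr_of_eventuallyEq (Eventually.of_forall fun t => ?_)
    · simp only [h0, Complex.ofReal_zero, zero_mul, add_zero, coverDeriv, pdet]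
      congr 1
      · simp
        ring
      · simp [h0]
    · simp [coverMatrix]
  all_goals simp [coverMatrix, coverDeriv]
  all_goals first | exact hasDerivAt_const _ _ | simpa using hlin 0 _

end GroupParameters

/-! ### The Cartan connection along the orbits -/

section Orbits

variable {M : Type*} [TopologicalSpace M] [ChartedSpace CSq M] [IsManifold 𝓘(ℂ, CSq) ω M]
variable {F : Type*} [NormedAddCommGroup F] [NormedSpace ℝ F]
variable {B : Type*} [TopologicalSpace B] [ChartedSpace F B] [IsManifold 𝓘(ℝ, F) ∞ B]

namespace CartanGeometry

variable (C : CartanGeometry M (F := F) B)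

/-- The orbit map of the structure group, in terms of the parameters of the covering. -/
def orbit (b : B) (q : Par) : B := C.act b (cover q.1 q.2)

@[simp] theorem orbit_parOne (b : B) : C.orbit b parOne = b := by
  rw [orbit, cover_parOne, C.act_one]

theorem proj_act (b : B) (p : P) : C.proj (C.act b p) = C.proj b :=
  ((C.proj_eq_iff _ _).2 ⟨p, rfl⟩).symm

theorem contMDiffAt_act {b : B} {q : Par} (hq : pdet q ≠ 0) :
    ContMDiffAt (𝓘(ℝ, F).prod 𝓘(ℝ, Par)) 𝓘(ℝ, F) ∞
      (fun r : B × Par => C.orbit r.1 r.2) (b, q) := by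
  have ho : IsOpen {r : B × Par | pdet r.2 ≠ 0} :=
    isOpen_ne_fun (continuous_pdet.comp continuous_snd) continuous_const
  exact (C.act_smooth (b, q) hq).contMDiffAt (ho.mem_nhds hq)

theorem contMDiffAt_orbit (b : B) {q : Par} (hq : pdet q ≠ 0) :
    ContMDiffAt 𝓘(ℝ, Par) 𝓘(ℝ, F) ∞ (C.orbit b) q :=
  (C.contMDiffAt_act (b := b) hq).comp q (contMDiffAt_const.prodMk contMDiffAt_id)

theorem contMDiffAt_orbit_left (b : B) {q : Par} (hq : pdet q ≠ 0) :
    ContMDiffAt 𝓘(ℝ, F) 𝓘(ℝ, F) ∞ (fun b' => C.orbit b' q) b :=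
  (C.contMDiffAt_act (b := b) hq).comp b (contMDiffAt_id.prodMk contMDiffAt_const)

theorem contMDiff_act {A : SL3} (hA : toPSL A ∈ P) :
    ContMDiff 𝓘(ℝ, F) 𝓘(ℝ, F) ∞ (fun b' => C.act b' ⟨toPSL A, hA⟩) := by
  intro b
  have h := C.contMDiffAt_orbit_left b (pdet_parOf_ne_zero hA)
  simpa only [orbit, cover_parOf hA] using h

/-- `form_vertical` asks for curves in the group defined for all times, but the line `q + tδ` may
meet singular matrices. The bounded reparametrisation `ε sin(t/ε)` has unit speed at `0` and stays
close to `q`. -/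
theorem exists_sin_bound {q : Par} (hq : pdet q ≠ 0) (δ : Par) :
    ∃ ε : ℝ, 0 < ε ∧ ∀ t : ℝ, pdet (q + (ε * Real.sin (t / ε)) • δ) ≠ 0 := by
  have hc : ContinuousAt (fun s : ℝ => pdet (q + s • δ)) 0 :=
    (continuous_pdet.comp (by fun_prop)).continuousAt
  have hev := hc.eventually_ne (y := 0) (by simpa using hq)
  obtain ⟨r, hr, hb⟩ := Metric.eventually_nhds_iff.1 hev
  refine ⟨r / 2, by positivity, fun t => hb ?_⟩
  rw [dist_zero_right, norm_mul, Real.norm_of_nonneg (by positivity : (0 : ℝ) ≤ r / 2),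
    Real.norm_eq_abs]
  have := Real.abs_sin_le_one (t / (r / 2))
  nlinarith [abs_nonneg (Real.sin (t / (r / 2)))]

theorem mfderiv_orbit_comp (b : B) {q δ : Par} (hq : pdet q ≠ 0) {ℓ : ℝ → Par} (h0 : ℓ 0 = q)
    (hℓ : HasDerivAt ℓ δ 0) :
    mfderiv 𝓘(ℝ, ℝ) 𝓘(ℝ, F) (fun t => C.orbit b (ℓ t)) 0 (1 : ℝ) =
      mfderiv 𝓘(ℝ, Par) 𝓘(ℝ, F) (C.orbit b) q δ := by
  subst h0
  have h1 := ((C.contMDiffAt_orbit b hq).mdifferentiableAt (by simp)).hasMFDerivAt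
  have h2 : HasMFDerivAt 𝓘(ℝ, ℝ) 𝓘(ℝ, Par) ℓ 0 (ContinuousLinearMap.toSpanSingleton ℝ δ) :=
    hℓ.hasFDerivAt.hasMFDerivAt
  have h3 := (h1.comp (0 : ℝ) h2).mfderiv
  refine (congrArg (fun L => L (1 : ℝ)) h3).trans ?_
  change mfderiv 𝓘(ℝ, Par) 𝓘(ℝ, F) (C.orbit b) (ℓ 0) ((1 : ℝ) • δ) = _
  rw [one_smul]

/-- The orbit map pulls `θ` back to the Maurer–Cartan form `N⁻¹ dN`; multiplying by `N` removes the
inverse. -/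
theorem coverMatrix_mul_form_orbit (b : B) {q : Par} (hq : pdet q ≠ 0) (δ : Par) :
    coverMatrix q.1 q.2 * C.form (C.orbit b q) (mfderiv 𝓘(ℝ, Par) 𝓘(ℝ, F) (C.orbit b) q δ)
      = coverDeriv q δ := by
  obtain ⟨ε, hε, hne⟩ := exists_sin_bound hq δ
  let χ : ℝ → ℝ := fun t => ε * Real.sin (t / ε)
  have hχ0 : χ 0 = 0 := by simp [χ]
  have hχ : HasDerivAt χ 1 0 := by
    have h := (((hasDerivAt_id (0 : ℝ)).div_const ε).sin).const_mul ε
    refine h.congr_deriv ?_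
    simp [hε.ne']
  have hχs : ContDiff ℝ ∞ χ := by
    unfold χ
    fun_prop
  let N := coverSL q hq
  -- Left translation by `N⁻¹` makes the curve start at the identity; acting on `b·q`, it traces
  -- `b·(q + χ(t)δ)`.
  let c : ℝ → SL3 := fun t => N⁻¹ * coverSL (q + χ t • δ) (hne t)
  have hcP : ∀ t, toPSL (c t) ∈ P := fun t => by
    simp only [c, map_mul, map_inv]
    exact P.mul_mem (P.inv_mem (toPSL_coverSL_mem _ _)) (toPSL_coverSL_mem _ _)
  have hc0 : c 0 = 1 := by
    simp only [c, hχ0, zero_smul, add_zero]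
    exact inv_mul_cancel N
  have hent (t i j) : (c t : Matrix (Fin 3) (Fin 3) ℂ) i j =
      ∑ k, (N⁻¹).1 i k * coverMatrix (q + χ t • δ).1 (q + χ t • δ).2 k j := by
    simp only [c, Matrix.SpecialLinearGroup.coe_mul, Matrix.mul_apply]
    rfl
  have hsm : ∀ i j, ContDiff ℝ ∞ fun t => (c t : Matrix (Fin 3) (Fin 3) ℂ) i j := by
    intro i j
    simp only [hent]
    refine ContDiff.sum fun k _ => contDiff_const.mul ?_
    have hlin (c d : ℂ) : ContDiff ℝ ∞ (fun t => c + χ t • d) :=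
      contDiff_const.add (hχs.smul contDiff_const)
    have hinv : ContDiff ℝ ∞ fun t => (pdet (q + χ t • δ))⁻¹ := by
      refine ContDiff.inv ?_ hne
      exact ((hlin _ _).mul (hlin _ _)).sub ((hlin _ _).mul (hlin _ _))
    fin_cases k <;> fin_cases j
    all_goals first | exact hinv | exact hlin _ _ | exact contDiff_const
  have hact (t) : C.act (C.orbit b q) ⟨toPSL (c t), hcP t⟩ = C.orbit b (q + χ t • δ) := by
    rw [orbit, orbit, ← C.act_mul, cover_eq _ hq, cover_eq _ (hne t)]
    congr 1
    apply Subtype.ext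
    simp only [c, map_mul, map_inv, Subgroup.coe_mul]
    exact mul_inv_cancel_left _ _
  have key := C.form_vertical c hcP hc0 hsm (C.orbit b q)
  have hb : C.act (C.orbit b q) ⟨toPSL (c 0), hcP 0⟩ = C.orbit b q := by
    rw [hact, hχ0, zero_smul, add_zero]
  -- The base points are equal only propositionally. As maps on the model space `F` the two values
  -- of the form can be compared.
  have hform : (C.form (C.act (C.orbit b q) ⟨toPSL (c 0), hcP 0⟩) :
      F →L[ℝ] Matrix (Fin 3) (Fin 3) ℂ) = C.form (C.orbit b q) := by
    rw [hb]
  have hder : mfderiv 𝓘(ℝ, ℝ) 𝓘(ℝ, F)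
      (fun t : ℝ => C.act (C.orbit b q) ⟨toPSL (c t), hcP t⟩) 0 (1 : ℝ) =
      mfderiv 𝓘(ℝ, Par) 𝓘(ℝ, F) (C.orbit b) q δ := by
    rw [funext hact]
    exact C.mfderiv_orbit_comp b hq (by simp [hχ0])
      (by simpa using (hχ.smul_const δ).const_add q)
  have hrhs : (Matrix.of fun i j => deriv (fun t => (c t : Matrix (Fin 3) (Fin 3) ℂ) i j) 0)
      = (N⁻¹).1 * coverDeriv q δ := by
    ext i j
    rw [Matrix.of_apply, Matrix.mul_apply]
    simp only [hent]
    refine HasDerivAt.deriv ?_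
    exact HasDerivAt.fun_sum fun k _ => (hasDerivAt_coverMatrix hq hχ0 hχ k j).const_mul _
  have key2 : C.form (C.orbit b q) (mfderiv 𝓘(ℝ, Par) 𝓘(ℝ, F) (C.orbit b) q δ)
      = (N⁻¹).1 * coverDeriv q δ := by
    rw [← hrhs, ← key, ← hder]
    exact (congrArg (fun L : F →L[ℝ] Matrix (Fin 3) (Fin 3) ℂ => L _) hform).symm
  rw [key2, ← Matrix.mul_assoc]
  have : coverMatrix q.1 q.2 * (N⁻¹).1 = 1 := congrArg Subtype.val (mul_inv_cancel N)
  rw [this, Matrix.one_mul]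

end CartanGeometry
end Orbits

/-! ### Sections through a given point of the bundle -/

section AdaptedSections

variable {M : Type*} [TopologicalSpace M] [ChartedSpace CSq M] [IsManifold 𝓘(ℂ, CSq) ω M]
variable {F : Type*} [NormedAddCommGroup F] [NormedSpace ℝ F]
variable {B : Type*} [TopologicalSpace B] [ChartedSpace F B] [IsManifold 𝓘(ℝ, F) ∞ B]

namespace CartanGeometry

/-- `τ` is the translate by `A` of the section determined by the preferred chart at `x₀`. -/
structure IsAdaptedSection (C : CartanGeometry M (F := F) B) (cov : Conn M) (x₀ : M) (A : SL3)
    (τ : M → B) : Prop where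
  mem : toPSL A ∈ P
  smooth : ContMDiffOn 𝓘(ℝ, CSq) 𝓘(ℝ, F) ∞ τ (chartAt CSq x₀).source
  proj_eq : ∀ y ∈ (chartAt CSq x₀).source, C.proj (τ y) = y
  form_zero : ∀ y ∈ (chartAt CSq x₀).source, ∀ v,
    A.1 0 0 * C.θ00 (τ y) (mfderiv 𝓘(ℝ, CSq) 𝓘(ℝ, F) τ y v)
      + ∑ k : Fin 2, A.1 0 k.succ * C.θc k (τ y) (mfderiv 𝓘(ℝ, CSq) 𝓘(ℝ, F) τ y v) = 0
  form_col : ∀ y ∈ (chartAt CSq x₀).source, ∀ v, ∀ i : Fin 2,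
    ∑ k : Fin 2, A.1 i.succ k.succ * C.θc k (τ y) (mfderiv 𝓘(ℝ, CSq) 𝓘(ℝ, F) τ y v)
      = A.1 0 0 * chartD x₀ y v i
  form_block : ∀ y ∈ (chartAt CSq x₀).source, ∀ v, ∀ i j : Fin 2,
    ∑ k : Fin 2, A.1 i.succ k.succ * C.θm k j (τ y) (mfderiv 𝓘(ℝ, CSq) 𝓘(ℝ, F) τ y v)
      = chartD x₀ y v i * A.1 0 j.succ
        + ∑ k : Fin 2, (∑ l, projInv cov (chartAt CSq x₀) i k l y * chartD x₀ y v l)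
          * A.1 k.succ j.succ

variable {C : CartanGeometry M (F := F) B} {cov : Conn M}

/-- The chart section `s` meets the fibre of `b`, and some `A` carries `s(π b)` to `b`. For `τ =
s·A` equivariance reads `A · τ*θ = s*θ · A`, and the three conditions on the form are entries of
this identity, the first column of `A` being zero below the corner. -/
theorem IsGeometryOf.exists_isAdaptedSection (hC : C.IsGeometryOf cov) (b : B) :
    ∃ A τ, C.IsAdaptedSection cov (C.proj b) A τ ∧ τ (C.proj b) = b := by
  obtain ⟨s, hs, hproj, hform⟩ := hC _ (isHolomorphicChart_chartAt (C.proj b))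
  have hmem := mem_chart_source CSq (C.proj b)
  obtain ⟨⟨p, hp⟩, hpb⟩ := (C.proj_eq_iff (s (C.proj b)) b).1 (hproj _ hmem)
  obtain ⟨A, rfl⟩ : ∃ A : SL3, toPSL A = p := QuotientGroup.mk'_surjective _ p
  obtain ⟨h1, h2⟩ := entries_of_toPSL_mem hp
  let τ : M → B := fun y => C.act (s y) ⟨toPSL A, hp⟩
  have hev : ∀ y ∈ (chartAt CSq (C.proj b)).source, ∀ v,
      (A : Matrix (Fin 3) (Fin 3) ℂ) * C.form (τ y) (mfderiv 𝓘(ℝ, CSq) 𝓘(ℝ, F) τ y v) =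
        C.form (s y) (mfderiv 𝓘(ℝ, CSq) 𝓘(ℝ, F) s y v) * (A : Matrix (Fin 3) (Fin 3) ℂ) := by
    intro y hy v
    have hsy : MDifferentiableAt 𝓘(ℝ, CSq) 𝓘(ℝ, F) s y :=
      ((hs y hy).contMDiffAt ((chartAt CSq _).open_source.mem_nhds hy)).mdifferentiableAt (by simp)
    have hd := mfderiv_comp_apply y (((C.contMDiff_act hp) (s y)).mdifferentiableAt (by simp)) hsy v
    have he := C.form_equivariant A hp (s y) (mfderiv 𝓘(ℝ, CSq) 𝓘(ℝ, F) s y v)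
    have he' : C.form (τ y) (mfderiv 𝓘(ℝ, CSq) 𝓘(ℝ, F) τ y v) = _ :=
      (congrArg (C.form (τ y)) hd).trans he
    have hAA : (A : Matrix (Fin 3) (Fin 3) ℂ) * ((A⁻¹ : SL3) : Matrix (Fin 3) (Fin 3) ℂ) = 1 :=
      congrArg Subtype.val (mul_inv_cancel A)
    rw [he', ← Matrix.mul_assoc, ← Matrix.mul_assoc, hAA, Matrix.one_mul]
  refine ⟨A, τ, ⟨hp, (C.contMDiff_act hp).comp_contMDiffOn hs,
    fun y hy => (C.proj_act _ _).trans (hproj y hy), ?_, ?_, ?_⟩, hpb⟩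
  · intro y hy v
    have h := congrFun (congrFun (hev y hy v) 0) 0
    obtain ⟨f0, -, -, -⟩ := hform y hy v
    simp only [Matrix.mul_apply, Fin.sum_univ_three, h1, h2, f0] at h
    simp only [Fin.sum_univ_two, θ00, θc, Fin.succ_zero_eq_one, Fin.succ_one_eq_two]
    linear_combination h
  · intro y hy v i
    have h := congrFun (congrFun (hev y hy v) i.succ) 0
    obtain ⟨-, f1, -, -⟩ := hform y hy v
    have hA : A.1 i.succ 0 = 0 := by fin_cases i <;> assumption
    simp only [Matrix.mul_apply, Fin.sum_univ_three, h1, h2, hA, f1, dz_chartAt] at h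
    simp only [Fin.sum_univ_two, θc, Fin.succ_zero_eq_one, Fin.succ_one_eq_two]
    linear_combination h
  · intro y hy v i j
    have h := congrFun (congrFun (hev y hy v) i.succ) j.succ
    obtain ⟨-, f1, f2, -⟩ := hform y hy v
    have g0 := f2 i 0
    have g1 := f2 i 1
    simp only [Fin.succ_zero_eq_one, Fin.succ_one_eq_two] at g0 g1
    have hA : A.1 i.succ 0 = 0 := by fin_cases i <;> assumption
    simp only [Matrix.mul_apply, Fin.sum_univ_three, hA, f1, g0, g1, dz_chartAt] at h
    simp only [Fin.sum_univ_two, θm, Fin.succ_zero_eq_one, Fin.succ_one_eq_two] at h ⊢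
    linear_combination h

/-- The fundamental vector at `b` with parameters `δ`. -/
def fundVec (C : CartanGeometry M (F := F) B) (b : B) (δ : Par) : TangentSpace 𝓘(ℝ, F) b :=
  (mfderiv 𝓘(ℝ, Par) 𝓘(ℝ, F) (C.orbit b) parOne δ : F)

theorem form_fundVec (b : B) (δ : Par) : C.form b (C.fundVec b δ) = coverDeriv parOne δ := by
  have h := C.coverMatrix_mul_form_orbit b (q := parOne) (by simp) δ
  have h1 : coverMatrix parOne.1 parOne.2 = 1 := congrArg Subtype.val coverSL_parOne
  rw [h1, Matrix.one_mul] at h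
  have hform : (C.form (C.orbit b parOne) : F →L[ℝ] Matrix (Fin 3) (Fin 3) ℂ) = C.form b := by
    rw [orbit_parOne]
  exact (congrArg (fun L : F →L[ℝ] Matrix (Fin 3) (Fin 3) ℂ => L _) hform).symm.trans h

theorem mfderiv_proj_fundVec (b : B) (δ : Par) :
    mfderiv 𝓘(ℝ, F) 𝓘(ℝ, CSq) C.proj b (C.fundVec b δ) = 0 := by
  have h1 := ((C.contMDiffAt_orbit b (q := parOne) (by simp)).mdifferentiableAt
    (by simp)).hasMFDerivAt
  have h2 := ((C.proj_smooth (C.orbit b parOne)).mdifferentiableAt (by simp)).hasMFDerivAt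
  have h3 := h2.comp parOne h1
  have h4 : (C.proj ∘ C.orbit b) = fun _ => C.proj b := funext fun q => C.proj_act _ _
  rw [h4] at h3
  have h5 := congrArg (fun L : Par →L[ℝ] CSq => L δ)
    (h3.mfderiv.symm.trans (hasMFDerivAt_const (C.proj b) parOne).mfderiv)
  have hproj : (mfderiv 𝓘(ℝ, F) 𝓘(ℝ, CSq) C.proj (C.orbit b parOne) : F →L[ℝ] CSq) =
      mfderiv 𝓘(ℝ, F) 𝓘(ℝ, CSq) C.proj b := by
    rw [orbit_parOne]
  exact (congrArg (fun L : F →L[ℝ] CSq => L _) hproj).symm.trans h5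

namespace IsAdaptedSection

variable {x₀ : M} {A : SL3} {τ : M → B}

theorem contMDiffAt (h : C.IsAdaptedSection cov x₀ A τ) {y : M}
    (hy : y ∈ (chartAt CSq x₀).source) : ContMDiffAt 𝓘(ℝ, CSq) 𝓘(ℝ, F) ∞ τ y :=
  (h.smooth y hy).contMDiffAt ((chartAt CSq x₀).open_source.mem_nhds hy)

theorem mfderiv_proj (h : C.IsAdaptedSection cov x₀ A τ) {y : M}
    (hy : y ∈ (chartAt CSq x₀).source) (u : TangentSpace 𝓘(ℝ, CSq) y) :
    mfderiv 𝓘(ℝ, F) 𝓘(ℝ, CSq) C.proj (τ y) (mfderiv 𝓘(ℝ, CSq) 𝓘(ℝ, F) τ y u) = u := by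
  have h1 := mfderiv_comp_apply y ((C.proj_smooth (τ y)).mdifferentiableAt (by simp))
    ((h.contMDiffAt hy).mdifferentiableAt (by simp)) u
  refine Eq.trans h1.symm ?_
  have h2 : C.proj ∘ τ =ᶠ[𝓝 y] id := by
    filter_upwards [(chartAt CSq x₀).open_source.mem_nhds hy] with p hp
    exact h.proj_eq p hp
  have h3 := ((hasMFDerivAt_id (I := 𝓘(ℝ, CSq)) y).congr_of_eventuallyEq h2).mfderiv
  exact congrArg (fun L : CSq →L[ℝ] CSq => L u) h3

/-- A vector tangent to the section can be given the same `θ^i_0` as `w`. The rest has its `θ`-value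
in the Lie algebra of `P`, so it is fundamental because `θ` is injective. -/
theorem exists_decomposition (h : C.IsAdaptedSection cov x₀ A τ) {y : M}
    (hy : y ∈ (chartAt CSq x₀).source) (w : TangentSpace 𝓘(ℝ, F) (τ y)) :
    ∃ u δ, w = mfderiv 𝓘(ℝ, CSq) 𝓘(ℝ, F) τ y u + C.fundVec (τ y) δ := by
  have hd : A.1 0 0 ≠ 0 := left_ne_zero_of_mul (mul_pdet_parOf h.mem ▸ one_ne_zero)
  have hp := pdet_parOf_ne_zero h.mem
  obtain ⟨u, hu'⟩ : ∃ u, chartD x₀ y u =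
      fun i => (A.1 0 0)⁻¹ * ∑ k : Fin 2, A.1 i.succ k.succ * C.θc k (τ y) w :=
    ⟨_, chartD_constField hy _⟩
  have hu : ∀ i, C.θc i (τ y) (mfderiv 𝓘(ℝ, CSq) 𝓘(ℝ, F) τ y u) = C.θc i (τ y) w := by
    have e := h.form_col y hy u
    have e0 := e 0
    have e1 := e 1
    simp only [hu', mul_inv_cancel_left₀ hd] at e0 e1
    simp only [Fin.sum_univ_two, Fin.succ_zero_eq_one, Fin.succ_one_eq_two] at e0 e1
    simp only [pdet, parOf, Fin.succ_zero_eq_one, Fin.succ_one_eq_two] at hp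
    refine Fin.forall_fin_two.2 ⟨mul_left_cancel₀ hp ?_, mul_left_cancel₀ hp ?_⟩
    · linear_combination A.1 2 2 * e0 - A.1 1 2 * e1
    · linear_combination A.1 1 1 * e1 - A.1 2 1 * e0
  -- The parameters of the fundamental vector are the lower block and the upper row of `X`; the
  -- corner entry follows from trace zero.
  let X := C.form (τ y) w - C.form (τ y) (mfderiv 𝓘(ℝ, CSq) 𝓘(ℝ, F) τ y u)
  refine ⟨u, (fun i j => X i.succ j.succ, fun j => X 0 j.succ), ?_⟩
  apply C.form_injective (τ y)
  rw [map_add, form_fundVec]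
  have hX : coverDeriv parOne (fun i j => X i.succ j.succ, fun j => X 0 j.succ) = X := by
    have htr : X.trace = 0 := by
      rw [Matrix.trace_sub, C.form_trace, C.form_trace, sub_zero]
    have hX0 : ∀ i : Fin 2, X i.succ 0 = 0 := fun i => by
      have := hu i
      simp only [θc] at this
      simp only [X, Matrix.sub_apply, this, sub_self]
    rw [Matrix.trace_fin_three] at htr
    have h10 := hX0 0
    have h20 := hX0 1
    simp only [Fin.succ_zero_eq_one, Fin.succ_one_eq_two] at h10 h20
    ext i j
    fin_cases i <;> fin_cases j <;> simp [coverDeriv, h10, h20]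
    simp [parOne]
    linear_combination -htr
  rw [hX]
  simp only [X]
  abel

/-- Fundamental vectors are killed both by `θ^i_0` and by the projection, so `form_col` extends to
all tangent vectors at `τ y`. -/
theorem sum_mul_θc (h : C.IsAdaptedSection cov x₀ A τ) {y : M}
    (hy : y ∈ (chartAt CSq x₀).source) (w : TangentSpace 𝓘(ℝ, F) (τ y)) (i : Fin 2) :
    ∑ k : Fin 2, A.1 i.succ k.succ * C.θc k (τ y) w
      = A.1 0 0 * chartD x₀ y (mfderiv 𝓘(ℝ, F) 𝓘(ℝ, CSq) C.proj (τ y) w) i := by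
  obtain ⟨u, δ, rfl⟩ := h.exists_decomposition hy w
  have h1 : mfderiv 𝓘(ℝ, F) 𝓘(ℝ, CSq) C.proj (τ y)
      (mfderiv 𝓘(ℝ, CSq) 𝓘(ℝ, F) τ y u + C.fundVec (τ y) δ) = u := by
    rw [map_add, h.mfderiv_proj hy, mfderiv_proj_fundVec]
    exact add_zero (M := CSq) u
  have h2 (k : Fin 2) : C.θc k (τ y) (mfderiv 𝓘(ℝ, CSq) 𝓘(ℝ, F) τ y u + C.fundVec (τ y) δ) =
      C.θc k (τ y) (mfderiv 𝓘(ℝ, CSq) 𝓘(ℝ, F) τ y u) := by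
    rw [θc, θc, map_add, form_fundVec, Matrix.add_apply]
    fin_cases k <;> simp [coverDeriv]
  simp only [h2]
  rw [h.form_col y hy u i]
  exact congrArg (fun v => A.1 0 0 * chartD x₀ y v i) h1.symm

end IsAdaptedSection
end CartanGeometry
end AdaptedSections

/-! ### Local openness of submersions -/

section Submersions

variable {F : Type*} [NormedAddCommGroup F] [NormedSpace ℝ F]
variable {B : Type*} [TopologicalSpace B] [ChartedSpace F B] [IsManifold 𝓘(ℝ, F) ∞ B]
variable {E : Type*} [NormedAddCommGroup E] [NormedSpace ℝ E]

theorem image_mem_nhds_of_surjective_mfderiv [CompleteSpace E] [CompleteSpace F] {f : E → B}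
    {p : E} (hf : ContMDiffAt 𝓘(ℝ, E) 𝓘(ℝ, F) ∞ f p)
    (hs : Function.Surjective (mfderiv 𝓘(ℝ, E) 𝓘(ℝ, F) f p)) {S : Set E} (hS : S ∈ 𝓝 p) :
    f '' S ∈ 𝓝 (f p) := by
  have hc : ContMDiffAt 𝓘(ℝ, F) 𝓘(ℝ, F) ∞ (chartAt F (f p)) (f p) :=
    contMDiffAt_of_mem_maximalAtlas (IsManifold.chart_mem_maximalAtlas (f p))
      (mem_chart_source F (f p))
  have hg : ContDiffAt ℝ ∞ (chartAt F (f p) ∘ f) p := (hc.comp p hf).contDiffAt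
  have hd := (hf.mdifferentiableAt (by simp)).hasMFDerivAt.2
  simp only [mfld_simps] at hd
  have hd' := (hasFDerivWithinAt_univ (𝕜 := ℝ) (E := E) (F := F)).1 hd
  have hst := hg.hasStrictFDerivAt' hd' (by simp)
  have hmap := hst.map_nhds_eq_of_surj (LinearMap.range_eq_top.2 hs)
  -- Openness is proved for `f` read in the chart at `f p`. Shrinking `S` into the domain of that
  -- chart allows its injectivity to carry the result back.
  have hS' : S ∩ f ⁻¹' (chartAt F (f p)).source ∈ 𝓝 p :=
    inter_mem hS (hf.continuousAt ((chartAt F (f p)).open_source.mem_nhds (mem_chart_source F _)))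
  have him := image_mem_map (m := chartAt F (f p) ∘ f) hS'
  rw [hmap] at him
  have hpre := ((chartAt F (f p)).continuousAt (mem_chart_source F (f p))).preimage_mem_nhds him
  filter_upwards [hpre, (chartAt F (f p)).open_source.mem_nhds (mem_chart_source F (f p))]
    with b' hb' hbs
  obtain ⟨e, ⟨heS, hes⟩, he⟩ := hb'
  exact ⟨e, heS, (chartAt F (f p)).injOn hes hbs he⟩

end Submersions

/-! ### Product neighbourhoods in the bundle -/

section Fibres

variable {M : Type*} [TopologicalSpace M] [ChartedSpace CSq M] [IsManifold 𝓘(ℂ, CSq) ω M]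
variable {F : Type*} [NormedAddCommGroup F] [NormedSpace ℝ F]
variable {B : Type*} [TopologicalSpace B] [ChartedSpace F B] [IsManifold 𝓘(ℝ, F) ∞ B]

namespace CartanGeometry

variable {C : CartanGeometry M (F := F) B} {cov : Conn M} {x₀ : M} {A : SL3} {τ : M → B}

/-- The map `(y, q) ↦ τ(y)·q` is a submersion at `(x₀, 1)`: its differential is `dτ` on the first
factor and the fundamental vectors on the second, which together span by `exists_decomposition`. -/
theorem IsAdaptedSection.image_orbit_mem_nhds [CompleteSpace F]
    (h : C.IsAdaptedSection cov x₀ A τ) {S : Set M} (hS : S ∈ 𝓝 x₀) {T : Set Par}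
    (hT : T ∈ 𝓝 parOne) :
    {b' | ∃ y ∈ S, ∃ q ∈ T, C.orbit (τ y) q = b'} ∈ 𝓝 (τ x₀) := by
  have hx₀ := mem_chart_source CSq x₀
  set z := chartAt CSq x₀ with hz
  let f : CSq × Par → B := fun r => C.orbit (τ (z.symm r.1)) r.2
  have hsymm : ContMDiffAt 𝓘(ℝ, CSq) 𝓘(ℝ, CSq) ∞ z.symm (z x₀) :=
    contMDiffOn_chart_symm.contMDiffAt (z.open_target.mem_nhds (z.map_source hx₀))
  have hτs : ContMDiffAt 𝓘(ℝ, CSq) 𝓘(ℝ, F) ∞ (fun p => τ (z.symm p)) (z x₀) :=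
    ContMDiffAt.comp (z x₀) (by rw [z.left_inv hx₀]; exact h.contMDiffAt hx₀) hsymm
  have hf : ContMDiffAt 𝓘(ℝ, CSq × Par) 𝓘(ℝ, F) ∞ f (z x₀, parOne) := by
    refine ContMDiffAt.comp (z x₀, parOne) (g := fun r : B × Par => C.orbit r.1 r.2)
      (f := fun r : CSq × Par => (τ (z.symm r.1), r.2))
      (C.contMDiffAt_act (b := τ (z.symm (z x₀))) (q := parOne) (by simp))
      (ContMDiffAt.prodMk ?_ ?_)
    · exact ContMDiffAt.comp (z x₀, parOne) (g := fun p => τ (z.symm p)) hτs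
        contDiff_fst.contMDiff.contMDiffAt
    · exact contDiff_snd.contMDiff.contMDiffAt
  have hfd := hf.mdifferentiableAt (by simp)
  have hf0 : f (z x₀, parOne) = τ x₀ := by
    simp only [f, orbit_parOne, z.left_inv hx₀]
  have hτd : MDifferentiableAt 𝓘(ℝ, CSq) 𝓘(ℝ, F) τ x₀ :=
    (h.contMDiffAt hx₀).mdifferentiableAt (by simp)
  let L : CSq × Par →L[ℝ] F := mfderiv 𝓘(ℝ, CSq × Par) 𝓘(ℝ, F) f (z x₀, parOne)
  have hL1 : ∀ u : TangentSpace 𝓘(ℝ, CSq) x₀,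
      L (chartD x₀ x₀ u, 0) = mfderiv 𝓘(ℝ, CSq) 𝓘(ℝ, F) τ x₀ u := by
    intro u
    have h1 : HasMFDerivAt 𝓘(ℝ, CSq) 𝓘(ℝ, CSq × Par) (fun y => (z y, parOne)) x₀
        ((ContinuousLinearMap.inl ℝ CSq Par).comp (chartD x₀ x₀)) := by
      have hi : HasMFDerivAt 𝓘(ℝ, CSq) 𝓘(ℝ, CSq × Par) (fun p : CSq => (p, parOne)) (z x₀)
          (ContinuousLinearMap.inl ℝ CSq Par) := by
        have := (hasFDerivAt_id (𝕜 := ℝ) (z x₀)).prodMk (hasFDerivAt_const (𝕜 := ℝ) parOne (z x₀))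
        exact this.hasMFDerivAt
      exact hi.comp x₀ (mdifferentiableAt_atlas (chart_mem_atlas _ _) hx₀).hasMFDerivAt
    have h2 := hfd.hasMFDerivAt.comp x₀ h1
    have h3 : (f ∘ fun y => (z y, parOne)) =ᶠ[𝓝 x₀] τ := by
      filter_upwards [z.open_source.mem_nhds hx₀] with y hy
      simp only [f, Function.comp, orbit_parOne, z.left_inv hy]
    have h4 := h2.mfderiv.symm.trans h3.mfderiv_eq
    exact congrArg (fun K : CSq →L[ℝ] F => K u) h4
  have hL2 : ∀ δ : Par, L (0, δ) = C.fundVec (τ x₀) δ := by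
    intro δ
    have hi : HasMFDerivAt 𝓘(ℝ, Par) 𝓘(ℝ, CSq × Par) (fun q : Par => (z x₀, q)) parOne
        (ContinuousLinearMap.inr ℝ CSq Par) := by
      have := (hasFDerivAt_const (𝕜 := ℝ) (z x₀) parOne).prodMk (hasFDerivAt_id (𝕜 := ℝ) parOne)
      exact this.hasMFDerivAt
    have h2 := hfd.hasMFDerivAt.comp parOne hi
    have h3 : (f ∘ fun q => (z x₀, q)) = C.orbit (τ x₀) := by
      funext q
      simp only [f, Function.comp, z.left_inv hx₀]
    rw [h3] at h2
    exact congrArg (fun K : Par →L[ℝ] F => K δ) h2.mfderiv.symm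
  have hsurj : Function.Surjective L := by
    intro w
    obtain ⟨u, δ, hw⟩ := h.exists_decomposition hx₀ w
    refine ⟨(chartD x₀ x₀ u, δ), ?_⟩
    have : ((chartD x₀ x₀ u, δ) : CSq × Par) = (chartD x₀ x₀ u, 0) + (0, δ) := by simp
    rw [this, map_add, hL1, hL2]
    exact hw.symm
  have hST : (z.symm ⁻¹' S) ×ˢ T ∈ 𝓝 (z x₀, parOne) := by
    refine prod_mem_nhds (hsymm.continuousAt.preimage_mem_nhds ?_) hT
    rwa [z.left_inv hx₀]
  have := image_mem_nhds_of_surjective_mfderiv hf hsurj hST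
  rw [hf0] at this
  filter_upwards [this] with b' hb'
  obtain ⟨⟨p, q⟩, ⟨hp, hq⟩, rfl⟩ := hb'
  exact ⟨z.symm p, hp, q, hq, rfl⟩

end CartanGeometry
end Fibres

/-! ### The coefficients along the fibres -/

section Invariance

/-- The adjugate of a `2 × 2` matrix. -/
def adj2 (a : Fin 2 → Fin 2 → ℂ) : Fin 2 → Fin 2 → ℂ := ![![a 1 1, -a 0 1], ![-a 1 0, a 0 0]]

/-- For `2 × 2` matrices the adjugate is linear and `adj(aX) = (tr X - X) adj a`. In the derivative
of `adj(a)ᵗ h conj(adj a)` the terms in `X` cancel those of `dh`, and the traces cancel `2 Re x`. -/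
theorem adj2_congruence_deriv {a d X hk dh : Fin 2 → Fin 2 → ℂ} {x : ℂ}
    (hd : ∀ i j, d i j = ∑ k, a i k * X k j) (hx : x = -(X 0 0 + X 1 1))
    (hdh : ∀ i j, dh i j = 2 * hk i j * (x.re : ℂ) + (∑ s, hk i s * conj (X s j))
      + ∑ s, hk s j * X s i) (i j : Fin 2) :
    ∑ k, ∑ l, ((adj2 d k i * hk k l + adj2 a k i * dh k l) * conj (adj2 a l j)
      + adj2 a k i * hk k l * conj (adj2 d l j)) = 0 := by
  have hre : 2 * (x.re : ℂ) = -(X 0 0 + X 1 1) - (conj (X 0 0) + conj (X 1 1)) := by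
    have := Complex.add_conj x
    rw [hx] at this ⊢
    simp only [map_neg, map_add] at this
    push_cast at this ⊢
    linear_combination -this
  have hdh' : ∀ i j, dh i j = hk i j * (-(X 0 0 + X 1 1) - (conj (X 0 0) + conj (X 1 1)))
      + (∑ s, hk i s * conj (X s j)) + ∑ s, hk s j * X s i := fun i j => by
    rw [hdh]; linear_combination hk i j * hre
  revert i j
  simp only [Fin.forall_fin_two, Fin.sum_univ_two, hdh', adj2, hd, Matrix.cons_val_zero,
    Matrix.cons_val_one, map_neg, map_add, map_mul]
  refine ⟨⟨?_, ?_⟩, ?_, ?_⟩ <;> ring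

variable {M : Type*} [TopologicalSpace M] [ChartedSpace CSq M] [IsManifold 𝓘(ℂ, CSq) ω M]
variable {F : Type*} [NormedAddCommGroup F] [NormedSpace ℝ F]
variable {B : Type*} [TopologicalSpace B] [ChartedSpace F B] [IsManifold 𝓘(ℝ, F) ∞ B]

namespace CartanGeometry

variable {C : CartanGeometry M (F := F) B}

theorem θc_mfderiv_orbit (b : B) {q : Par} (hq : pdet q ≠ 0) (δ : Par) (k : Fin 2) :
    C.θc k (C.orbit b q) (mfderiv 𝓘(ℝ, Par) 𝓘(ℝ, F) (C.orbit b) q δ) = 0 := by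
  have h := C.coverMatrix_mul_form_orbit b hq δ
  have h1 := congrFun (congrFun h 1) 0
  have h2 := congrFun (congrFun h 2) 0
  simp only [Matrix.mul_apply, Fin.sum_univ_three] at h1 h2
  simp [coverMatrix, coverDeriv] at h1 h2
  simp only [pdet] at hq
  revert k
  refine Fin.forall_fin_two.2 ⟨mul_left_cancel₀ hq ?_, mul_left_cancel₀ hq ?_⟩
  · simp only [θc, Fin.succ_zero_eq_one]
    linear_combination q.1 1 1 * h1 - q.1 0 1 * h2
  · simp only [θc, Fin.succ_one_eq_two]
    linear_combination q.1 0 0 * h2 - q.1 1 0 * h1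

theorem sum_mul_θm_mfderiv_orbit (b : B) {q : Par} (hq : pdet q ≠ 0) (δ : Par) (i j : Fin 2) :
    δ.1 i j = ∑ k, q.1 i k *
      C.θm k j (C.orbit b q) (mfderiv 𝓘(ℝ, Par) 𝓘(ℝ, F) (C.orbit b) q δ) := by
  have h := congrFun (congrFun (C.coverMatrix_mul_form_orbit b hq δ) i.succ) j.succ
  simp only [Matrix.mul_apply, Fin.sum_univ_three] at h
  simp only [Fin.sum_univ_two, θm]
  revert i j
  simp [Fin.forall_fin_two, coverMatrix, coverDeriv, eq_comm]

theorem θ00_eq (b : B) (w : TangentSpace 𝓘(ℝ, F) b) :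
    C.θ00 b w = -(C.θm 0 0 b w + C.θm 1 1 b w) := by
  have h := C.form_trace b w
  rw [Matrix.trace_fin_three] at h
  simp only [θ00, θm, Fin.succ_zero_eq_one, Fin.succ_one_eq_two]
  linear_combination h

theorem hasDerivAt_comp_orbit {f : B → ℂ} (b : B) {q δ : Par} (t : ℝ)
    (hq : pdet (q + t • δ) ≠ 0)
    (hf : MDifferentiableAt 𝓘(ℝ, F) 𝓘(ℝ, ℂ) f (C.orbit b (q + t • δ))) :
    HasDerivAt (fun s : ℝ => f (C.orbit b (q + s • δ)))
      (mvfderiv 𝓘(ℝ, F) f (C.orbit b (q + t • δ))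
        (mfderiv 𝓘(ℝ, Par) 𝓘(ℝ, F) (C.orbit b) (q + t • δ) δ)) t := by
  have hℓ : HasDerivAt (fun s : ℝ => q + s • δ) δ t := by
    simpa using ((hasDerivAt_id t).smul_const δ).const_add q
  have h2 := ((C.contMDiffAt_orbit b hq).mdifferentiableAt (by simp)).hasMFDerivAt
  have h3 := (hf.hasMFDerivAt.comp (q + t • δ) h2).hasFDerivAt
  exact HasFDerivAt.comp_hasDerivAt (f := fun s : ℝ => q + s • δ) t h3 hℓ

/-- On vertical vectors the terms with `h_i` drop out of the equation, and `adj2_congruence_deriv`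
shows that the transformed matrix is constant along the segment of parameters. -/
theorem IsSolutionOn.congruence_orbit {hh : Fin 2 → Fin 2 → B → ℂ} {hv : Fin 2 → B → ℂ}
    {h : B → ℝ} {U : Set B} (hsol : C.IsSolutionOn hh hv h U) (hUo : IsOpen U) (b : B) {q : Par}
    (hq : ∀ t ∈ Icc (0 : ℝ) 1, pdet (parOne + t • (q - parOne)) ≠ 0 ∧
      C.orbit b (parOne + t • (q - parOne)) ∈ U) (i j : Fin 2) :
    ∑ k, ∑ l, adj2 q.1 k i * hh k l (C.orbit b q) * conj (adj2 q.1 l j) = hh i j b := by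
  set δ := q - parOne with hδ
  let r : ℝ → Par := fun t => parOne + t • δ
  let f : ℝ → ℂ := fun t =>
    ∑ k, ∑ l, adj2 (r t).1 k i * hh k l (C.orbit b (r t)) * conj (adj2 (r t).1 l j)
  have hder : ∀ t ∈ Icc (0 : ℝ) 1, HasDerivAt f 0 t := by
    intro t ht
    obtain ⟨hp, hU⟩ : pdet (r t) ≠ 0 ∧ C.orbit b (r t) ∈ U := hq t ht
    have hr : ∀ i j, HasDerivAt (fun t => (r t).1 i j) (δ.1 i j) t := fun i j => by
      have : HasDerivAt (fun t : ℝ => parOne.1 i j + t • δ.1 i j) (δ.1 i j) t := by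
        simpa using ((hasDerivAt_id t).smul_const (δ.1 i j)).const_add (parOne.1 i j)
      exact this
    have hadj : ∀ i j, HasDerivAt (fun t => adj2 (r t).1 i j) (adj2 δ.1 i j) t :=
      Fin.forall_fin_two.2 ⟨Fin.forall_fin_two.2 ⟨hr 1 1, (hr 0 1).neg⟩,
        Fin.forall_fin_two.2 ⟨(hr 1 0).neg, hr 0 0⟩⟩
    have hconj : ∀ i j, HasDerivAt (fun t => conj (adj2 (r t).1 i j)) (conj (adj2 δ.1 i j)) t :=
      fun i j => by simpa using (hadj i j).star
    obtain ⟨w, hw⟩ : ∃ w : TangentSpace 𝓘(ℝ, F) (C.orbit b (r t)),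
        mfderiv 𝓘(ℝ, Par) 𝓘(ℝ, F) (C.orbit b) (r t) δ = w := ⟨_, rfl⟩
    have hwc : ∀ k, C.θc k (C.orbit b (r t)) w = 0 := hw ▸ θc_mfderiv_orbit b hp δ
    have hwm : ∀ i j, δ.1 i j = ∑ k, (r t).1 i k * C.θm k j (C.orbit b (r t)) w :=
      hw ▸ sum_mul_θm_mfderiv_orbit b hp δ
    have hhd : ∀ k l, HasDerivAt (fun t => hh k l (C.orbit b (r t)))
        (mvfderiv 𝓘(ℝ, F) (hh k l) (C.orbit b (r t)) w) t := fun k l =>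
      hw ▸ hasDerivAt_comp_orbit b t hp (((hsol.smooth_hh k l _ hU).contMDiffAt
        (hUo.mem_nhds hU)).mdifferentiableAt (by simp))
    have hsum := HasDerivAt.fun_sum (u := Finset.univ) fun k _ =>
      HasDerivAt.fun_sum (u := Finset.univ) fun l _ => ((hadj k i).mul (hhd k l)).mul (hconj l j)
    refine hsum.congr_deriv ?_
    refine adj2_congruence_deriv (a := (r t).1) (d := δ.1)
      (X := fun k j => C.θm k j (C.orbit b (r t)) w) hwm (θ00_eq _ _) (fun k l => ?_) i j
    rw [hsol.eq_hh _ hU]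
    simp only [hwc, mul_zero, map_zero, Finset.sum_const_zero, add_zero]
  have hconst := constant_of_has_deriv_right_zero (f := f) (a := 0) (b := 1)
    (fun t ht => (hder t ht).continuousAt.continuousWithinAt)
    (fun t ht => (hder t (Ico_subset_Icc_self ht)).hasDerivWithinAt) 1 (right_mem_Icc.2 zero_le_one)
  have h1 : r 1 = q := by simp [r, hδ]
  have h0 : r 0 = parOne := by simp [r]
  simp only [f, h1, h0, orbit_parOne] at hconst
  rw [hconst]
  revert i j
  simp [Fin.forall_fin_two, adj2, parOne, Fin.sum_univ_two]

end CartanGeometry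
end Invariance

/-! ### Hermitian forms under congruence -/

section HermitianForms

/-- The sesquilinear form with matrix `k`. -/
def sform (k : Fin 2 → Fin 2 → ℂ) (x y : Fin 2 → ℂ) : ℂ := ∑ i, ∑ j, k i j * x i * conj (y j)

/-- The determinant of a `2 × 2` matrix. -/
def cdet (k : Fin 2 → Fin 2 → ℂ) : ℂ := k 0 0 * k 1 1 - k 0 1 * k 1 0

theorem conj_sform {k : Fin 2 → Fin 2 → ℂ} (hk : ∀ i j, k i j = conj (k j i)) (x y : Fin 2 → ℂ) :
    conj (sform k x y) = sform k y x := by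
  have h00 := hk 0 0
  have h01 := hk 0 1
  have h10 := hk 1 0
  have h11 := hk 1 1
  simp only [sform, Fin.sum_univ_two, map_add, map_mul, Complex.conj_conj, ← h00, ← h01, ← h10,
    ← h11]
  ring

/-- From `x = p a x'` and `adj(a) a = p` one gets `adj(a) x = p² x'`, hence the fourth power of
`|p|`. -/
theorem sform_congruence {a k k' : Fin 2 → Fin 2 → ℂ}
    (hk : ∀ i j, ∑ r, ∑ s, adj2 a r i * k' r s * conj (adj2 a s j) = k i j)
    {x x' y y' : Fin 2 → ℂ} {p : ℂ}
    (hp : p = cdet a) (hx : ∀ i, x i = p * ∑ r, a i r * x' r)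
    (hy : ∀ i, y i = p * ∑ r, a i r * y' r) :
    sform k x y = (p * conj p) ^ 2 * sform k' x' y' := by
  simp only [sform, ← hk, hx, hy, Fin.sum_univ_two, adj2, Matrix.cons_val_zero,
    Matrix.cons_val_one, map_neg, map_add, map_mul, hp, cdet, map_sub]
  ring

theorem cdet_congruence {a k k' : Fin 2 → Fin 2 → ℂ}
    (hk : ∀ i j, ∑ r, ∑ s, adj2 a r i * k' r s * conj (adj2 a s j) = k i j) :
    cdet k = (cdet a * conj (cdet a)) * cdet k' := by
  simp only [cdet, ← hk, Fin.sum_univ_two, adj2, Matrix.cons_val_zero,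
    Matrix.cons_val_one, map_neg, map_mul, map_sub]
  ring

theorem CartanGeometry.cdet_eq_hdet {B : Type*} {hh : Fin 2 → Fin 2 → B → ℂ} {b : B}
    (hherm : ∀ i j, hh i j b = conj (hh j i b)) :
    cdet (fun i j => hh i j b) = (CartanGeometry.hdet hh b : ℂ) := by
  have h1 : conj (hh 0 0 b * hh 1 1 b) = hh 0 0 b * hh 1 1 b := by
    rw [map_mul, ← hherm, ← hherm]
  have h2 := Complex.conj_eq_iff_re.1 h1
  rw [cdet, CartanGeometry.hdet, hherm 1 0, Complex.mul_conj, ← Complex.sq_norm]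
  push_cast
  rw [h2]

end HermitianForms

/-! ### The soldering form and the form on the base -/

section Soldering

variable {M : Type*} [TopologicalSpace M] [ChartedSpace CSq M] [IsManifold 𝓘(ℂ, CSq) ω M]
variable {F : Type*} [NormedAddCommGroup F] [NormedSpace ℝ F]
variable {B : Type*} [TopologicalSpace B] [ChartedSpace F B] [IsManifold 𝓘(ℝ, F) ∞ B]

/-- The coefficients of the soldering form along an adapted section. -/
def solderMat (A : SL3) (i k : Fin 2) : ℂ := A.1 0 0 ^ 2 * adj2 (parOf A).1 i k

/-- The linear map with matrix `solderMat A`. -/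
def solderL (A : SL3) : CSq →L[ℝ] CSq :=
  ContinuousLinearMap.pi fun i => ∑ k, solderMat A i k • coordL k

theorem solderL_apply (A : SL3) (w : CSq) (i : Fin 2) :
    solderL A w i = ∑ k, solderMat A i k * w k := by
  simp [solderL, coordL]

/-- The corner is the inverse determinant of the block, so the inverse of the block is the corner
times the adjugate. The second factor of the corner in `solderMat` comes from the right-hand side.
-/
theorem eq_solderL {A : SL3} (hA : toPSL A ∈ P) {x w : CSq}
    (h : ∀ i : Fin 2, ∑ k : Fin 2, A.1 i.succ k.succ * x k = A.1 0 0 * w i) : x = solderL A w := by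
  have hd := mul_pdet_parOf hA
  have h0 := h 0
  have h1 := h 1
  simp only [pdet, parOf, Fin.succ_zero_eq_one, Fin.succ_one_eq_two] at hd
  simp only [Fin.sum_univ_two, Fin.succ_zero_eq_one, Fin.succ_one_eq_two] at h0 h1
  ext i
  rw [solderL_apply]
  revert i
  simp only [Fin.forall_fin_two, Fin.sum_univ_two, solderMat, adj2, parOf, Matrix.cons_val_zero,
    Matrix.cons_val_one, Fin.succ_zero_eq_one, Fin.succ_one_eq_two]
  constructor
  · linear_combination A.1 0 0 * (A.1 2 2 * h0 - A.1 1 2 * h1) - x 0 * hd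
  · linear_combination A.1 0 0 * (A.1 1 1 * h1 - A.1 2 1 * h0) - x 1 * hd

theorem sum_mul_solderL {A : SL3} (hA : toPSL A ∈ P) (w : CSq) (i : Fin 2) :
    ∑ k : Fin 2, A.1 i.succ k.succ * solderL A w k = A.1 0 0 * w i := by
  have hd := mul_pdet_parOf hA
  simp only [pdet, parOf, Fin.succ_zero_eq_one, Fin.succ_one_eq_two] at hd
  simp only [solderL_apply]
  revert i
  simp only [Fin.forall_fin_two, Fin.sum_univ_two, solderMat, adj2, parOf, Matrix.cons_val_zero,
    Matrix.cons_val_one, Fin.succ_zero_eq_one, Fin.succ_one_eq_two]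
  constructor
  · linear_combination A.1 0 0 * w 0 * hd
  · linear_combination A.1 0 0 * w 1 * hd

namespace CartanGeometry

variable {C : CartanGeometry M (F := F) B} {cov : Conn M}

open Classical in
/-- The map `T_x M → ℂ²`, `x = π b`, through which the soldering form factors. -/
def solder (C : CartanGeometry M (F := F) B) (b : B) : CSq →L[ℝ] CSq :=
  if h : ∃ L : CSq →L[ℝ] CSq, ∀ w i, L (mfderiv 𝓘(ℝ, F) 𝓘(ℝ, CSq) C.proj b w) i = C.θc i b w
  then h.choose else 0

theorem IsAdaptedSection.θc_eq {x₀ : M} {A : SL3} {τ : M → B}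
    (h : C.IsAdaptedSection cov x₀ A τ) {y : M} (hy : y ∈ (chartAt CSq x₀).source)
    (w : TangentSpace 𝓘(ℝ, F) (τ y)) (i : Fin 2) :
    (solderL A).comp (chartD x₀ y) (mfderiv 𝓘(ℝ, F) 𝓘(ℝ, CSq) C.proj (τ y) w) i
      = C.θc i (τ y) w :=
  (congrFun (eq_solderL h.mem (x := fun i => C.θc i (τ y) w) (h.sum_mul_θc hy w)) i).symm

theorem IsAdaptedSection.solder_eq {x₀ : M} {A : SL3} {τ : M → B}
    (h : C.IsAdaptedSection cov x₀ A τ) {y : M} (hy : y ∈ (chartAt CSq x₀).source) (u : CSq) :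
    C.solder (τ y) u = solderL A (chartD x₀ y u) := by
  have hex : ∃ L : CSq →L[ℝ] CSq, ∀ w i,
      L (mfderiv 𝓘(ℝ, F) 𝓘(ℝ, CSq) C.proj (τ y) w) i = C.θc i (τ y) w :=
    ⟨(solderL A).comp (chartD x₀ y), h.θc_eq hy⟩
  rw [solder, dif_pos hex]
  ext i
  have h1 := (hex.choose_spec (mfderiv 𝓘(ℝ, CSq) 𝓘(ℝ, F) τ y u) i).trans
    (h.θc_eq hy (mfderiv 𝓘(ℝ, CSq) 𝓘(ℝ, F) τ y u) i).symm
  have h2 : (mfderiv 𝓘(ℝ, F) 𝓘(ℝ, CSq) C.proj (τ y) (mfderiv 𝓘(ℝ, CSq) 𝓘(ℝ, F) τ y u) : CSq) = u :=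
    h.mfderiv_proj hy u
  exact (congrArg (fun v : CSq => hex.choose v i) h2).symm.trans
    (h1.trans (congrArg (fun v : CSq => solderL A (chartD x₀ y v) i) h2))

theorem IsGeometryOf.solder_proj (hC : C.IsGeometryOf cov) (b : B) (w : TangentSpace 𝓘(ℝ, F) b)
    (i : Fin 2) : C.solder b (mfderiv 𝓘(ℝ, F) 𝓘(ℝ, CSq) C.proj b w) i = C.θc i b w := by
  obtain ⟨A, τ, hτ, hb⟩ := hC.exists_isAdaptedSection b
  have hx := mem_chart_source CSq (C.proj b)
  -- With `π b` replaced by a variable, `b = τ x` can be substituted despite the dependent types.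
  generalize C.proj b = x at *
  subst hb
  exact (congrFun (hτ.solder_eq hx _) i).trans (hτ.θc_eq hx w i)

theorem IsGeometryOf.mfderiv_proj_surjective (hC : C.IsGeometryOf cov) (b : B) (u : CSq) :
    ∃ w : TangentSpace 𝓘(ℝ, F) b, (mfderiv 𝓘(ℝ, F) 𝓘(ℝ, CSq) C.proj b w : CSq) = u := by
  obtain ⟨A, τ, hτ, hb⟩ := hC.exists_isAdaptedSection b
  have hx := mem_chart_source CSq (C.proj b)
  generalize C.proj b = x at *
  subst hb
  exact ⟨_, hτ.mfderiv_proj hx u⟩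

/-- The first column of the equivariance identity `N θ(bq) = θ(b) N`; the determinant appears
because the corner of `N` is its inverse. -/
theorem IsGeometryOf.sum_mul_solder_orbit (hC : C.IsGeometryOf cov) (b : B) {q : Par}
    (hq : pdet q ≠ 0) (u : CSq) (i : Fin 2) :
    C.solder b u i = pdet q * ∑ k, q.1 i k * C.solder (C.orbit b q) u k := by
  obtain ⟨w, hw⟩ := hC.mfderiv_proj_surjective b u
  have hA := toPSL_coverSL_mem q hq
  have hR : (fun b' => C.act b' ⟨toPSL (coverSL q hq), hA⟩) = fun b' => C.orbit b' q :=
    funext fun b' => by rw [orbit, cover_eq q hq]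
  let w' : TangentSpace 𝓘(ℝ, F) (C.orbit b q) :=
    mfderiv 𝓘(ℝ, F) 𝓘(ℝ, F) (fun b' => C.orbit b' q) b w
  have hw' : (mfderiv 𝓘(ℝ, F) 𝓘(ℝ, CSq) C.proj (C.orbit b q) w' : CSq) = u := by
    have h1 := mfderiv_comp_apply b ((C.proj_smooth (C.orbit b q)).mdifferentiableAt (by simp))
      ((C.contMDiffAt_orbit_left b hq).mdifferentiableAt (by simp)) w
    have h2 : (C.proj ∘ fun b' => C.orbit b' q) = C.proj := funext fun b' => C.proj_act _ _
    rw [h2] at h1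
    exact h1.symm.trans hw
  have he := C.form_equivariant (coverSL q hq) hA b w
  have hact : C.act b ⟨toPSL (coverSL q hq), hA⟩ = C.orbit b q := congrFun hR b
  have hform : (C.form (C.act b ⟨toPSL (coverSL q hq), hA⟩) :
      F →L[ℝ] Matrix (Fin 3) (Fin 3) ℂ) = C.form (C.orbit b q) := by rw [hact]
  have he' : C.form (C.orbit b q) w' = ((coverSL q hq)⁻¹ : SL3).1 * C.form b w *
      coverMatrix q.1 q.2 := by
    refine Eq.trans ?_ he
    rw [hR]
    exact (congrArg (fun L : F →L[ℝ] Matrix (Fin 3) (Fin 3) ℂ => L w') hform).symm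
  have he2 : coverMatrix q.1 q.2 * C.form (C.orbit b q) w' = C.form b w * coverMatrix q.1 q.2 := by
    have hAA : coverMatrix q.1 q.2 * ((coverSL q hq)⁻¹ : SL3).1 = 1 :=
      congrArg Subtype.val (mul_inv_cancel (coverSL q hq))
    rw [he', ← Matrix.mul_assoc, ← Matrix.mul_assoc, hAA, Matrix.one_mul]
  have hs : ∀ k, C.solder (C.orbit b q) u k = C.form (C.orbit b q) w' k.succ 0 := fun k =>
    (congrArg (fun v : CSq => C.solder (C.orbit b q) v k) hw').symm.trans (hC.solder_proj _ w' k)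
  have hs0 : ∀ k, C.solder b u k = C.form b w k.succ 0 := fun k =>
    (congrArg (fun v : CSq => C.solder b v k) hw).symm.trans (hC.solder_proj _ w k)
  have h1 := congrFun (congrFun he2 i.succ) 0
  simp only [hs, hs0, Fin.sum_univ_two, Fin.succ_zero_eq_one, Fin.succ_one_eq_two]
  simp only [Matrix.mul_apply, Fin.sum_univ_three] at h1
  have hq' : (pdet q)⁻¹ * pdet q = 1 := inv_mul_cancel₀ hq
  revert i
  simp only [Fin.forall_fin_two, coverMatrix]
  simp only [pdet, Fin.succ_zero_eq_one, Fin.succ_one_eq_two] at hq' ⊢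
  constructor
  · intro h1
    simp at h1
    linear_combination C.form b w 1 0 * (-hq') - (q.1 0 0 * q.1 1 1 - q.1 0 1 * q.1 1 0) * h1
  · intro h1
    simp at h1
    linear_combination C.form b w 2 0 * (-hq') - (q.1 0 0 * q.1 1 1 - q.1 0 1 * q.1 1 0) * h1

/-- The hermitian form `h_{i\bar j} θ^i_0 ∘ \bar θ^j_0 / (h_{1\bar 1} h_{2\bar 2} - |h_{1\bar 2}|²)²`,
as a bilinear form on the tangent space of `M` at `π b`. -/
def bform (C : CartanGeometry M (F := F) B) (hh : Fin 2 → Fin 2 → B → ℂ) (b : B) :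
    CSq →L[ℝ] CSq →L[ℝ] ℝ :=
  LinearMap.toContinuousBilinearMap <| LinearMap.mk₂ ℝ
    (fun u v => (sform (fun i j => hh i j b) (C.solder b u) (C.solder b v)).re / hdet hh b ^ 2)
    (fun u u' v => by simp [sform, Fin.sum_univ_two]; ring)
    (fun c u v => by simp [sform, Fin.sum_univ_two]; ring)
    (fun u v v' => by simp [sform, Fin.sum_univ_two]; ring)
    (fun c u v => by simp [sform, Fin.sum_univ_two]; ring)

theorem bform_apply (hh : Fin 2 → Fin 2 → B → ℂ) (b : B) (u v : CSq) :
    C.bform hh b u v =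
      (sform (fun i j => hh i j b) (C.solder b u) (C.solder b v)).re / hdet hh b ^ 2 := rfl

theorem IsGeometryOf.quadForm_eq (hC : C.IsGeometryOf cov) (hh : Fin 2 → Fin 2 → B → ℂ) (b : B)
    (w : TangentSpace 𝓘(ℝ, F) b) :
    C.quadForm hh b w = C.bform hh b (mfderiv 𝓘(ℝ, F) 𝓘(ℝ, CSq) C.proj b w)
      (mfderiv 𝓘(ℝ, F) 𝓘(ℝ, CSq) C.proj b w) := by
  have hs : (fun i => C.θc i b w) = C.solder b (mfderiv 𝓘(ℝ, F) 𝓘(ℝ, CSq) C.proj b w) :=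
    funext fun i => (hC.solder_proj b w i).symm
  exact congrArg (fun s : CSq => (sform (fun i j => hh i j b) s s).re / hdet hh b ^ 2) hs

/-- The numerator scales by `|pdet q|⁴` and `hdet` by `|pdet q|²`, so the exponent two in the
denominator is the one that makes the quotient invariant. -/
theorem IsGeometryOf.bform_orbit (hC : C.IsGeometryOf cov) {hh : Fin 2 → Fin 2 → B → ℂ}
    {hv : Fin 2 → B → ℂ} {h : B → ℝ} {U : Set B} (hsol : C.IsSolutionOn hh hv h U)
    (hUo : IsOpen U) (b : B) {q : Par}
    (hq : ∀ t ∈ Icc (0 : ℝ) 1, pdet (parOne + t • (q - parOne)) ≠ 0 ∧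
      C.orbit b (parOne + t • (q - parOne)) ∈ U) :
    C.bform hh (C.orbit b q) = C.bform hh b := by
  have hk := hsol.congruence_orbit hUo b hq
  have hb : b ∈ U := by simpa using (hq 0 (by simp)).2
  obtain ⟨hp, hb'⟩ : pdet q ≠ 0 ∧ C.orbit b q ∈ U := by simpa using hq 1 (by simp)
  have hdet := cdet_congruence (k := fun i j => hh i j b) (k' := fun i j => hh i j (C.orbit b q)) hk
  rw [cdet_eq_hdet (hsol.hermitian b hb), cdet_eq_hdet (hsol.hermitian _ hb'),
    Complex.mul_conj, ← Complex.ofReal_mul, Complex.ofReal_inj] at hdet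
  ext u v
  rw [bform_apply, bform_apply, sform_congruence (k := fun i j => hh i j b)
    (k' := fun i j => hh i j (C.orbit b q)) hk rfl (hC.sum_mul_solder_orbit b hp u)
    (hC.sum_mul_solder_orbit b hp v), hdet]
  have hpos : Complex.normSq (pdet q) ≠ 0 := by simpa using hp
  change _ = ((pdet q * conj (pdet q)) ^ 2 * _).re / (Complex.normSq (pdet q) * _) ^ 2
  rw [Complex.mul_conj, ← Complex.ofReal_pow, Complex.re_ofReal_mul]
  field_simp

end CartanGeometry
end Soldering

/-! ### Pointwise algebra behind metric compatibility -/

section MetricAlgebra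

theorem two_mul_re (x : ℂ) : 2 * (x.re : ℂ) = x + conj x := by
  rw [Complex.add_conj]
  push_cast
  ring

/-- Compares connection matrices in the coframe (`m`) and in coordinates (`φ`). The inhomogeneous
term `v_i n_j` is again a multiple of `v`, so it merely replaces `α` by `μ = α - n/d` in one slot.
The terms in `β` turn `Π` into `Γ` and are taken away again by the covector. -/
theorem solder_connection {a m φ : Fin 2 → Fin 2 → ℂ} {n v y dy y' e dy' α β μ : Fin 2 → ℂ} {d : ℂ}
    (hm : ∀ i j, ∑ k, a i k * m k j = v i * n j + ∑ k, φ i k * a k j)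
    (hy : ∀ i, ∑ k, a i k * y' k = d * y i) (he : ∀ i, ∑ k, a i k * e k = d * v i)
    (hdy : ∀ i, ∑ k, a i k * dy' k = d * dy i) (hμ : ∀ k, d * μ k = d * α k - n k) (i : Fin 2) :
    ∑ k, a i k * (dy' k + (∑ j, m k j * y' j) + (∑ j, α j * e j) * y' k + (∑ j, μ j * y' j) * e k)
      = d * (dy i + ((∑ k, φ i k * y k) + (∑ j, β j * v j) * y i + (∑ j, β j * y j) * v i)
        + (((∑ j, α j * y' j) - ∑ j, β j * y j) * v i
          + ((∑ j, α j * e j) - ∑ j, β j * v j) * y i)) := by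
  have hm0 := hm i 0
  have hm1 := hm i 1
  have hy0 := hy 0
  have hy1 := hy 1
  have hyi := hy i
  have hei := he i
  have hdi := hdy i
  have hμ0 := hμ 0
  have hμ1 := hμ 1
  simp only [Fin.sum_univ_two] at *
  linear_combination hdi + y' 0 * hm0 + y' 1 * hm1 + φ i 0 * hy0 + φ i 1 * hy1
    + (α 0 * e 0 + α 1 * e 1) * hyi + (μ 0 * y' 0 + μ 1 * y' 1) * hei
    + v i * (y' 0 * hμ0 + y' 1 * hμ1)

/-- The equation for the derivative of `h_{i\bar j}`, at a point. -/
def IsFormDeriv (k dk m : Fin 2 → Fin 2 → ℂ) (x : ℂ) (e l l' : Fin 2 → ℂ) : Prop :=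
  ∀ i j, dk i j = 2 * k i j * (x.re : ℂ) + (∑ s, k i s * conj (m s j)) + (∑ s, k s j * m s i)
    + l i * (∑ s, conj (CartanGeometry.eps s j * e s)) + l' j * ∑ s, CartanGeometry.eps s i * e s

variable {k dk m : Fin 2 → Fin 2 → ℂ} {x : ℂ} {e l l' ψ μ ν α : Fin 2 → ℂ}

theorem IsFormDeriv.eq (h : IsFormDeriv k dk m x e l l')
    (hx : x = -∑ i, ν i * e i) (hl : ∀ i, l i = ∑ t, k i t * conj (ψ t))
    (hl' : ∀ j, l' j = ∑ t, k t j * ψ t) (i j : Fin 2) :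
    dk i j = k i j * (-(ν 0 * e 0 + ν 1 * e 1) - (conj (ν 0) * conj (e 0) + conj (ν 1) * conj (e 1)))
      + (k i 0 * conj (m 0 j) + k i 1 * conj (m 1 j)) + (k 0 j * m 0 i + k 1 j * m 1 i)
      + (k i 0 * conj (ψ 0) + k i 1 * conj (ψ 1)) * (if j = 0 then -conj (e 1) else conj (e 0))
      + (k 0 j * ψ 0 + k 1 j * ψ 1) * (if i = 0 then -e 1 else e 0) := by
  have h2 := two_mul_re x
  rw [h i j, hl, hl']
  have he : ∀ i, (∑ s, (CartanGeometry.eps s i : ℂ) * e s) = if i = 0 then -e 1 else e 0 := by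
    simp [Fin.forall_fin_two, CartanGeometry.eps]
  have he' : ∀ i, (∑ s, conj ((CartanGeometry.eps s i : ℂ) * e s))
      = if i = 0 then -conj (e 1) else conj (e 0) := by
    simp [Fin.forall_fin_two, CartanGeometry.eps]
  rw [he, he']
  simp only [hx, Fin.sum_univ_two, map_neg, map_add, map_mul] at h2 ⊢
  linear_combination k i j * h2

/-- With `l'` expressed through `ψ`, the `ε` term acts on `y` as `(e_0 y_1 - e_1 y_0)ψ = μ(y)e -
μ(e)y`. Together with `x = -ν(e)` this gives `m y + μ(y)e - α(e)y`; the term with factor `4` turns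
the last sign around. -/
theorem IsFormDeriv.sform_eq (h : IsFormDeriv k dk m x e l l')
    (hx : x = -∑ i, ν i * e i) (hl : ∀ i, l i = ∑ t, k i t * conj (ψ t))
    (hl' : ∀ j, l' j = ∑ t, k t j * ψ t) (hμ0 : μ 0 = -ψ 1) (hμ1 : μ 1 = ψ 0)
    (hα : ∀ i, α i = μ i + ν i) (y dy z dz : Fin 2 → ℂ) :
    sform dk y z + sform k dy z + sform k y dz + 4 * ((∑ j, α j * e j).re : ℂ) * sform k y z
      = sform k (fun i => dy i + (∑ j, m i j * y j) + (∑ j, α j * e j) * y i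
          + (∑ j, μ j * y j) * e i) z
        + sform k y (fun i => dz i + (∑ j, m i j * z j) + (∑ j, α j * e j) * z i
          + (∑ j, μ j * z j) * e i) := by
  have h2 := two_mul_re (∑ j, α j * e j)
  have h4 : 4 * ((∑ j, α j * e j).re : ℂ) = 2 * (∑ j, α j * e j) + 2 * conj (∑ j, α j * e j) := by
    linear_combination 2 * h2
  have hd := h.eq hx hl hl'
  rw [h4]
  simp only [sform, Fin.sum_univ_two, hα, hμ0, hμ1, hd, map_add, map_mul, map_neg, if_true,
    one_ne_zero, if_false]
  ring

/-- The logarithmic derivative of the determinant is twice the real part of the trace of `y ↦ m y +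
μ(y)e - α(e)y`. That trace is `ν(e) + μ(e) - 2α(e) = -α(e)`, since `tr m = -x = ν(e)`. -/
theorem IsFormDeriv.cdet_eq (h : IsFormDeriv k dk m x e l l')
    (hx : x = -∑ i, ν i * e i) (hl : ∀ i, l i = ∑ t, k i t * conj (ψ t))
    (hl' : ∀ j, l' j = ∑ t, k t j * ψ t) (hμ0 : μ 0 = -ψ 1) (hμ1 : μ 1 = ψ 0)
    (hα : ∀ i, α i = μ i + ν i) (htr : x = -(m 0 0 + m 1 1)) :
    dk 0 0 * k 1 1 + k 0 0 * dk 1 1 - (dk 0 1 * k 1 0 + k 0 1 * dk 1 0)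
      = -2 * ((∑ j, α j * e j).re : ℂ) * cdet k := by
  have h2 := two_mul_re (∑ j, α j * e j)
  have hd := h.eq hx hl hl'
  have h11 : m 1 1 = (ν 0 * e 0 + ν 1 * e 1) - m 0 0 := by
    rw [Fin.sum_univ_two] at hx
    linear_combination htr - hx
  have h3 : -2 * ((∑ j, α j * e j).re : ℂ) = -(∑ j, α j * e j) - conj (∑ j, α j * e j) := by
    linear_combination -h2
  rw [h3]
  simp only [cdet, Fin.sum_univ_two, hα, hμ0, hμ1, hd, h11, map_add, map_mul, map_neg, map_sub,
    if_true, one_ne_zero, if_false]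
  ring

/-- The real form `Re (k_{i\bar j} x_i \bar y_j) / (det k)²`, as a function of all the data. -/
def localForm (r : (Fin 2 → Fin 2 → ℂ) × CSq × CSq) : ℝ :=
  (sform r.1 r.2.1 r.2.2).re / (cdet r.1).re ^ 2

theorem contDiff_cdet_re : ContDiff ℝ ∞ (fun k : Fin 2 → Fin 2 → ℂ => (cdet k).re) := by
  have h : ContDiff ℝ ∞ (fun k : Fin 2 → Fin 2 → ℂ => cdet k) := by
    unfold cdet
    fun_prop
  exact Complex.reCLM.contDiff.comp h

theorem contDiffAt_localForm {r : (Fin 2 → Fin 2 → ℂ) × CSq × CSq} (hr : (cdet r.1).re ≠ 0) :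
    ContDiffAt ℝ ∞ localForm r := by
  refine ContDiffAt.div ?_ ((contDiff_cdet_re.comp contDiff_fst).pow 2).contDiffAt
    (pow_ne_zero 2 hr)
  suffices h : ContDiff ℝ ∞ fun r : (Fin 2 → Fin 2 → ℂ) × CSq × CSq => sform r.1 r.2.1 r.2.2 from
    (Complex.reCLM.contDiff.comp h).contDiffAt
  simp only [sform]
  refine ContDiff.sum fun i _ => ContDiff.sum fun j _ => ContDiff.mul (by fun_prop) ?_
  exact Complex.conjCLE.contDiff.comp (f := fun r : (Fin 2 → Fin 2 → ℂ) × CSq × CSq => r.2.2 j)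
    (by fun_prop)

/-- The determinant has logarithmic derivative `-2c`, so its power `-2` contributes the `4c`
required by `IsFormDeriv.sform_eq`. -/
theorem hasDerivAt_localForm {K : ℝ → Fin 2 → Fin 2 → ℂ} {Y Z : ℝ → Fin 2 → ℂ}
    {k dK : Fin 2 → Fin 2 → ℂ} {y z dY dZ : Fin 2 → ℂ} {c : ℝ}
    (hk : K 0 = k) (hy : Y 0 = y) (hz : Z 0 = z)
    (hK : ∀ i j, HasDerivAt (fun t => K t i j) (dK i j) 0)
    (hY : ∀ i, HasDerivAt (fun t => Y t i) (dY i) 0)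
    (hZ : ∀ i, HasDerivAt (fun t => Z t i) (dZ i) 0) (h0 : (cdet k).re ≠ 0)
    (hd : dK 0 0 * k 1 1 + k 0 0 * dK 1 1 - (dK 0 1 * k 1 0 + k 0 1 * dK 1 0)
      = -2 * (c : ℂ) * cdet k) :
    HasDerivAt (fun t => localForm (K t, Y t, Z t))
      ((sform dK y z + sform k dY z + sform k y dZ + 4 * (c : ℂ) * sform k y z).re
        / (cdet k).re ^ 2) 0 := by
  subst hk hy hz
  have hZc : ∀ i, HasDerivAt (fun t => conj (Z t i)) (conj (dZ i)) 0 := fun i => by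
    simpa using (hZ i).star
  have h1 : HasDerivAt (fun t => sform (K t) (Y t) (Z t)) (sform dK (Y 0) (Z 0)
      + sform (K 0) dY (Z 0) + sform (K 0) (Y 0) dZ) 0 := by
    have := HasDerivAt.fun_sum (u := Finset.univ) fun i _ =>
      HasDerivAt.fun_sum (u := Finset.univ) fun j _ => ((hK i j).mul (hY i)).mul (hZc j)
    refine this.congr_deriv ?_
    simp only [sform, Fin.sum_univ_two, Pi.mul_apply]
    ring
  have h2 : HasDerivAt (fun t => cdet (K t)) (-2 * (c : ℂ) * cdet (K 0)) 0 := by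
    have := ((hK 0 0).mul (hK 1 1)).sub ((hK 0 1).mul (hK 1 0))
    exact this.congr_deriv hd
  have h1r := Complex.reCLM.hasFDerivAt.comp_hasDerivAt (0 : ℝ) h1
  have h2r := Complex.reCLM.hasFDerivAt.comp_hasDerivAt (0 : ℝ) h2
  have h3 := h1r.div (h2r.pow 2) (pow_ne_zero 2 h0)
  refine h3.congr_deriv ?_
  have e1 : (-2 * (c : ℂ) * cdet (K 0)).re = -2 * c * (cdet (K 0)).re := by
    rw [← Complex.re_ofReal_mul]; push_cast; rfl
  have e2 (s : ℂ) : (4 * (c : ℂ) * s).re = 4 * c * s.re := by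
    rw [← Complex.re_ofReal_mul]; push_cast; rfl
  simp only [Pi.pow_apply, Function.comp, Complex.reCLM_apply, e1, Complex.add_re, e2]
  field_simp
  ring

end MetricAlgebra

/-! ### Functions on the bundle along a section -/

section CurveComposition

variable {E : Type*} [NormedAddCommGroup E] [NormedSpace ℝ E]
variable {N : Type*} [TopologicalSpace N] [ChartedSpace E N]
variable {F : Type*} [NormedAddCommGroup F] [NormedSpace ℝ F]
variable {B : Type*} [TopologicalSpace B] [ChartedSpace F B]
variable {G : Type*} [NormedAddCommGroup G] [NormedSpace ℝ G]

theorem hasDerivAt_comp_chartLine {f : B → G} {τ : N → B} {y : N}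
    (hτ : MDifferentiableAt 𝓘(ℝ, E) 𝓘(ℝ, F) τ y)
    (hf : MDifferentiableAt 𝓘(ℝ, F) 𝓘(ℝ, G) f (τ y)) (v : TangentSpace 𝓘(ℝ, E) y) :
    HasDerivAt (fun t => f (τ (chartLine (E := E) y v t)))
      (mvfderiv 𝓘(ℝ, F) f (τ y) (mfderiv 𝓘(ℝ, E) 𝓘(ℝ, F) τ y v)) 0 := by
  have h1 := hasDerivAt_chartLine (hf.comp y hτ) v
  exact h1.congr_deriv (mfderiv_comp_apply y hf hτ v)

end CurveComposition

/-! ### Metric compatibility along an adapted section -/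

section MetricAlongSection

/-- The complex covector with the given components. -/
def covL : CSq →L[ℝ] CSq →L[ℝ] ℂ :=
  LinearMap.toContinuousBilinearMap <| LinearMap.mk₂ ℝ (fun γ w => ∑ k, γ k * w k)
    (fun γ γ' w => by simp [Fin.sum_univ_two]; ring)
    (fun c γ w => by simp [Fin.sum_univ_two]; ring)
    (fun γ w w' => by simp [Fin.sum_univ_two]; ring)
    (fun c γ w => by simp [Fin.sum_univ_two]; ring)

theorem covL_apply (γ w : CSq) : covL γ w = ∑ k, γ k * w k := rfl

/-- The solution `ψ` of `∑ t, k t j * ψ t = l j`. -/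
def cramer (k : Fin 2 → Fin 2 → ℂ) (l : Fin 2 → ℂ) : Fin 2 → ℂ :=
  ![(l 0 * k 1 1 - l 1 * k 1 0) / cdet k, (k 0 0 * l 1 - k 0 1 * l 0) / cdet k]

theorem sum_mul_cramer {k : Fin 2 → Fin 2 → ℂ} (hk : cdet k ≠ 0) (l : Fin 2 → ℂ) (j : Fin 2) :
    l j = ∑ t, k t j * cramer k l t := by
  have h1 := div_mul_cancel₀ (l 0 * k 1 1 - l 1 * k 1 0) hk
  have h2 := div_mul_cancel₀ (k 0 0 * l 1 - k 0 1 * l 0) hk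
  apply mul_right_cancel₀ hk
  rw [Finset.sum_mul]
  revert j
  simp only [Fin.forall_fin_two, Fin.sum_univ_two, cramer, Matrix.cons_val_zero,
    Matrix.cons_val_one, mul_assoc, h1, h2]
  unfold cdet
  constructor <;> ring

/-- The components, in terms of the coframe, of the covector that occurs in the change to the
Levi-Civita connection. -/
def muCoeff (k : Fin 2 → Fin 2 → ℂ) (l : Fin 2 → ℂ) : Fin 2 → ℂ := ![-cramer k l 1, cramer k l 0]

variable {M : Type*} [TopologicalSpace M] [ChartedSpace CSq M] [IsManifold 𝓘(ℂ, CSq) ω M]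
variable {F : Type*} [NormedAddCommGroup F] [NormedSpace ℝ F]
variable {B : Type*} [TopologicalSpace B] [ChartedSpace F B] [IsManifold 𝓘(ℝ, F) ∞ B]

/-- The components in the chart at `x₀` of the covector that changes `cov` to the Levi-Civita
connection. -/
def metricCoeff (cov : Conn M) (hh : Fin 2 → Fin 2 → B → ℂ) (hv : Fin 2 → B → ℂ) (x₀ : M) (A : SL3)
    (τ : M → B) (y : M) : CSq := fun k =>
  (∑ i, (muCoeff (fun i j => hh i j (τ y)) (fun j => conj (hv j (τ y))) i
      + A.1 0 i.succ / A.1 0 0) * solderMat A i k)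
    - 1 / 3 * ∑ l, christoffel cov (chartAt CSq x₀) l l k y

/-- The definition of `Π` solved for `Γ`. Symmetry of `Γ` is needed because `v` and `w` are
contracted in opposite order on the two sides. -/
theorem sum_christoffel_eq {cov : Conn M} (hcov : IsComplexLinearOn cov univ) {x₀ y : M}
    (hy : y ∈ (chartAt CSq x₀).source) (v w : CSq) (i : Fin 2) :
    ∑ j, ∑ k, christoffel cov (chartAt CSq x₀) i j k y * v j * w k =
      (∑ k, (∑ l, projInv cov (chartAt CSq x₀) i k l y * v l) * w k)
        + (∑ j, (1 / 3 * ∑ l, christoffel cov (chartAt CSq x₀) l l j y) * v j) * w i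
        + (∑ j, (1 / 3 * ∑ l, christoffel cov (chartAt CSq x₀) l l j y) * w j) * v i := by
  have hs := christoffel_symm hcov hy i 0 1
  revert i
  simp only [Fin.forall_fin_two, Fin.sum_univ_two, projInv, if_true, one_ne_zero, zero_ne_one,
    if_false]
  constructor
  · intro hs
    linear_combination (v 0 * w 1 - v 1 * w 0) * hs
  · intro hs
    linear_combination (v 0 * w 1 - v 1 * w 0) * hs

namespace CartanGeometry

variable {C : CartanGeometry M (F := F) B} {cov : Conn M} {x₀ : M} {A : SL3} {τ : M → B}
variable {hh : Fin 2 → Fin 2 → B → ℂ} {hv : Fin 2 → B → ℂ} {h : B → ℝ} {U : Set B}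

theorem bform_eq_localForm {b : B} (hherm : ∀ i j, hh i j b = conj (hh j i b)) (u v : CSq) :
    C.bform hh b u v = localForm (fun i j => hh i j b, C.solder b u, C.solder b v) := by
  rw [bform_apply, localForm, cdet_eq_hdet hherm, Complex.ofReal_re]

/-- The derivative of `solderL A (chartD x₀ p (Y p))` at `y` along `v`. -/
def solderDeriv (x₀ : M) (A : SL3) (Y : VField M) (y : M) (v : TangentSpace 𝓘(ℝ, CSq) y) : CSq :=
  solderL A fun k => mvfderiv 𝓘(ℝ, CSq) (fun p => chartD x₀ p (Y p) k) y v

theorem hasDerivAt_solderL {y : M} (hy : y ∈ (chartAt CSq x₀).source) {Y : VField M}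
    (hY : DiffFieldAt Y y) (v : TangentSpace 𝓘(ℝ, CSq) y) (i : Fin 2) :
    HasDerivAt (fun t => solderL A (chartD x₀ (chartLine (E := CSq) y v t)
      (Y (chartLine (E := CSq) y v t))) i) (solderDeriv x₀ A Y y v i) 0 := by
  simp only [solderDeriv, solderL_apply]
  exact HasDerivAt.fun_sum fun k _ =>
    (hasDerivAt_chartLine (mdifferentiableAt_component hy hY k) v).const_mul _

/-- Writes the changed covariant derivative in the coframe of `τ`, in the shape that
`IsFormDeriv.sform_eq` produces. The choice of `metricCoeff` makes the Christoffel traces cancel. -/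
theorem solderL_cov (hcov : IsComplexLinearOn cov univ) (hτ : C.IsAdaptedSection cov x₀ A τ)
    {y : M} (hy : y ∈ (chartAt CSq x₀).source) {Y : VField M} (hY : DiffFieldAt Y y)
    (v : TangentSpace 𝓘(ℝ, CSq) y) :
    solderL A (chartD x₀ y (cov Y y v
        + projTensor y ((covL (metricCoeff cov hh hv x₀ A τ y)).comp (chartD x₀ y)) (Y y) v)) =
      fun k =>
        let μ := muCoeff (fun i j => hh i j (τ y)) (fun j => conj (hv j (τ y)))
        let e := solderL A (chartD x₀ y v)
        let y' := solderL A (chartD x₀ y (Y y))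
        solderDeriv x₀ A Y y v k
          + (∑ j, C.θm k j (τ y) (mfderiv 𝓘(ℝ, CSq) 𝓘(ℝ, F) τ y v) * y' j)
          + (∑ j, (μ j + A.1 0 j.succ / A.1 0 0) * e j) * y' k + (∑ j, μ j * y' j) * e k := by
  have hd : A.1 0 0 ≠ 0 := left_ne_zero_of_mul (mul_pdet_parOf hτ.mem ▸ one_ne_zero)
  have hcovL : ∀ u, covL (metricCoeff cov hh hv x₀ A τ y) u =
      (∑ j, (muCoeff (fun i j => hh i j (τ y)) (fun j => conj (hv j (τ y))) j
        + A.1 0 j.succ / A.1 0 0) * solderL A u j)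
      - ∑ j, (1 / 3 * ∑ l, christoffel cov (chartAt CSq x₀) l l j y) * u j := fun u => by
    simp only [covL_apply, metricCoeff, solderL_apply, Fin.sum_univ_two]
    ring
  refine (eq_solderL hτ.mem fun i => ?_).symm
  refine (solder_connection (a := fun i k => A.1 i.succ k.succ)
    (φ := fun i k => ∑ l, projInv cov (chartAt CSq x₀) i k l y * chartD x₀ y v l)
    (n := fun j => A.1 0 j.succ) (v := chartD x₀ y v) (y := chartD x₀ y (Y y))
    (dy := fun k => mvfderiv 𝓘(ℝ, CSq) (fun p => chartD x₀ p (Y p) k) y v)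
    (β := fun j => 1 / 3 * ∑ l, christoffel cov (chartAt CSq x₀) l l j y)
    (hτ.form_block y hy v) (sum_mul_solderL hτ.mem _) (sum_mul_solderL hτ.mem _)
    (sum_mul_solderL hτ.mem _) (fun k => ?_) i).trans ?_
  · field_simp
    ring
  · congr 1
    rw [projTensor_apply, map_add, map_add, chartD_csmul hy, chartD_csmul hy, Pi.add_apply,
      chartD_cov hcov hy hY, sum_christoffel_eq hcov hy]
    simp only [Pi.add_apply, Pi.smul_apply, smul_eq_mul, ContinuousLinearMap.comp_apply, hcovL]

theorem isFormDeriv (hτ : C.IsAdaptedSection cov x₀ A τ) (hsol : C.IsSolutionOn hh hv h U) {y : M}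
    (hy : y ∈ (chartAt CSq x₀).source) (hyU : τ y ∈ U) (v : TangentSpace 𝓘(ℝ, CSq) y) :
    IsFormDeriv (fun i j => hh i j (τ y))
      (fun i j => mvfderiv 𝓘(ℝ, F) (hh i j) (τ y) (mfderiv 𝓘(ℝ, CSq) 𝓘(ℝ, F) τ y v))
      (fun i j => C.θm i j (τ y) (mfderiv 𝓘(ℝ, CSq) 𝓘(ℝ, F) τ y v))
      (C.θ00 (τ y) (mfderiv 𝓘(ℝ, CSq) 𝓘(ℝ, F) τ y v)) (solderL A (chartD x₀ y v))
      (fun i => hv i (τ y)) (fun i => conj (hv i (τ y))) := by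
  have he : solderL A (chartD x₀ y v) =
      fun i => C.θc i (τ y) (mfderiv 𝓘(ℝ, CSq) 𝓘(ℝ, F) τ y v) :=
    (eq_solderL hτ.mem (hτ.form_col y hy v)).symm
  rw [he]
  exact hsol.eq_hh (τ y) hyU _

/-- Near `y` the metric is `localForm` evaluated along `τ`. Its derivative along a chart line
follows from `IsFormDeriv.cdet_eq`, and `IsFormDeriv.sform_eq` splits it into the two covariant
derivatives. -/
theorem IsAdaptedSection.isMetricCovector (hcov : IsComplexLinearOn cov univ)
    (hτ : C.IsAdaptedSection cov x₀ A τ) (hsol : C.IsSolutionOn hh hv h U) (hUo : IsOpen U)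
    {y : M} (hy : y ∈ (chartAt CSq x₀).source) (hyU : τ y ∈ U) (hdet : hdet hh (τ y) ≠ 0)
    {g : BilinField M}
    (hg : ∀ᶠ p in 𝓝 y, ∀ u v : TangentSpace 𝓘(ℝ, CSq) p, g p u v = C.bform hh (τ p) u v) :
    IsMetricCovector g cov y
      ((covL (metricCoeff cov hh hv x₀ A τ y)).comp (chartD x₀ y)) where
  complex_linear v := by
    simp only [ContinuousLinearMap.comp_apply, chartD_J hy, covL_apply, Fin.sum_univ_two,
      Pi.smul_apply, smul_eq_mul]
    ring
  metric Y Z hY hZ v := by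
    have hτd : MDifferentiableAt 𝓘(ℝ, CSq) 𝓘(ℝ, F) τ y :=
      (hτ.contMDiffAt hy).mdifferentiableAt (by simp)
    have hhd : ∀ i j, MDifferentiableAt 𝓘(ℝ, F) 𝓘(ℝ, ℂ) (hh i j) (τ y) := fun i j =>
      ((hsol.smooth_hh i j _ hyU).contMDiffAt (hUo.mem_nhds hyU)).mdifferentiableAt (by simp)
    have hherm := hsol.hermitian (τ y) hyU
    have hc : cdet (fun i j => hh i j (τ y)) ≠ 0 := by
      rw [cdet_eq_hdet hherm]; exact_mod_cast hdet
    have hcr : (cdet (fun i j => hh i j (τ y))).re ≠ 0 := by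
      rwa [cdet_eq_hdet hherm, Complex.ofReal_re]
    have hsolder : ∀ p ∈ (chartAt CSq x₀).source, ∀ u : TangentSpace 𝓘(ℝ, CSq) p,
        C.solder (τ p) u = solderL A (chartD x₀ p u) := fun p hp u => hτ.solder_eq hp u
    have hev : (fun p => g p (Y p) (Z p)) =ᶠ[𝓝 y] fun p => localForm
        (fun i j => hh i j (τ p), solderL A (chartD x₀ p (Y p)), solderL A (chartD x₀ p (Z p))) := by
      filter_upwards [hg, (chartAt CSq x₀).open_source.mem_nhds hy,
        hτd.continuousAt.preimage_mem_nhds (hUo.mem_nhds hyU)] with p hgp hp hpU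
      rw [hgp]
      refine (bform_eq_localForm (hsol.hermitian (τ p) hpU) _ _).trans ?_
      rw [hsolder p hp, hsolder p hp]
    have hgd : ∀ u w : TangentSpace 𝓘(ℝ, CSq) y, g y u w =
        (sform (fun i j => hh i j (τ y)) (solderL A (chartD x₀ y u))
          (solderL A (chartD x₀ y w))).re / (cdet (fun i j => hh i j (τ y))).re ^ 2 := by
      intro u w
      rw [hg.self_of_nhds]
      refine (bform_eq_localForm hherm _ _).trans ?_
      rw [hsolder y hy, hsolder y hy]
      rfl
    have hYd := (solderL A).differentiable.comp_mdifferentiableAt ((diffFieldAt_iff hy Y).1 hY)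
    have hZd := (solderL A).differentiable.comp_mdifferentiableAt ((diffFieldAt_iff hy Z).1 hZ)
    have hHd : MDifferentiableAt 𝓘(ℝ, CSq) 𝓘(ℝ, Fin 2 → Fin 2 → ℂ)
        (fun p i j => hh i j (τ p)) y := by
      refine ContMDiffAt.mdifferentiableAt (n := ∞) (contMDiffAt_pi_space.2 fun i =>
        contMDiffAt_pi_space.2 fun j => ?_) (by simp)
      exact ((hsol.smooth_hh i j _ hyU).contMDiffAt (hUo.mem_nhds hyU)).comp y (hτ.contMDiffAt hy)
    have hmd : MDifferentiableAt 𝓘(ℝ, CSq) 𝓘(ℝ, ℝ) (fun p => g p (Y p) (Z p)) y := by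
      refine MDifferentiableAt.congr_of_eventuallyEq ?_ hev
      exact DifferentiableAt.comp_mdifferentiableAt (f := fun p => (fun i j => hh i j (τ p),
        solderL A (chartD x₀ p (Y p)), solderL A (chartD x₀ p (Z p))))
        ((contDiffAt_localForm (r := (fun i j => hh i j (τ y), solderL A (chartD x₀ y (Y y)),
          solderL A (chartD x₀ y (Z y)))) hcr).differentiableAt (by simp))
        (hHd.prodMk_space (hYd.prodMk_space hZd))
    have hform := isFormDeriv hτ hsol hy hyU v
    have hψ := sum_mul_cramer hc fun j => conj (hv j (τ y))
    have hψ' : ∀ i, hv i (τ y) = ∑ t, hh i t (τ y) *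
        conj (cramer (fun i j => hh i j (τ y)) (fun j => conj (hv j (τ y))) t) := fun i => by
      have := congrArg conj (hψ i)
      simp only [Complex.conj_conj, map_sum, map_mul, ← hherm] at this
      exact this
    have hd : A.1 0 0 ≠ 0 := left_ne_zero_of_mul (mul_pdet_parOf hτ.mem ▸ one_ne_zero)
    have he : solderL A (chartD x₀ y v) =
        fun i => C.θc i (τ y) (mfderiv 𝓘(ℝ, CSq) 𝓘(ℝ, F) τ y v) :=
      (eq_solderL hτ.mem (hτ.form_col y hy v)).symm
    -- Translation by `A` makes `θ^0_0` nonzero along `τ`; this expresses it through the coframe,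
    -- with `ν_i` the upper row of `A` divided by the corner.
    have hx : C.θ00 (τ y) (mfderiv 𝓘(ℝ, CSq) 𝓘(ℝ, F) τ y v) =
        -∑ i : Fin 2, A.1 0 i.succ / A.1 0 0 * solderL A (chartD x₀ y v) i := by
      have := hτ.form_zero y hy v
      rw [he]
      apply mul_left_cancel₀ hd
      simp only [Fin.sum_univ_two] at this ⊢
      field_simp
      linear_combination this
    have hℓ : chartLine (E := CSq) y v 0 = y := chartLine_zero y _
    let μ := muCoeff (fun i j => hh i j (τ y)) fun j => conj (hv j (τ y))
    have hder := hasDerivAt_localForm (congrArg (fun p i j => hh i j (τ p)) hℓ)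
      (congrArg (fun p => solderL A (chartD x₀ p (Y p))) hℓ)
      (congrArg (fun p => solderL A (chartD x₀ p (Z p))) hℓ)
      (fun i j => hasDerivAt_comp_chartLine hτd (hhd i j) v)
      (hasDerivAt_solderL (A := A) hy hY v) (hasDerivAt_solderL (A := A) hy hZ v) hcr
      (hform.cdet_eq (μ := μ) (α := fun i => μ i + A.1 0 i.succ / A.1 0 0) hx hψ' hψ rfl rfl
        (fun i => rfl) (θ00_eq _ _))
    have hev' := eventually_chartLine (E := CSq) hev v
    rw [mvfderiv_eq_of_hasDerivAt hmd (hder.congr_of_eventuallyEq hev'), hgd, hgd,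
      solderL_cov hcov hτ hy hY, solderL_cov hcov hτ hy hZ, ← add_div, ← Complex.add_re,
      ← hform.sform_eq (μ := μ) (α := fun i => μ i + A.1 0 i.succ / A.1 0 0) hx hψ' hψ rfl rfl
        (fun i => rfl)]

end CartanGeometry
end MetricAlongSection

/-! ### Descent to the base -/

section Descent

theorem solderL_I_smul (A : SL3) (w : CSq) : solderL A (Complex.I • w) = Complex.I • solderL A w := by
  ext i
  simp only [solderL_apply, Pi.smul_apply, smul_eq_mul, Fin.sum_univ_two]
  ring

theorem sform_I_smul (k : Fin 2 → Fin 2 → ℂ) (x y : CSq) :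
    sform k (Complex.I • x) (Complex.I • y) = sform k x y := by
  simp only [sform, Pi.smul_apply, smul_eq_mul, map_mul, Complex.conj_I, Fin.sum_univ_two]
  linear_combination (-(k 0 0 * x 0 * conj (y 0)) - k 0 1 * x 0 * conj (y 1)
    - k 1 0 * x 1 * conj (y 0) - k 1 1 * x 1 * conj (y 1)) * Complex.I_mul_I

theorem eq_zero_of_sform_re {k : Fin 2 → Fin 2 → ℂ} (hk : cdet k ≠ 0) {x : CSq}
    (h : ∀ y, (sform k x y).re = 0) : x = 0 := by
  -- The test vector is the image of `x` under the transposed matrix, which makes the value a sum of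
  -- squared moduli.
  have h1 := h fun j => ∑ i, k i j * x i
  have h2 : sform k x (fun j => ∑ i, k i j * x i) =
      ((Complex.normSq (∑ i, k i 0 * x i) + Complex.normSq (∑ i, k i 1 * x i) : ℝ) : ℂ) := by
    rw [Complex.ofReal_add, ← Complex.mul_conj, ← Complex.mul_conj]
    simp only [sform, Fin.sum_univ_two]
    ring
  rw [h2, Complex.ofReal_re] at h1
  have h3 := (add_eq_zero_iff_of_nonneg (Complex.normSq_nonneg _) (Complex.normSq_nonneg _)).1 h1
  obtain ⟨h4, h5⟩ := h3
  rw [Complex.normSq_eq_zero, Fin.sum_univ_two] at h4 h5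
  ext i
  apply mul_left_cancel₀ hk
  revert i
  simp only [Fin.forall_fin_two, cdet, Pi.zero_apply, mul_zero]
  constructor
  · linear_combination k 1 1 * h4 - k 1 0 * h5
  · linear_combination k 0 0 * h5 - k 0 1 * h4

theorem solderL_surjective {A : SL3} (hA : toPSL A ∈ P) (x : CSq) : ∃ w, solderL A w = x := by
  have hd : A.1 0 0 ≠ 0 := left_ne_zero_of_mul (mul_pdet_parOf hA ▸ one_ne_zero)
  refine ⟨fun i => (A.1 0 0)⁻¹ * ∑ k : Fin 2, A.1 i.succ k.succ * x k,
    (eq_solderL hA fun i => ?_).symm⟩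
  rw [mul_inv_cancel_left₀ hd]

theorem solderL_eq_zero {A : SL3} (hA : toPSL A ∈ P) {w : CSq} (h : solderL A w = 0) : w = 0 := by
  have hd : A.1 0 0 ≠ 0 := left_ne_zero_of_mul (mul_pdet_parOf hA ▸ one_ne_zero)
  ext i
  have := sum_mul_solderL hA w i
  simp only [h, Pi.zero_apply, mul_zero, Finset.sum_const_zero] at this
  exact (mul_eq_zero.1 this.symm).resolve_left hd

theorem contDiffAt_metricCoeff (s : Fin 2 → Fin 2 → ℂ) (c : Fin 2 → ℂ)
    {r : (Fin 2 → Fin 2 → ℂ) × CSq × CSq} (hr : cdet r.1 ≠ 0) :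
    ContDiffAt ℝ ∞ (fun r : (Fin 2 → Fin 2 → ℂ) × CSq × CSq => (fun k =>
      (∑ i, (muCoeff r.1 (fun j => conj (r.2.1 j)) i + c i) * s i k) - 1 / 3 * r.2.2 k : CSq)) r := by
  have hdet : ContDiffAt ℝ ∞ (fun r : (Fin 2 → Fin 2 → ℂ) × CSq × CSq => cdet r.1) r := by
    unfold cdet
    fun_prop
  have hconj (j : Fin 2) : ContDiff ℝ ∞
      (fun r : (Fin 2 → Fin 2 → ℂ) × CSq × CSq => conj (r.2.1 j)) :=
    Complex.conjCLE.contDiff.comp (f := fun r : (Fin 2 → Fin 2 → ℂ) × CSq × CSq => r.2.1 j)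
      (by fun_prop)
  have h0 : ContDiffAt ℝ ∞ (fun r : (Fin 2 → Fin 2 → ℂ) × CSq × CSq =>
      cramer r.1 (fun j => conj (r.2.1 j)) 0) r := by
    simp only [cramer, Matrix.cons_val_zero, div_eq_mul_inv]
    refine ContDiffAt.mul ?_ (hdet.inv hr)
    exact (((hconj 0).mul (by fun_prop)).sub ((hconj 1).mul (by fun_prop))).contDiffAt
  have h1 : ContDiffAt ℝ ∞ (fun r : (Fin 2 → Fin 2 → ℂ) × CSq × CSq =>
      cramer r.1 (fun j => conj (r.2.1 j)) 1) r := by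
    simp only [cramer, Matrix.cons_val_one, div_eq_mul_inv]
    refine ContDiffAt.mul ?_ (hdet.inv hr)
    exact ((ContDiff.mul (by fun_prop) (hconj 1)).sub
      (ContDiff.mul (by fun_prop) (hconj 0))).contDiffAt
  have hμ : ∀ i, ContDiffAt ℝ ∞ (fun r : (Fin 2 → Fin 2 → ℂ) × CSq × CSq =>
      muCoeff r.1 (fun j => conj (r.2.1 j)) i) r := Fin.forall_fin_two.2 ⟨h1.neg, h0⟩
  refine contDiffAt_pi.2 fun k => ContDiffAt.sub ?_ (by fun_prop)
  exact ContDiffAt.sum fun i _ => ((hμ i).add contDiffAt_const).mul contDiffAt_const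

variable {M : Type*} [TopologicalSpace M] [ChartedSpace CSq M] [IsManifold 𝓘(ℂ, CSq) ω M]
variable {F : Type*} [NormedAddCommGroup F] [NormedSpace ℝ F]
variable {B : Type*} [TopologicalSpace B] [ChartedSpace F B] [IsManifold 𝓘(ℝ, F) ∞ B]

namespace CartanGeometry

variable {C : CartanGeometry M (F := F) B} {cov : Conn M} {x₀ : M} {A : SL3} {τ : M → B}
variable {hh : Fin 2 → Fin 2 → B → ℂ} {hv : Fin 2 → B → ℂ} {h : B → ℝ} {U : Set B}

theorem IsAdaptedSection.contMDiffAt_hh (hτ : C.IsAdaptedSection cov x₀ A τ)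
    (hsol : C.IsSolutionOn hh hv h U) (hUo : IsOpen U) {y : M}
    (hy : y ∈ (chartAt CSq x₀).source) (hyU : τ y ∈ U) :
    ContMDiffAt 𝓘(ℝ, CSq) 𝓘(ℝ, Fin 2 → Fin 2 → ℂ) ∞ (fun p i j => hh i j (τ p)) y :=
  contMDiffAt_pi_space.2 fun i => contMDiffAt_pi_space.2 fun j =>
    ((hsol.smooth_hh i j _ hyU).contMDiffAt (hUo.mem_nhds hyU)).comp y (hτ.contMDiffAt hy)

theorem IsAdaptedSection.contMDiffAt_metricCoeff [T2Space M] (hcov : IsComplexLinearOn cov univ)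
    (hτ : C.IsAdaptedSection cov x₀ A τ) (hsol : C.IsSolutionOn hh hv h U) (hUo : IsOpen U)
    (hxU : τ x₀ ∈ U) (hdet : hdet hh (τ x₀) ≠ 0) :
    ContMDiffAt 𝓘(ℝ, CSq) 𝓘(ℝ, CSq) ∞ (metricCoeff cov hh hv x₀ A τ) x₀ := by
  have hx := mem_chart_source CSq x₀
  have hc : cdet (fun i j => hh i j (τ x₀)) ≠ 0 := by
    rw [cdet_eq_hdet (hsol.hermitian _ hxU)]; exact_mod_cast hdet
  have h2 : ContMDiffAt 𝓘(ℝ, CSq) 𝓘(ℝ, CSq) ∞ (fun p j => hv j (τ p)) x₀ :=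
    contMDiffAt_pi_space.2 fun j =>
      ((hsol.smooth_hv j _ hxU).contMDiffAt (hUo.mem_nhds hxU)).comp x₀ (hτ.contMDiffAt hx)
  have h3 : ContMDiffAt 𝓘(ℝ, CSq) 𝓘(ℝ, CSq) ∞
      (fun p k => ∑ l, christoffel cov (chartAt CSq x₀) l l k p) x₀ := by
    refine contMDiffAt_pi_space.2 fun k => ?_
    simp only [Fin.sum_univ_two]
    have hΓ (l : Fin 2) := (contMDiffOn_christoffel hcov x₀ l l k).contMDiffAt
      ((chartAt CSq x₀).open_source.mem_nhds hx)
    exact (hΓ 0).add (hΓ 1)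
  exact ContMDiffAt.comp x₀ (f := fun p => (fun i j => hh i j (τ p), fun j => hv j (τ p),
      fun k => ∑ l, christoffel cov (chartAt CSq x₀) l l k p))
    (contDiffAt_metricCoeff (solderMat A) (fun i => A.1 0 i.succ / A.1 0 0) hc).contMDiffAt
    ((hτ.contMDiffAt_hh hsol hUo hx hxU).prodMk_space (h2.prodMk_space h3))

theorem IsAdaptedSection.bform_eq (hτ : C.IsAdaptedSection cov x₀ A τ)
    (hsol : C.IsSolutionOn hh hv h U) {y : M} (hy : y ∈ (chartAt CSq x₀).source) (hyU : τ y ∈ U)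
    (u v : TangentSpace 𝓘(ℝ, CSq) y) :
    C.bform hh (τ y) u v = localForm (fun i j => hh i j (τ y), solderL A (chartD x₀ y u),
      solderL A (chartD x₀ y v)) := by
  refine (bform_eq_localForm (hsol.hermitian _ hyU) _ _).trans ?_
  exact congrArg₂ (fun a b : CSq => localForm (fun i j => hh i j (τ y), a, b))
    (hτ.solder_eq hy u) (hτ.solder_eq hy v)

/-- Invariance makes the choice of a point in each fibre harmless, so near any point of the image
`g` can be computed along an adapted section with values in `U'`. -/
theorem IsGeometryOf.descendsOn [T2Space M] (hcov : IsComplexLinearOn cov univ)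
    (hC : C.IsGeometryOf cov) (hsol : C.IsSolutionOn hh hv h U) (hUo : IsOpen U)
    (hdet : ∀ b ∈ U, hdet hh b ≠ 0) {U' : Set B} (hU' : IsOpen U') (hsub : U' ⊆ U)
    (hinv : ∀ b ∈ U', ∀ b' ∈ U', C.proj b = C.proj b' → C.bform hh b = C.bform hh b') :
    C.DescendsOn cov hh U' := by
  classical
  let g : BilinField M := fun x =>
    if hx : ∃ b ∈ U', C.proj b = x then C.bform hh hx.choose else (0 : CSq →L[ℝ] CSq →L[ℝ] ℝ)
  have hgb : ∀ b ∈ U', ∀ x, C.proj b = x → ∀ u v : TangentSpace 𝓘(ℝ, CSq) x,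
      g x u v = C.bform hh b u v := by
    intro b hb x hx u v
    have hex : ∃ b ∈ U', C.proj b = x := ⟨b, hb, hx⟩
    have h1 : g x = C.bform hh hex.choose := dif_pos hex
    have h2 := hinv _ hex.choose_spec.1 b hb (hex.choose_spec.2.trans hx.symm)
    exact congrArg (fun L : CSq →L[ℝ] CSq →L[ℝ] ℝ => L u v) (h1.trans h2)
  have hsec : ∀ x ∈ C.proj '' U', ∃ A τ, C.IsAdaptedSection cov x A τ ∧ τ x ∈ U' ∧
      ∀ᶠ y in 𝓝 x, y ∈ (chartAt CSq x).source ∧ τ y ∈ U' := by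
    rintro x ⟨b, hb, rfl⟩
    obtain ⟨A, τ, hτ, hτb⟩ := hC.exists_isAdaptedSection b
    have hx := mem_chart_source CSq (C.proj b)
    refine ⟨A, τ, hτ, hτb.symm ▸ hb, ?_⟩
    filter_upwards [(chartAt CSq (C.proj b)).open_source.mem_nhds hx,
      (hτ.contMDiffAt hx).continuousAt.preimage_mem_nhds (hU'.mem_nhds (hτb.symm ▸ hb))]
      with y h1 h2 using ⟨h1, h2⟩
  have hgloc : ∀ {x A τ}, C.IsAdaptedSection cov x A τ → ∀ y ∈ (chartAt CSq x).source, τ y ∈ U' →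
      ∀ u v : TangentSpace 𝓘(ℝ, CSq) y, g y u v = localForm (fun i j => hh i j (τ y),
        solderL A (chartD x y u), solderL A (chartD x y v)) := by
    intro x A τ hτ y hy hyU u v
    rw [hgb (τ y) hyU y (hτ.proj_eq y hy), ← hτ.bform_eq hsol hy (hsub hyU)]
  have hopen : IsOpen (C.proj '' U') := by
    rw [isOpen_iff_mem_nhds]
    intro x hx
    obtain ⟨A, τ, hτ, -, hev⟩ := hsec x hx
    filter_upwards [hev] with y hy
    exact ⟨τ y, hy.2, hτ.proj_eq y hy.1⟩
  have hcdet : ∀ b ∈ U', cdet (fun i j => hh i j b) ≠ 0 := fun b hb => by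
    rw [cdet_eq_hdet (hsol.hermitian b (hsub hb))]
    exact_mod_cast hdet b (hsub hb)
  have hcdet' : ∀ b ∈ U', (cdet (fun i j => hh i j b)).re ≠ 0 := fun b hb => by
    rw [cdet_eq_hdet (hsol.hermitian b (hsub hb)), Complex.ofReal_re]
    exact hdet b (hsub hb)
  have hmetric : IsMetricOn g (C.proj '' U') := by
    refine ⟨?_, ?_, ?_⟩
    · intro v₀ hv₀
      obtain ⟨A, τ, hτ, hτU, hev⟩ := hsec v₀.proj hv₀
      have hx := mem_chart_source CSq v₀.proj
      refine ContMDiffAt.contMDiffWithinAt ?_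
      have hproj : ContMDiffAt 𝓘(ℝ, CSq).tangent 𝓘(ℝ, CSq) ∞
          (fun v : TangentBundle 𝓘(ℝ, CSq) M => v.proj) v₀ :=
        Bundle.contMDiff_proj (TangentSpace 𝓘(ℝ, CSq)) v₀
      have hsnd := Bundle.contMDiffAt_totalSpace.1
        (contMDiffAt_id (I := 𝓘(ℝ, CSq).tangent) (n := ∞) (x := v₀))
      have hev' := hproj.continuousAt.eventually hev
      have hs : ContMDiffAt 𝓘(ℝ, CSq).tangent 𝓘(ℝ, CSq) ∞
          (fun v : TangentBundle 𝓘(ℝ, CSq) M => solderL A (chartD v₀.proj v.proj v.snd)) v₀ := by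
        refine ((solderL A).contMDiff.contMDiffAt.comp v₀ hsnd.2).congr_of_eventuallyEq ?_
        filter_upwards [hev'] with v hvv
        exact congrArg (solderL A) (trivializationAt_snd hvv.1 v.snd).symm
      have hH : ContMDiffAt 𝓘(ℝ, CSq).tangent 𝓘(ℝ, Fin 2 → Fin 2 → ℂ) ∞
          (fun (v : TangentBundle 𝓘(ℝ, CSq) M) i j => hh i j (τ v.proj)) v₀ :=
        ContMDiffAt.comp v₀ (hτ.contMDiffAt_hh hsol hUo hx (hsub hτU)) hproj
      have hL := ContMDiffAt.comp v₀ (f := fun v : TangentBundle 𝓘(ℝ, CSq) M =>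
          (fun i j => hh i j (τ v.proj), solderL A (chartD v₀.proj v.proj v.snd),
            solderL A (chartD v₀.proj v.proj v.snd)))
        (contDiffAt_localForm (r := (fun i j => hh i j (τ v₀.proj),
          solderL A (chartD v₀.proj v₀.proj v₀.snd), solderL A (chartD v₀.proj v₀.proj v₀.snd)))
          (hcdet' _ hτU)).contMDiffAt (hH.prodMk_space (hs.prodMk_space hs))
      refine hL.congr_of_eventuallyEq ?_
      filter_upwards [hev'] with v hvv
      exact hgloc hτ v.proj hvv.1 hvv.2 v.snd v.snd
    · intro x hx u v
      obtain ⟨A, τ, hτ, hτU, -⟩ := hsec x hx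
      have hxs := mem_chart_source CSq x
      rw [hgloc hτ x hxs hτU, hgloc hτ x hxs hτU, localForm, localForm]
      simp only
      rw [← conj_sform (hsol.hermitian _ (hsub hτU)), Complex.conj_re]
    · intro x hx u hu
      obtain ⟨A, τ, hτ, hτU, -⟩ := hsec x hx
      have hxs := mem_chart_source CSq x
      have h1 : solderL A (chartD x x u) = 0 := by
        refine eq_zero_of_sform_re (hcdet _ hτU) fun y => ?_
        obtain ⟨w, rfl⟩ := solderL_surjective hτ.mem y
        have h2 := hu (constField x w x)
        rw [hgloc hτ x hxs hτU, localForm, chartD_constField hxs] at h2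
        exact (div_eq_zero_iff.1 h2).resolve_right (pow_ne_zero 2 (hcdet' _ hτU))
      apply chartD_injective hxs
      rw [solderL_eq_zero hτ.mem h1, map_zero]
  have hherm : ∀ x ∈ C.proj '' U', ∀ v w, g x (J x v) (J x w) = g x v w := by
    intro x hx u v
    obtain ⟨A, τ, hτ, hτU, -⟩ := hsec x hx
    have hxs := mem_chart_source CSq x
    rw [hgloc hτ x hxs hτU, hgloc hτ x hxs hτU, localForm, localForm]
    simp only [chartD_J hxs, solderL_I_smul, sform_I_smul]
  have hloc : ∀ x ∈ C.proj '' U', ∃ a : M → CSq →L[ℝ] ℂ,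
      ContMDiffAt 𝓘(ℝ, CSq) 𝓘(ℝ, CSq →L[ℝ] ℂ) ∞ a x ∧
      ∀ᶠ y in 𝓝 x, IsMetricCovector g cov y ((a y).comp (chartD x y)) := by
    intro x hx
    obtain ⟨A, τ, hτ, hτU, hev⟩ := hsec x hx
    refine ⟨fun y => covL (metricCoeff cov hh hv x A τ y), covL.contMDiff.contMDiffAt.comp x
      (hτ.contMDiffAt_metricCoeff hcov hsol hUo (hsub hτU) (hdet _ (hsub hτU))), ?_⟩
    -- Parallelism at `y` involves derivatives of `g`, so the section must stay in `U'` on a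
    -- neighbourhood of `y`.
    filter_upwards [hev.eventually_nhds] with y hy
    refine hτ.isMetricCovector hcov hsol hUo hy.self_of_nhds.1 (hsub hy.self_of_nhds.2)
      (hdet _ (hsub hy.self_of_nhds.2)) ?_
    filter_upwards [hy] with p hp
    exact hgb (τ p) hp.2 p (hτ.proj_eq p hp.1)
  obtain ⟨hK, hcomp⟩ := isPseudoKahlerOn_and_isCompatibleOn hcov hopen hmetric hherm hloc
  exact ⟨hopen, g, hK, hcomp, fun b hb w =>
    (hC.quadForm_eq hh b w).trans (hgb b hb _ rfl _ _).symm⟩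

/-- The parameters are confined to a ball, whose convexity keeps the segments from the identity
among nonsingular parameters that map into `U`. -/
theorem IsGeometryOf.exists_bform_orbit_eq (hC : C.IsGeometryOf cov)
    (hsol : C.IsSolutionOn hh hv h U) (hUo : IsOpen U) {b : B} (hb : b ∈ U) :
    ∃ A τ, C.IsAdaptedSection cov (C.proj b) A τ ∧ τ (C.proj b) = b ∧
      ∃ S ∈ 𝓝 (C.proj b), ∃ T ∈ 𝓝 parOne, ∀ y ∈ S, y ∈ (chartAt CSq (C.proj b)).source ∧
        ∀ q ∈ T, C.orbit (τ y) q ∈ U ∧ C.bform hh (C.orbit (τ y) q) = C.bform hh (τ y) := by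
  obtain ⟨A, τ, hτ, hτb⟩ := hC.exists_isAdaptedSection b
  have hx := mem_chart_source CSq (C.proj b)
  have hcont : ContinuousAt (fun r : M × Par => C.orbit (τ r.1) r.2) (C.proj b, parOne) :=
    ContinuousAt.comp (g := fun r : B × Par => C.orbit r.1 r.2)
      (f := fun r : M × Par => (τ r.1, r.2)) (x := (C.proj b, parOne))
      (C.contMDiffAt_act (by simp)).continuousAt
      ((ContinuousAt.comp (f := Prod.fst) (x := (C.proj b, parOne)) (hτ.contMDiffAt hx).continuousAt
        continuousAt_fst).prodMk continuousAt_snd)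
  have hU : ∀ᶠ r : M × Par in 𝓝 (C.proj b, parOne), C.orbit (τ r.1) r.2 ∈ U :=
    hcont.eventually (hUo.mem_nhds (by simpa [hτb] using hb))
  rw [nhds_prod_eq] at hU
  obtain ⟨S, hS, T, hT, hST⟩ := eventually_prod_iff.1 hU
  have hT' : ∀ᶠ q in 𝓝 parOne, T q ∧ pdet q ≠ 0 :=
    hT.and (continuous_pdet.continuousAt.eventually_ne (by simp))
  obtain ⟨ε, hε, hball⟩ := Metric.eventually_nhds_iff_ball.1 hT'
  refine ⟨A, τ, hτ, hτb, {y | S y} ∩ (chartAt CSq (C.proj b)).source,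
    inter_mem hS ((chartAt CSq _).open_source.mem_nhds hx), Metric.ball parOne ε,
    Metric.ball_mem_nhds _ hε, fun y hy => ⟨hy.2, fun q hq => ?_⟩⟩
  have hseg : ∀ t ∈ Icc (0 : ℝ) 1, parOne + t • (q - parOne) ∈ Metric.ball parOne ε := fun t ht =>
    (convex_ball parOne ε).add_smul_sub_mem (Metric.mem_ball_self hε) hq ht
  exact ⟨hST hy.1 (hball q hq).1, hC.bform_orbit hsol hUo (τ y) fun t ht =>
    ⟨(hball _ (hseg t ht)).2, hST hy.1 (hball _ (hseg t ht)).1⟩⟩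

/-- On a product neighbourhood, two points over the same `y` are both translates of `τ y` by
admissible parameters, so their forms agree with the one at `τ y`. -/
theorem IsGeometryOf.exists_descendsOn [T2Space M] [CompleteSpace F]
    (hcov : IsComplexLinearOn cov univ) (hC : C.IsGeometryOf cov)
    (hsol : C.IsSolutionOn hh hv h U) (hUo : IsOpen U) (hdet : ∀ b ∈ U, hdet hh b ≠ 0) {b : B}
    (hb : b ∈ U) : ∃ U' : Set B, IsOpen U' ∧ b ∈ U' ∧ U' ⊆ U ∧ C.DescendsOn cov hh U' := by
  obtain ⟨A, τ, hτ, hτb, S, hS, T, hT, hST⟩ := hC.exists_bform_orbit_eq hsol hUo hb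
  have hN := hτ.image_orbit_mem_nhds hS hT
  rw [hτb] at hN
  have hsub : interior {b' | ∃ y ∈ S, ∃ q ∈ T, C.orbit (τ y) q = b'} ⊆ U := by
    intro b' hb'
    obtain ⟨y, hy, q, hq, rfl⟩ := interior_subset hb'
    exact ((hST y hy).2 q hq).1
  refine ⟨_, isOpen_interior, mem_interior_iff_mem_nhds.2 hN, hsub,
    hC.descendsOn hcov hsol hUo hdet isOpen_interior hsub ?_⟩
  intro b₁ hb₁ b₂ hb₂ h12
  obtain ⟨y₁, hy₁, q₁, hq₁, rfl⟩ := interior_subset hb₁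
  obtain ⟨y₂, hy₂, q₂, hq₂, rfl⟩ := interior_subset hb₂
  rw [orbit, orbit, C.proj_act, C.proj_act, hτ.proj_eq _ (hST y₁ hy₁).1,
    hτ.proj_eq _ (hST y₂ hy₂).1] at h12
  subst h12
  rw [((hST y₁ hy₁).2 q₁ hq₁).2, ((hST y₁ hy₁).2 q₂ hq₂).2]

/-- Product neighbourhoods show that the form is locally constant on each fibre of `U`;
connectedness makes it constant. -/
theorem IsGeometryOf.descendsOn_of_isPreconnected [T2Space M] [CompleteSpace F]
    (hcov : IsComplexLinearOn cov univ) (hC : C.IsGeometryOf cov)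
    (hsol : C.IsSolutionOn hh hv h U) (hUo : IsOpen U) (hdet : ∀ b ∈ U, hdet hh b ≠ 0)
    (hfib : ∀ x : M, IsPreconnected (U ∩ C.proj ⁻¹' {x})) : C.DescendsOn cov hh U := by
  refine hC.descendsOn hcov hsol hUo hdet hUo subset_rfl fun b hb b' hb' hbb' => ?_
  refine (hfib (C.proj b)).induction₂ (fun b₁ b₂ => C.bform hh b₁ = C.bform hh b₂) ?_
    (fun _ _ _ _ _ _ h₁ h₂ => h₁.trans h₂) (fun _ _ _ _ h₁ => h₁.symm) ⟨hb, rfl⟩ ⟨hb', hbb'.symm⟩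
  rintro b₁ ⟨hb₁, hx₁⟩
  obtain ⟨A, τ, hτ, hτb, S, hS, T, hT, hST⟩ := hC.exists_bform_orbit_eq hsol hUo hb₁
  have hN := hτ.image_orbit_mem_nhds hS hT
  rw [hτb] at hN
  filter_upwards [mem_nhdsWithin_of_mem_nhds hN, self_mem_nhdsWithin] with b₂ hb₂ hx₂
  obtain ⟨y, hy, q, hq, rfl⟩ := hb₂
  have hy' : y = C.proj b₁ := by
    have := hx₂.2
    rw [mem_preimage, orbit, C.proj_act, hτ.proj_eq _ (hST y hy).1] at this
    exact (mem_singleton_iff.1 this).trans (mem_singleton_iff.1 hx₁).symm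
  rw [((hST y hy).2 q hq).2, hy', hτb]

end CartanGeometry
end Descent

end CProj

end

theorem mainTheorem2
    {M : Type*} [TopologicalSpace M] [T2Space M] [ChartedSpace CProj.CSq M]
    [IsManifold 𝓘(ℂ, CProj.CSq) ω M]
    {F : Type*} [NormedAddCommGroup F] [NormedSpace ℝ F] [FiniteDimensional ℝ F]
    {B : Type*} [TopologicalSpace B] [ChartedSpace F B] [IsManifold 𝓘(ℝ, F) ∞ B]
    (cov : CProj.Conn M) (hcov : CProj.IsComplexLinearOn cov Set.univ)
    (C : CProj.CartanGeometry M (F := F) B) (hC : C.IsGeometryOf cov)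
    (U : Set B) (hUo : IsOpen U) (hUc : IsConnected U)
    (hh : Fin 2 → Fin 2 → B → ℂ) (hv : Fin 2 → B → ℂ) (h : B → ℝ)
    (hsol : C.IsSolutionOn hh hv h U)
    (hdet : ∀ b ∈ U, CProj.CartanGeometry.hdet hh b ≠ 0) :
    (∀ b ∈ U, ∃ U' : Set B, IsOpen U' ∧ b ∈ U' ∧ U' ⊆ U ∧ C.DescendsOn cov hh U') ∧
    ((∀ x : M, IsPreconnected (U ∩ C.proj ⁻¹' {x})) → C.DescendsOn cov hh U) := by
  -- Completeness feeds the open mapping argument of `image_mem_nhds_of_surjective_mfderiv`.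
  have : CompleteSpace F := FiniteDimensional.complete ℝ F
  exact ⟨fun _ hb => hC.exists_descendsOn hcov hsol hUo hdet hb,
    hC.descendsOn_of_isPreconnected hcov hsol hUo hdet⟩
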